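/- **Theorem 2.1.** Let $-\infty\le\alpha<\beta<\infty$; for $\alpha=-\infty$ the symbol $[\alpha,\beta]$ stands for $(-\infty,\beta]$ (and, in the Riemann sphere $\overline{\mathbb C}$, for $(-\infty,\beta]\cup\{\infty\}$). Let $\mu$ be a positive measure on $\mathbb R$ whose support is an infinite subset of $[\alpha,\beta]$ and for which the integral defining the Markov function $$f^{[\mu]}(z)=\int\frac{d\mu(x)}{z-x},\qquad z\in\mathbb C\setminus[\alpha,\beta],$$ converges. Let $\nu$ be the measure on $[\alpha,\beta]$ with density $$\frac{d\nu}{dx}(x)=\frac{\sqrt{|\alpha|}}{\pi\sqrt{(x-\alpha)(\beta-x)}}\quad(\alpha\text{ finite},\ \alpha\ne0),\qquad \frac{d\nu}{dx}(x)=\frac{1}{\pi\sqrt{\beta-x}}\quad(\alpha=-\infty),$$ where for $\alpha=0$ the factor $\sqrt{|\alpha|}$ is replaced by $1$, and let $f^{[\nu]}(z)=\int\frac{d\nu(x)}{z-x}$. Let $\mathbb E\subset\mathbb R\setminus[\alpha,\beta]$, let $m\ge1$, and let $z_1,\dots,z_{2m}\in\mathbb C\setminus[\alpha,\beta]$, not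 necessarily distinct, be such that $w$ and $\overline w$ occur equally often among them for every $w\in\mathbb C$. Then for $\sigma\in\{\mu,\nu\}$ there is exactly one rational function $r_m^{[\sigma]}$ of numerator degree at most $m-1$ and denominator degree at most $m$ that has no poles at $z_1,\dots,z_{2m}$ and interpolates $f^{[\sigma]}$ there in the sense of Hermite (at a point occurring $k$ times, the derivatives of orders $0,\dots,k-1$ agree). On $\mathbb E$, $r_m^{[\sigma]}$ has no poles and $f^{[\sigma]}$ has no zeros. Write $\|g\|_{\mathbb E}=\sup_{x\in\mathbb E}|g(x)|\in[0,\infty]$. Let $\varphi$ be any conformal bijection from $\overline{\mathbb C}\setminus[\alpha,\beta]$ onto the complement in $\overline{\mathbb C}$ of the closed unit disk that satisfies $\varphi(\overline z)=\overline{\varphi(z)}$, and put $$G_{2m}(z)=\prod_{j=1}^{2m}\frac{\varphi(z)-\varphi(z_j)}{1-\varphi(z)\varphi(z_j)},\qquad \eta_{2m}=\sup_{z\in\mathbb E}|G_{2m}(z)|,$$ the factors being extended by continuity where $\varphi(z)=\infty$ or $\varphi(z_j)=\infty$. 1. (General case.) Always $$\Bigl\|\frac{f^{[\mu]}-r_m^{[\mu]}}{f^{[\mu]}}\Bigr\|_{\mathbb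 E}\le\Bigl\|1-\Bigl(\frac{r_m^{[\nu]}}{f^{[\nu]}}\Bigr)^2\Bigr\|_{\mathbb E}\le\frac{4\,\eta_{2m}}{(1-\eta_{2m})^2},$$ where the last term is read as $+\infty$ if $\eta_{2m}=1$. 2. (Positive case.) Suppose that every real number occurs an even number of times among $z_1,\dots,z_{2m}$. Alternatively, suppose that $\mathbb E$ is a finite union of nondegenerate (possibly unbounded) closed intervals, that every point of $\mathrm{Int}(\mathbb E)$ occurs an even number of times among the $z_j$, and that every connected component of $\mathbb R\setminus(\mathrm{Int}(\mathbb E)\cup[\alpha,\beta])$ contains an even number of the $z_j$, counted with multiplicity. Then $$\Bigl\|\frac{f^{[\mu]}-r_m^{[\mu]}}{f^{[\mu]}}\Bigr\|_{\mathbb E}\le2\,\Bigl\|\frac{f^{[\nu]}-r_m^{[\nu]}}{f^{[\nu]}}\Bigr\|_{\mathbb E}\le4\,\eta_{2m}.$$ -/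

import Mathlib

open MeasureTheory Set OnePoint


noncomputable section

/-- The real interval `[α, β]` for `-∞ ≤ α < β < ∞`; for `α = -∞` this is `(-∞, β]`. -/
def realCut (α : EReal) (β : ℝ) : Set ℝ := {x : ℝ | α ≤ (x : EReal) ∧ x ≤ β}

/-- The interval `[α, β]` as a subset of the complex plane. -/
def complexCut (α : EReal) (β : ℝ) : Set ℂ := {z : ℂ | ∃ x ∈ realCut α β, z = (x : ℂ)}

/-- The interval `[α, β]` as a (closed) subset of the Riemann sphere; it contains `∞` exactly
when `α = -∞`. -/
def sphereCut (α : EReal) (β : ℝ) : Set (OnePoint ℂ) :=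
  {p | (∃ x ∈ realCut α β, p = ((x : ℂ) : OnePoint ℂ)) ∨ (α = ⊥ ∧ p = ∞)}

/-- The Markov function (Cauchy transform) `z ↦ ∫ dμ(x) / (z - x)` of a measure on the line. -/
def markov (μ : Measure ℝ) (z : ℂ) : ℂ := ∫ x : ℝ, 1 / (z - (x : ℂ)) ∂μ

/-- The positive measures that generate Markov functions on `[α, β]`: the support is an infinite
subset of `[α, β]`, and the integral defining the Markov function converges off `[α, β]`. -/
structure IsMarkovMeasure (α : EReal) (β : ℝ) (μ : Measure ℝ) : Prop where
  support_subset : μ.support ⊆ realCut α β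
  support_infinite : μ.support.Infinite
  integrable : ∀ z : ℂ, z ∉ complexCut α β → Integrable (fun x : ℝ => 1 / (z - (x : ℂ))) μ

/-- The density of the (scaled) equilibrium measure: `√|α| / (π √((x - α)(β - x)))` for finite
`α ≠ 0`, and the limiting density `1 / (π √(β - x))` for `α = -∞`. For `α = 0` the factor `√|α|`
would annihilate the measure; since the scaling is immaterial for relative errors, it is replaced
by `1` in that case. -/
def nuDensity (α : EReal) (β x : ℝ) : ℝ :=
  if α = ⊥ then 1 / (Real.pi * √(β - x))
  else (if α = 0 then 1 else √|α.toReal|) / (Real.pi * √((x - α.toReal) * (β - x)))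

/-- The measure `ν` on `[α, β]` with density `nuDensity`. -/
def nu (α : EReal) (β : ℝ) : Measure ℝ :=
  (volume.restrict (realCut α β)).withDensity fun x => ENNReal.ofReal (nuDensity α β x)

/-- The number of occurrences of `w` among the interpolation points. -/
def pointMultiplicity {n : ℕ} (z : Fin n → ℂ) (w : ℂ) : ℕ := Set.ncard {j | z j = w}

/-- The value of a rational function at a point which is not a pole. -/
def ratVal (r : RatFunc ℂ) (z : ℂ) : ℂ := r.eval (RingHom.id ℂ) z

/-- `r` is a rational interpolant of type `[m-1|m]` of `f` at `z_1, …, z_{2m}`: numerator degree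
at most `m - 1`, denominator degree at most `m`, and at each interpolation point `w` of
multiplicity `k`, `r` is finite and its derivatives of orders `0, …, k - 1` agree with those
of `f` (interpolation in the sense of Hermite). -/
structure IsRationalInterpolant (m : ℕ) (z : Fin (2 * m) → ℂ) (f : ℂ → ℂ) (r : RatFunc ℂ) :
    Prop where
  num_degree : r.num.degree < (m : WithBot ℕ)
  denom_degree : r.denom.natDegree ≤ m
  denom_ne_zero : ∀ j, r.denom.eval (z j) ≠ 0
  interpolates : ∀ j, ∀ k < pointMultiplicity z (z j),
    iteratedDeriv k (ratVal r) (z j) = iteratedDeriv k f (z j)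

/-- The supremum norm over the real set `E`, with values in `[0, ∞]`. -/
def supNormOn (E : Set ℝ) (g : ℂ → ℂ) : ENNReal := ⨆ x ∈ E, ‖g (x : ℂ)‖ₑ

/-- The relative error `‖(f - r) / f‖` in the supremum norm over `E`. -/
def relError (E : Set ℝ) (f : ℂ → ℂ) (r : RatFunc ℂ) : ENNReal :=
  supNormOn E fun z => (f z - ratVal r z) / f z

/-- The complement of the closed unit disk in the Riemann sphere. -/
def exteriorDisk : Set (OnePoint ℂ) := {p | p = ∞ ∨ ∃ w : ℂ, 1 < ‖w‖ ∧ p = (w : OnePoint ℂ)}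

/-- The coordinate `w ↦ 1 / w` of the Riemann sphere, with `∞ ↦ 0`; it is a chart on the sphere
without the origin, hence on all of `exteriorDisk`. -/
def recipChart : OnePoint ℂ → ℂ
  | ∞ => 0
  | (w : ℂ) => w⁻¹

/-- The inverse chart of the sphere at `∞`, that is, `ζ ↦ 1 / ζ` with `0 ↦ ∞`. -/
def chartAtInfty (ζ : ℂ) : OnePoint ℂ := open scoped Classical in
  if ζ = 0 then ∞ else ((ζ⁻¹ : ℂ) : OnePoint ℂ)

/-- `φ` maps the complement of `[α, β]` in the Riemann sphere conformally (holomorphically and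
bijectively) onto the complement of the closed unit disk, and is compatible with complex
conjugation. Holomorphy is expressed in the chart `recipChart` of the target and in the charts
`z` and `1 / z` of the source. -/
structure IsConformalExteriorMap (α : EReal) (β : ℝ) (φ : OnePoint ℂ → OnePoint ℂ) : Prop where
  bijOn : BijOn φ (sphereCut α β)ᶜ exteriorDisk
  holomorphic : DifferentiableOn ℂ (fun z : ℂ => recipChart (φ (z : OnePoint ℂ)))
    (complexCut α β)ᶜ
  holomorphic_infty : ∞ ∉ sphereCut α β →
    ∃ U ∈ nhds (0 : ℂ), DifferentiableOn ℂ (fun ζ : ℂ => recipChart (φ (chartAtInfty ζ))) U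
  map_conj : ∀ p ∉ sphereCut α β,
    φ (OnePoint.map (starRingEnd ℂ) p) = OnePoint.map (starRingEnd ℂ) (φ p)

/-- The Blaschke-type factor `(w - v) / (1 - w v)` for `w`, `v` in the exterior of the closed unit
disk, with its continuous extension to `w = ∞` or `v = ∞`. -/
def blaschkeFactor : OnePoint ℂ → OnePoint ℂ → ℂ
  | (w : ℂ), (v : ℂ) => (w - v) / (1 - w * v)
  | ∞, (v : ℂ) => -v⁻¹
  | (w : ℂ), ∞ => w⁻¹
  | ∞, ∞ => 0

/-- `G(z) = ∏_j (φ(z) - φ(z_j)) / (1 - φ(z) φ(z_j))`. -/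
def blaschkeProduct (φ : OnePoint ℂ → OnePoint ℂ) {n : ℕ} (z : Fin n → ℂ) (x : ℂ) : ℂ :=
  ∏ j, blaschkeFactor (φ (x : OnePoint ℂ)) (φ (z j : OnePoint ℂ))

/-- `η = sup_{x ∈ E} |G(x)|`. -/
def eta (φ : OnePoint ℂ → OnePoint ℂ) (E : Set ℝ) {n : ℕ} (z : Fin n → ℂ) : ENNReal :=
  supNormOn E (blaschkeProduct φ z)

/-- `E` is a finite union of nondegenerate closed intervals (possibly unbounded). -/
def IsFiniteUnionOfIntervals (E : Set ℝ) : Prop :=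
  ∃ S : Set (Set ℝ), S.Finite ∧ E = ⋃₀ S ∧
    ∀ J ∈ S, IsClosed J ∧ J.OrdConnected ∧ (interior J).Nonempty

/-- The positive case: either all real interpolation points have even multiplicity, or `E` is a
finite union of nondegenerate closed intervals, the interpolation points in the interior of `E`
have even multiplicity, and every maximal subinterval of the complement of `Int(E)` in
`ℝ \ [α, β]` contains an even number of interpolation points (with multiplicity). -/
def PositiveCase (α : EReal) (β : ℝ) (E : Set ℝ) {n : ℕ} (z : Fin n → ℂ) : Prop :=
  (∀ x : ℝ, Even (pointMultiplicity z (x : ℂ))) ∨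
  (IsFiniteUnionOfIntervals E ∧
    (∀ x ∈ interior E, Even (pointMultiplicity z (x : ℂ))) ∧
    ∀ x ∈ (interior E ∪ realCut α β)ᶜ,
      Even (Set.ncard {j | ∃ y ∈ connectedComponentIn (interior E ∪ realCut α β)ᶜ x,
        z j = (y : ℂ)}))

end

/-!
# Relative errors of multipoint Padé approximants of Markov functions

All relative errors at a real point `x` off the cut are compared with one real number `B = B(x)` in
`(-1, 1)`. Let `s = √y`, where `y` is the Möbius coordinate that sends the cut to the negative
half-line; `s` maps the complement of the cut conformally to the right half-plane, and
`B = ∏_j (s - s_j) / (s + s_j)` is a Blaschke product of the nodes in this coordinate.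

* The Markov function of `ν` is `c / ((a + b z) s)`, and the even and odd parts of the polynomial
  `∏_j (s + s_j)` in `s` give its interpolant explicitly, with
  `r^ν / f^ν = (1 - B) / (1 + B)`. Hence `1 - (r^ν / f^ν)² = 4 B / (1 + B)²` and
  `1 - r^ν / f^ν = 2 B / (1 + B)` (`IsSlitParam.exists_explicit`,
  `IsSlitParam.isRationalInterpolant_nu`).

* For `μ`, let `ω` be the node polynomial. The denominator `q` of the interpolant is orthogonal with
  respect to `dμ / ω`, so that its zeros lie on the cut and
  `f - r = (ω / q²) ∫ q(t)² / (ω(t) (x - t)) dμ(t)` at `x`. On the cut `1 / (ω(t) (x - t))` has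
  constant sign, and by orthogonality `q` minimizes the integral among the polynomials with the same
  value at `x`. Any `Q` of degree at most `m` with `Q² ≤ M |ω|` on the cut therefore gives
  `|f - r| Q(x)² ≤ M |ω(x)| |f(x)|` (`IsMarkovMeasure.extremal`,
  `IsMarkovMeasure.exists_interpolant`). With the denominator of `r^ν` for `Q` this reads
  `|(f - r) / f| ≤ 4 |B| / (1 + B)²`, which is the modulus of `1 - (r^ν / f^ν)²`
  (`IsSlitParam.exists_interpolants`).

* For an arbitrary conformal map `φ`, the Schwarz lemma applied to the composition of
  `(s - s(x)) / (s + s(x))` with the inverse of the corresponding factor of `G` gives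
  `|B| ≤ |G(x)|` (`IsSlitParam.norm_root_factor_le`). This yields the bounds in terms of `η`.

* Conjugate pairs contribute nonnegative factors to `B`, and a real node contributes a negative one
  exactly if `s_j > s`. Up to an even number of sign changes these are the real nodes between `x`
  and the cut, so that in the positive case parity gives `0 ≤ B` on `E`
  (`IsSlitParam.slitBlaschke_nonneg_of_positiveCase`), and then
  `4 B / (1 + B)² ≤ 2 · 2 B / (1 + B) ≤ 4 B`.
-/

/-! ### Hermite interpolation by rational functions -/

section Hermite

open Polynomial

/-- The node polynomial `∏_j (X - z_j)` of the interpolation points. -/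
noncomputable def nodePoly {n : ℕ} (z : Fin n → ℂ) : ℂ[X] := ∏ j, (X - C (z j))

theorem nodePoly_eval {n : ℕ} (z : Fin n → ℂ) (w : ℂ) :
    (nodePoly z).eval w = ∏ j, (w - z j) := by
  simp [nodePoly, eval_prod]

theorem nodePoly_monic {n : ℕ} (z : Fin n → ℂ) : (nodePoly z).Monic :=
  monic_prod_of_monic _ _ fun j _ => monic_X_sub_C (z j)

theorem nodePoly_natDegree {n : ℕ} (z : Fin n → ℂ) : (nodePoly z).natDegree = n := by
  simp [nodePoly, natDegree_prod_of_monic _ _ fun j _ => monic_X_sub_C (z j)]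

theorem pointMultiplicity_eq_card {n : ℕ} (z : Fin n → ℂ) (w : ℂ) :
    pointMultiplicity z w = (Finset.univ.filter fun j => z j = w).card := by
  rw [pointMultiplicity, ← Set.ncard_coe_finset]
  simp

theorem pointMultiplicity_eq_count {n : ℕ} (z : Fin n → ℂ) (w : ℂ) :
    pointMultiplicity z w = Multiset.count w (Finset.univ.val.map z) := by
  rw [pointMultiplicity_eq_card, Multiset.count_map, ← Finset.filter_val]
  simp only [Finset.card_val, eq_comm]

theorem pow_pointMultiplicity_dvd_nodePoly {n : ℕ} (z : Fin n → ℂ) (w : ℂ) :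
    (X - C w) ^ pointMultiplicity z w ∣ nodePoly z := by
  rw [pointMultiplicity_eq_card, nodePoly,
    ← Finset.prod_filter_mul_prod_filter_not Finset.univ (fun j => z j = w)]
  refine Dvd.intro _ (congrArg (· * _) ?_)
  rw [← Finset.prod_const]
  refine Finset.prod_congr rfl fun j hj => ?_
  rw [(Finset.mem_filter.1 hj).2]

theorem nodePoly_dvd {n : ℕ} (z : Fin n → ℂ) (D : ℂ[X])
    (h : ∀ j, (X - C (z j)) ^ pointMultiplicity z (z j) ∣ D) : nodePoly z ∣ D := by
  rcases eq_or_ne D 0 with rfl | hD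
  · exact dvd_zero _
  have h1 : nodePoly z = ((Finset.univ.val.map z).map fun a => X - C a).prod := by
    rw [Multiset.map_map]; rfl
  rw [h1, Multiset.prod_X_sub_C_dvd_iff_le_roots hD, Multiset.le_iff_count]
  intro a
  by_cases ha : a ∈ Finset.univ.val.map z
  · obtain ⟨j, -, rfl⟩ := Multiset.mem_map.1 ha
    rw [← pointMultiplicity_eq_count, count_roots, le_rootMultiplicity_iff hD]
    exact h j
  · rw [Multiset.count_eq_zero_of_notMem ha]
    exact Nat.zero_le _

theorem analyticAt_polynomial_eval (p : ℂ[X]) (a : ℂ) : AnalyticAt ℂ (fun x => p.eval x) a :=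
  p.differentiable.analyticAt a

theorem pow_dvd_of_le_analyticOrderAt {D : ℂ[X]} {a : ℂ} {k : ℕ}
    (h : (k : ℕ∞) ≤ analyticOrderAt (fun x => D.eval x) a) : (X - C a) ^ k ∣ D := by
  rcases eq_or_ne D 0 with rfl | hD
  · exact dvd_zero _
  obtain ⟨g, hg, hng⟩ := exists_eq_pow_rootMultiplicity_mul_and_not_dvd D hD a
  have h2 : analyticOrderAt (fun x => D.eval x) a = (D.rootMultiplicity a : ℕ) := by
    rw [(analyticAt_polynomial_eval D a).analyticOrderAt_eq_natCast]
    refine ⟨fun x => g.eval x, analyticAt_polynomial_eval g a,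
      fun h0 => hng (dvd_iff_isRoot.2 h0), ?_⟩
    refine Filter.Eventually.of_forall fun x => ?_
    conv_lhs => rw [hg]
    simp
  rw [h2, Nat.cast_le] at h
  exact (le_rootMultiplicity_iff hD).1 h

theorem ratVal_eq (r : RatFunc ℂ) (w : ℂ) : ratVal r w = r.num.eval w / r.denom.eval w := rfl

theorem analyticAt_ratVal {r : RatFunc ℂ} {w : ℂ} (h : r.denom.eval w ≠ 0) :
    AnalyticAt ℂ (ratVal r) w := by
  exact (analyticAt_polynomial_eval r.num w).div (analyticAt_polynomial_eval r.denom w) h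

/-- A rational interpolant is determined by the values it interpolates: for two interpolants
`p₁ / q₁` and `p₂ / q₂` the polynomial `p₁ q₂ - p₂ q₁` has degree less than `2m`, but `2m` zeros. -/
theorem IsRationalInterpolant.unique {m : ℕ} {z : Fin (2 * m) → ℂ} {f : ℂ → ℂ} {r r' : RatFunc ℂ}
    (h : IsRationalInterpolant m z f r) (h' : IsRationalInterpolant m z f r') : r = r' := by
  set D : ℂ[X] := r.num * r'.denom - r'.num * r.denom with hDdef
  have hdvd : nodePoly z ∣ D := by
    refine nodePoly_dvd z D fun j => pow_dvd_of_le_analyticOrderAt ?_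
    have han := analyticAt_ratVal (h.denom_ne_zero j)
    have han' := analyticAt_ratVal (h'.denom_ne_zero j)
    have hord : (pointMultiplicity z (z j) : ℕ∞) ≤
        analyticOrderAt (fun w => ratVal r w - ratVal r' w) (z j) := by
      rw [natCast_le_analyticOrderAt_iff_iteratedDeriv_eq_zero (han.fun_sub han')]
      intro i hi
      rw [iteratedDeriv_fun_sub han.contDiffAt han'.contDiffAt, h.interpolates j i hi,
        h'.interpolates j i hi, sub_self]
    have hpoly : AnalyticAt ℂ (fun x => (r.denom * r'.denom).eval x) (z j) :=
      analyticAt_polynomial_eval _ _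
    have heq : (fun x => D.eval x) =ᶠ[nhds (z j)]
        fun x => (r.denom * r'.denom).eval x * (ratVal r x - ratVal r' x) := by
      have hc : ∀ p : ℂ[X], p.eval (z j) ≠ 0 → ∀ᶠ x in nhds (z j), p.eval x ≠ 0 := fun p hp =>
        p.continuous.continuousAt.eventually_ne hp
      filter_upwards [hc _ (h.denom_ne_zero j), hc _ (h'.denom_ne_zero j)] with x h1 h2
      simp only [hDdef, eval_sub, eval_mul, ratVal_eq]
      field_simp
    rw [analyticOrderAt_congr heq]
    have := analyticOrderAt_mul hpoly (han.fun_sub han')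
    refine le_trans hord ?_
    have h3 : (fun x => (r.denom * r'.denom).eval x * (ratVal r x - ratVal r' x)) =
      (fun x => (r.denom * r'.denom).eval x) * (fun w => ratVal r w - ratVal r' w) := rfl
    rw [h3, this]
    exact le_add_self
  have hdeg : D.degree < (nodePoly z).degree := by
    rw [degree_eq_natDegree (nodePoly_monic z).ne_zero, nodePoly_natDegree]
    have key : ∀ p q : ℂ[X], p.degree < (m : WithBot ℕ) → q.natDegree ≤ m →
        (p * q).degree < ((2 * m : ℕ) : WithBot ℕ) := by
      intro p q hp hq
      rcases eq_or_ne p 0 with rfl | hp0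
      · rw [zero_mul, degree_zero]
        exact WithBot.bot_lt_coe (2 * m)
      refine lt_of_le_of_lt degree_le_natDegree ?_
      have := natDegree_mul_le (p := p) (q := q)
      have h1 : p.natDegree < m := (natDegree_lt_iff_degree_lt hp0).2 hp
      exact_mod_cast (by omega : (p * q).natDegree < 2 * m)
    exact lt_of_le_of_lt (degree_sub_le _ _) (max_lt (key _ _ h.num_degree h'.denom_degree)
      (key _ _ h'.num_degree h.denom_degree))
  have hD : D = 0 := eq_zero_of_dvd_of_degree_lt hdvd hdeg
  rw [← RatFunc.num_div_denom r, ← RatFunc.num_div_denom r', div_eq_div_iff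
    (RatFunc.algebraMap_ne_zero r.denom_ne_zero) (RatFunc.algebraMap_ne_zero r'.denom_ne_zero),
    ← map_mul, ← map_mul]
  exact congrArg _ (sub_eq_zero.1 hD)

theorem ratVal_div_eq {p q : ℂ[X]} {w : ℂ} (hq : q.eval w ≠ 0) :
    (algebraMap ℂ[X] (RatFunc ℂ) p / algebraMap ℂ[X] (RatFunc ℂ) q).denom.eval w ≠ 0 ∧
    ratVal (algebraMap ℂ[X] (RatFunc ℂ) p / algebraMap ℂ[X] (RatFunc ℂ) q) w =
      p.eval w / q.eval w := by
  set r := algebraMap ℂ[X] (RatFunc ℂ) p / algebraMap ℂ[X] (RatFunc ℂ) q with hr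
  have hq0 : q ≠ 0 := by rintro rfl; simp at hq
  have hd : r.denom.eval w ≠ 0 := by
    obtain ⟨g, hg⟩ := RatFunc.denom_div_dvd p q
    rw [hg, eval_mul] at hq
    exact left_ne_zero_of_mul hq
  refine ⟨hd, ?_⟩
  have h1 : r.num * q = p * r.denom := by
    apply RatFunc.algebraMap_injective ℂ
    rw [map_mul, map_mul, ← div_eq_div_iff (RatFunc.algebraMap_ne_zero r.denom_ne_zero)
      (RatFunc.algebraMap_ne_zero hq0), RatFunc.num_div_denom, hr]
  rw [ratVal_eq, div_eq_div_iff hd hq, ← eval_mul, h1, eval_mul]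

/-- If `f q - p` is an analytic multiple of the node polynomial near every interpolation point and
`q` does not vanish there, then `p / q` interpolates `f` in the sense of Hermite. -/
theorem isRationalInterpolant_div {m : ℕ} {z : Fin (2 * m) → ℂ} {f g : ℂ → ℂ} {p q : ℂ[X]}
    (hp : p.degree < (m : WithBot ℕ)) (hq : q.natDegree ≤ m) (hq0 : ∀ j, q.eval (z j) ≠ 0)
    (hf : ∀ j, AnalyticAt ℂ f (z j)) (hg : ∀ j, AnalyticAt ℂ g (z j))
    (h : ∀ j, ∀ᶠ w in nhds (z j), f w * q.eval w - p.eval w = (nodePoly z).eval w * g w) :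
    IsRationalInterpolant m z f
      (algebraMap ℂ[X] (RatFunc ℂ) p / algebraMap ℂ[X] (RatFunc ℂ) q) := by
  set r := algebraMap ℂ[X] (RatFunc ℂ) p / algebraMap ℂ[X] (RatFunc ℂ) q with hr
  refine ⟨?_, ?_, fun j => (ratVal_div_eq (hq0 j)).1, ?_⟩
  · rcases eq_or_ne p 0 with rfl | hp0
    · simp [hr]
    · rcases eq_or_ne q 0 with rfl | hq0
      · simp [hr]
      exact lt_of_le_of_lt (degree_le_of_dvd (RatFunc.num_div_dvd p hq0) hp0) hp
  · rcases eq_or_ne q 0 with rfl | hq0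
    · simp [hr]
    exact (natDegree_le_of_dvd (RatFunc.denom_div_dvd p q) hq0).trans hq
  intro j
  have han : AnalyticAt ℂ (ratVal r) (z j) := analyticAt_ratVal (ratVal_div_eq (hq0 j)).1
  have hord : (pointMultiplicity z (z j) : ℕ∞) ≤
      analyticOrderAt (fun w => ratVal r w - f w) (z j) := by
    rw [natCast_le_analyticOrderAt (han.fun_sub (hf j))]
    obtain ⟨G, hG⟩ := pow_pointMultiplicity_dvd_nodePoly z (z j)
    have hpol : ∀ p : ℂ[X], AnalyticAt ℂ (fun x => p.eval x) (z j) :=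
      fun p => analyticAt_polynomial_eval p _
    refine ⟨fun w => -(G.eval w * g w / q.eval w),
      (((hpol G).mul (hg j)).div (hpol q) (hq0 j)).neg, ?_⟩
    filter_upwards [h j, q.continuous.continuousAt.eventually_ne (hq0 j)] with w hw hqw
    rw [(ratVal_div_eq hqw).2]
    rw [hG] at hw
    simp only [eval_mul, eval_pow, eval_sub, eval_X, eval_C] at hw
    simp only [smul_eq_mul]
    field_simp
    linear_combination -hw
  rw [natCast_le_analyticOrderAt_iff_iteratedDeriv_eq_zero (han.fun_sub (hf j))] at hord
  intro k hk
  have := hord k hk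
  rwa [iteratedDeriv_fun_sub han.contDiffAt (hf j).contDiffAt, sub_eq_zero] at this

end Hermite

/-! ### Integrability against Markov measures -/

section Integrability

open Polynomial

variable {α : EReal} {β : ℝ} {μ : Measure ℝ}

theorem isClosed_realCut (α : EReal) (β : ℝ) : IsClosed (realCut α β) :=
  (isClosed_le continuous_const continuous_coe_real_ereal).inter isClosed_Iic

theorem ordConnected_realCut (α : EReal) (β : ℝ) : (realCut α β).OrdConnected :=
  ⟨fun _ hx _ hy _ ht =>
    ⟨hx.1.trans (EReal.coe_le_coe_iff.2 ht.1), ht.2.trans hy.2⟩⟩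

theorem complexCut_eq_image (α : EReal) (β : ℝ) :
    complexCut α β = (fun x : ℝ => (x : ℂ)) '' realCut α β := by
  ext z
  simp only [complexCut, mem_ofPred_eq, mem_image]
  exact exists_congr fun x => and_congr_right fun _ => eq_comm

theorem isClosed_complexCut (α : EReal) (β : ℝ) : IsClosed (complexCut α β) := by
  rw [complexCut_eq_image]
  exact Complex.isometry_ofReal.isClosedEmbedding.isClosedMap _ (isClosed_realCut α β)

@[simp]
theorem ofReal_mem_complexCut {x : ℝ} : (x : ℂ) ∈ complexCut α β ↔ x ∈ realCut α β := by
  simp [complexCut_eq_image]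

theorem notMem_complexCut_of_im_ne_zero {z : ℂ} (hz : z.im ≠ 0) : z ∉ complexCut α β := by
  rintro ⟨x, -, rfl⟩
  simp at hz

theorem sub_ofReal_ne_zero {z : ℂ} (hz : z ∉ complexCut α β) {x : ℝ} (hx : x ∈ realCut α β) :
    z - x ≠ 0 :=
  sub_ne_zero.2 fun h => hz ⟨x, hx, h⟩

theorem exists_norm_sub_ge {z : ℂ} (hz : z ∉ complexCut α β) :
    ∃ δ > 0, ∀ x ∈ realCut α β, δ ≤ ‖z - x‖ := by
  obtain ⟨δ, hδ, h⟩ := Metric.isOpen_iff.1 (isClosed_complexCut α β).isOpen_compl z hz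
  refine ⟨δ, hδ, fun x hx => ?_⟩
  by_contra! hlt
  refine h (a := (x : ℂ)) ?_ (ofReal_mem_complexCut.2 hx)
  rwa [Metric.mem_ball, dist_comm, dist_eq_norm]

theorem exists_one_add_abs_le {z : ℂ} (hz : z ∉ complexCut α β) :
    ∃ C > 0, ∀ x ∈ realCut α β, 1 + |x| ≤ C * ‖z - x‖ := by
  obtain ⟨δ, hδ, h⟩ := exists_norm_sub_ge hz
  refine ⟨1 + (1 + ‖z‖) / δ, by positivity, fun x hx => ?_⟩
  have h1 : |x| ≤ ‖z‖ + ‖z - x‖ := by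
    have := norm_sub_le z (z - x)
    simpa using this
  have h2 : (1 + ‖z‖) ≤ (1 + ‖z‖) / δ * ‖z - x‖ := by
    rw [div_mul_eq_mul_div, le_div_iff₀ hδ]
    exact mul_le_mul_of_nonneg_left (h x hx) (by positivity)
  linarith

theorem IsMarkovMeasure.ae_mem (hμ : IsMarkovMeasure α β μ) : ∀ᵐ x ∂μ, x ∈ realCut α β :=
  Filter.mem_of_superset Measure.support_mem_ae hμ.support_subset

theorem IsMarkovMeasure.integrable_inv_one_add_abs (hμ : IsMarkovMeasure α β μ) :
    Integrable (fun x : ℝ => (1 + |x|)⁻¹) μ := by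
  have h := hμ.integrable Complex.I (notMem_complexCut_of_im_ne_zero (by simp))
  refine h.mono (by fun_prop) (Filter.Eventually.of_forall fun x => ?_)
  have hx : 0 < 1 + |x| := by positivity
  rw [norm_inv, Real.norm_of_nonneg hx.le, norm_div, norm_one, one_div]
  have h0 : Complex.I - x ≠ 0 := fun h0 => by simpa using congrArg Complex.im h0
  refine inv_anti₀ (norm_pos_iff.2 h0) ?_
  simpa using norm_sub_le Complex.I (x : ℂ)

theorem exists_pow_le_norm_prod (s : Multiset ℂ) (hs : ∀ a ∈ s, a ∉ complexCut α β) :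
    ∃ C > 0, ∀ x ∈ realCut α β,
      (1 + |x|) ^ s.card ≤ C * ‖(s.map fun a => (x : ℂ) - a).prod‖ := by
  induction s using Multiset.induction with
  | empty => exact ⟨1, one_pos, by simp⟩
  | cons a s ih =>
    obtain ⟨C, hC, h⟩ := ih fun b hb => hs b (Multiset.mem_cons_of_mem hb)
    obtain ⟨C', hC', h'⟩ := exists_one_add_abs_le (hs a (Multiset.mem_cons_self a s))
    refine ⟨C * C', by positivity, fun x hx => ?_⟩
    have h1 := mul_le_mul (h x hx) (h' x hx) (by positivity) (by positivity)
    rw [Multiset.card_cons, pow_succ, Multiset.map_cons, Multiset.prod_cons, norm_mul,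
      norm_sub_rev (x : ℂ) a]
    linarith

theorem exists_norm_eval_le (N : ℂ[X]) : ∃ C, 0 ≤ C ∧ ∀ x : ℝ,
    ‖N.eval (x : ℂ)‖ ≤ C * (1 + |x|) ^ N.natDegree := by
  refine ⟨∑ i ∈ Finset.range (N.natDegree + 1), ‖N.coeff i‖, by positivity, fun x => ?_⟩
  rw [eval_eq_sum_range, Finset.sum_mul]
  refine (norm_sum_le _ _).trans (Finset.sum_le_sum fun i hi => ?_)
  rw [norm_mul, norm_pow, Complex.norm_real, Real.norm_eq_abs]
  refine mul_le_mul_of_nonneg_left ?_ (norm_nonneg _)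
  calc |x| ^ i ≤ (1 + |x|) ^ i := by gcongr; linarith
    _ ≤ (1 + |x|) ^ N.natDegree :=
      pow_le_pow_right₀ (by linarith [abs_nonneg x]) (Finset.mem_range_succ_iff.1 hi)

theorem exists_norm_div_le {N D : ℂ[X]} (hD : ∀ x ∈ realCut α β, D.eval (x : ℂ) ≠ 0)
    (hdeg : N.natDegree < D.natDegree) :
    ∃ C, ∀ x ∈ realCut α β, ‖N.eval (x : ℂ) / D.eval (x : ℂ)‖ ≤ C * (1 + |x|)⁻¹ := by
  have hD0 : D ≠ 0 := by rintro rfl; simp at hdeg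
  have hsplit := IsAlgClosed.splits D
  obtain ⟨C, hC, h⟩ := exists_norm_eval_le N
  obtain ⟨C', hC', h'⟩ := exists_pow_le_norm_prod (α := α) (β := β) D.roots (by
    rintro a ha ⟨x, hx, rfl⟩
    exact hD x hx (isRoot_of_mem_roots ha))
  have hl : 0 < ‖D.leadingCoeff‖ := norm_pos_iff.2 (leadingCoeff_ne_zero.2 hD0)
  refine ⟨C * C' / ‖D.leadingCoeff‖, fun x hx => ?_⟩
  have h1 : D.eval (x : ℂ) = D.leadingCoeff * (D.roots.map fun a => (x : ℂ) - a).prod := by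
    conv_lhs => rw [hsplit.eq_prod_roots]
    rw [eval_mul, eval_C, eval_multiset_prod, Multiset.map_map]
    simp
  have hcard : D.roots.card = D.natDegree := hsplit.natDegree_eq_card_roots.symm
  have h2 := h' x hx
  have h3 : 0 < ‖D.eval (x : ℂ)‖ := norm_pos_iff.2 (hD x hx)
  have h4 : (D.roots.map fun a => (x : ℂ) - a).prod = D.eval (x : ℂ) / D.leadingCoeff := by
    rw [h1, mul_div_cancel_left₀ _ (leadingCoeff_ne_zero.2 hD0)]
  rw [hcard, h4, norm_div] at h2
  have hx1 : 1 ≤ 1 + |x| := by linarith [abs_nonneg x]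
  have h5 : (1 + |x|) ^ (N.natDegree + 1) ≤ (1 + |x|) ^ D.natDegree :=
    pow_le_pow_right₀ hx1 hdeg
  rw [norm_div, div_le_iff₀ h3]
  refine (h x).trans ?_
  have h6 : (1 + |x|) ^ N.natDegree = (1 + |x|) ^ (N.natDegree + 1) * (1 + |x|)⁻¹ := by
    field_simp
    ring
  rw [h6]
  calc C * ((1 + |x|) ^ (N.natDegree + 1) * (1 + |x|)⁻¹)
      ≤ C * ((C' * (‖D.eval (x : ℂ)‖ / ‖D.leadingCoeff‖)) * (1 + |x|)⁻¹) := by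
        gcongr
        exact h5.trans h2
    _ = _ := by ring

theorem IsMarkovMeasure.integrable_div (hμ : IsMarkovMeasure α β μ) {N D : ℂ[X]}
    (hD : ∀ x ∈ realCut α β, D.eval (x : ℂ) ≠ 0) (hdeg : N.natDegree < D.natDegree) :
    Integrable (fun x : ℝ => N.eval (x : ℂ) / D.eval (x : ℂ)) μ := by
  obtain ⟨C, hC⟩ := exists_norm_div_le hD hdeg
  have hm : ∀ P : ℂ[X], Measurable fun x : ℝ => P.eval (x : ℂ) := fun P =>
    (P.continuous.comp Complex.continuous_ofReal).measurable
  refine (hμ.integrable_inv_one_add_abs.const_mul C).mono' ((hm N).div (hm D)).aestronglyMeasurable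
    ?_
  filter_upwards [hμ.ae_mem] with x hx using hC x hx

theorem IsMarkovMeasure.integrable_div_mul_sub (hμ : IsMarkovMeasure α β μ) {N D : ℂ[X]}
    (hD : ∀ x ∈ realCut α β, D.eval (x : ℂ) ≠ 0) (hdeg : N.natDegree ≤ D.natDegree) {z : ℂ}
    (hz : z ∉ complexCut α β) :
    Integrable (fun x : ℝ => N.eval (x : ℂ) / D.eval (x : ℂ) / (z - x)) μ := by
  rcases (realCut α β).eq_empty_or_nonempty with h0 | ⟨x0, hx0⟩
  · have h1 := hμ.support_subset
    rw [h0, subset_empty_iff] at h1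
    exact absurd hμ.support_infinite (by simp [h1])
  have hD0 : D ≠ 0 := by rintro rfl; exact hD x0 hx0 (by simp)
  have := hμ.integrable_div (N := -N) (D := D * (X - C z)) (fun x hx => by
    rw [eval_mul]
    refine mul_ne_zero (hD x hx) ?_
    have := sub_ofReal_ne_zero hz hx
    simp only [eval_sub, eval_X, eval_C]
    rwa [← neg_sub, neg_ne_zero]) (by
    rw [natDegree_neg, natDegree_mul hD0 (X_sub_C_ne_zero z), natDegree_X_sub_C]; omega)
  refine this.congr (Filter.Eventually.of_forall fun x => ?_)
  simp only [eval_neg, eval_mul, eval_sub, eval_X, eval_C]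
  rw [div_div, ← neg_sub z (x : ℂ), mul_neg, neg_div_neg_eq]

theorem eval_map_ofReal (P : ℝ[X]) (x : ℝ) :
    (P.map Complex.ofRealHom).eval (x : ℂ) = (P.eval x : ℝ) := by
  rw [← Complex.ofRealHom_eq_coe, eval_map_apply]; rfl

theorem IsMarkovMeasure.integrable_real_div (hμ : IsMarkovMeasure α β μ) {N D : ℝ[X]}
    (hD : ∀ x ∈ realCut α β, D.eval x ≠ 0) (hdeg : N.natDegree < D.natDegree) :
    Integrable (fun x : ℝ => N.eval x / D.eval x) μ := by
  have := hμ.integrable_div (N := N.map Complex.ofRealHom) (D := D.map Complex.ofRealHom)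
    (fun x hx => by rw [eval_map_ofReal]; exact_mod_cast hD x hx)
    (by rwa [natDegree_map, natDegree_map])
  refine this.re.congr (Filter.Eventually.of_forall fun x => ?_)
  simp only [eval_map_ofReal]
  rw [← Complex.ofReal_div]
  exact Complex.ofReal_re _

theorem IsMarkovMeasure.integrable_real_div_sub (hμ : IsMarkovMeasure α β μ) {N D : ℝ[X]}
    (hD : ∀ x ∈ realCut α β, D.eval x ≠ 0) (hdeg : N.natDegree ≤ D.natDegree) {x₀ : ℝ}
    (hx₀ : x₀ ∉ realCut α β) :
    Integrable (fun x : ℝ => N.eval x / D.eval x / (x₀ - x)) μ := by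
  have := hμ.integrable_div_mul_sub (N := N.map Complex.ofRealHom) (D := D.map Complex.ofRealHom)
    (z := x₀)
    (fun x hx => by rw [eval_map_ofReal]; exact_mod_cast hD x hx)
    (by rwa [natDegree_map, natDegree_map]) (by simpa using hx₀)
  refine this.re.congr (Filter.Eventually.of_forall fun x => ?_)
  simp only [eval_map_ofReal]
  rw [← Complex.ofReal_sub, ← Complex.ofReal_div, ← Complex.ofReal_div]
  exact Complex.ofReal_re _

/-- Cauchy transforms are holomorphic off the cut. -/
theorem differentiableOn_cauchyTransform (hμ : ∀ᵐ x ∂μ, x ∈ realCut α β) {k : ℝ → ℂ}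
    (hk : ∀ z ∉ complexCut α β, Integrable (fun x : ℝ => k x / (z - x)) μ) :
    DifferentiableOn ℂ (fun z => ∫ x, k x / (z - x) ∂μ) (complexCut α β)ᶜ := by
  intro z hz
  obtain ⟨δ, hδ, h⟩ := exists_norm_sub_ge hz
  have hmeas : ∀ w : ℂ, AEStronglyMeasurable (fun x : ℝ => -((w - x)⁻¹)) μ := fun w =>
    (Measurable.inv (by fun_prop)).neg.aestronglyMeasurable
  -- on the ball of radius `δ / 2` each distance `|w - x|` is at least `|z - x| / 2`
  have hhalf : ∀ w ∈ Metric.ball z (δ / 2), ∀ x ∈ realCut α β,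
      ‖z - x‖ / 2 ≤ ‖w - x‖ := by
    intro w hw x hx
    have h1 : ‖z - x‖ ≤ ‖z - w‖ + ‖w - x‖ := norm_sub_le_norm_sub_add_norm_sub z w x
    rw [Metric.mem_ball, dist_comm, dist_eq_norm] at hw
    have := h x hx
    linarith
  have hout : ∀ w ∈ Metric.ball z (δ / 2), w ∉ complexCut α β := by
    rintro w hw ⟨x, hx, rfl⟩
    have h1 := hhalf _ hw x hx
    have := h x hx
    rw [sub_self, norm_zero] at h1
    linarith
  refine ((hasDerivAt_integral_of_dominated_loc_of_deriv_le (μ := μ)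
    (F := fun w (x : ℝ) => k x / (w - x)) (F' := fun w (x : ℝ) => k x / (w - x) * (-((w - x)⁻¹)))
    (bound := fun x : ℝ => 4 / δ * ‖k x / (z - x)‖)
    (Metric.ball_mem_nhds z (half_pos hδ)) ?_ (hk z hz)
    ?_ ?_ ?_ ?_).2.differentiableAt).differentiableWithinAt
  · filter_upwards [Metric.ball_mem_nhds z (half_pos hδ)] with w hw
      using (hk w (hout w hw)).aestronglyMeasurable
  · exact (hk z hz).aestronglyMeasurable.mul (hmeas z)
  · filter_upwards [hμ] with x hx w hw
    have h1 := hhalf w hw x hx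
    have h2 := h x hx
    have h3 : 0 < ‖z - x‖ := hδ.trans_le h2
    have h4 : 0 < ‖w - x‖ := lt_of_lt_of_le (half_pos h3) h1
    rw [norm_mul, norm_neg, norm_inv, norm_div, norm_div]
    have h5 : ‖w - (x : ℂ)‖⁻¹ ≤ 2 / ‖z - x‖ := by
      rw [inv_le_comm₀ h4 (by positivity), inv_div]; exact h1
    have h6 : ‖w - (x : ℂ)‖⁻¹ ≤ 2 / δ := h5.trans (by gcongr)
    calc ‖k x‖ / ‖w - x‖ * ‖w - (x : ℂ)‖⁻¹ = ‖k x‖ * (‖w - (x : ℂ)‖⁻¹ * ‖w - (x : ℂ)‖⁻¹) := by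
          rw [div_eq_mul_inv]; ring
      _ ≤ ‖k x‖ * (2 / ‖z - x‖ * (2 / δ)) := by gcongr
      _ = _ := by ring
  · exact (hk z hz).norm.const_mul _
  · filter_upwards [hμ] with x hx w hw
    have h4 : w - x ≠ 0 := sub_ofReal_ne_zero (hout w hw) hx
    have := ((hasDerivAt_id w).sub_const (x : ℂ)).inv h4
    have := this.const_mul (k x)
    refine this.congr_deriv ?_
    simp only [id]
    field_simp

theorem IsMarkovMeasure.differentiableOn_markov (hμ : IsMarkovMeasure α β μ) :
    DifferentiableOn ℂ (markov μ) (complexCut α β)ᶜ :=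
  differentiableOn_cauchyTransform hμ.ae_mem (k := fun _ => 1) hμ.integrable

end Integrability

/-! ### Orthogonal denominators -/

section Orthogonal

open Polynomial

variable {α : EReal} {β : ℝ} {μ : Measure ℝ}

theorem exists_eq_C_eval_add_mul {K : Type*} [Field K] {m : ℕ} (hm : 0 < m) (h : K[X])
    (hdeg : h.natDegree ≤ m) (a : K) :
    ∃ g : K[X], h = C (h.eval a) + (X - C a) * g ∧ g.degree < (m : WithBot ℕ) := by
  refine ⟨h /ₘ (X - C a), ?_, ?_⟩
  · conv_lhs => rw [← modByMonic_add_div h (X - C a), modByMonic_X_sub_C_eq_C_eval]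
  · refine lt_of_le_of_lt degree_le_natDegree ?_
    rw [natDegree_divByMonic _ (monic_X_sub_C a), natDegree_X_sub_C]
    exact_mod_cast (by omega : h.natDegree - 1 < m)

/-- The denominators: a nonzero polynomial of degree at most `m` which is orthogonal to all
polynomials of degree less than `m` with respect to `dμ / ω`. There are `m` conditions on
`m + 1` coefficients. -/
theorem IsMarkovMeasure.exists_orthogonal (hμ : IsMarkovMeasure α β μ) {m : ℕ} (hm : 0 < m)
    {ω : ℝ[X]} (hω : ∀ x ∈ realCut α β, ω.eval x ≠ 0) (hdeg : ω.natDegree = 2 * m) :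
    ∃ q : ℝ[X], q ≠ 0 ∧ q.natDegree ≤ m ∧
      ∀ h : ℝ[X], h.degree < (m : WithBot ℕ) → ∫ x, q.eval x * h.eval x / ω.eval x ∂μ = 0 := by
  have hint : ∀ (q : degreeLT ℝ (m + 1)) (h : degreeLT ℝ m),
      Integrable (fun x : ℝ => (q : ℝ[X]).eval x * (h : ℝ[X]).eval x / ω.eval x) μ := by
    intro q h
    have := hμ.integrable_real_div (N := (q : ℝ[X]) * (h : ℝ[X])) hω (by
      rw [hdeg]
      rcases eq_or_ne (h : ℝ[X]) 0 with h0 | h0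
      · rw [h0, mul_zero, natDegree_zero]; omega
      rcases eq_or_ne (q : ℝ[X]) 0 with q0 | q0
      · rw [q0, zero_mul, natDegree_zero]; omega
      have h1 := (natDegree_lt_iff_degree_lt h0).2 (mem_degreeLT.1 h.2)
      have h2 := (natDegree_lt_iff_degree_lt q0).2 (mem_degreeLT.1 q.2)
      have := natDegree_mul_le (p := (q : ℝ[X])) (q := (h : ℝ[X]))
      omega)
    simpa only [eval_mul] using this
  let L : degreeLT ℝ (m + 1) →ₗ[ℝ] degreeLT ℝ m →ₗ[ℝ] ℝ :=
    LinearMap.mk₂ ℝ (fun q h => ∫ x, (q : ℝ[X]).eval x * (h : ℝ[X]).eval x / ω.eval x ∂μ)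
      (fun q q' h => by
        rw [← integral_add (hint q h) (hint q' h)]
        refine integral_congr_ae (Filter.Eventually.of_forall fun x => ?_)
        simp only [Submodule.coe_add, eval_add]; ring)
      (fun c q h => by
        rw [smul_eq_mul, ← integral_const_mul]
        refine integral_congr_ae (Filter.Eventually.of_forall fun x => ?_)
        simp only [Submodule.coe_smul, eval_smul, smul_eq_mul]; ring)
      (fun q h h' => by
        rw [← integral_add (hint q h) (hint q h')]
        refine integral_congr_ae (Filter.Eventually.of_forall fun x => ?_)
        simp only [Submodule.coe_add, eval_add]; ring)
      (fun c q h => by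
        rw [smul_eq_mul, ← integral_const_mul]
        refine integral_congr_ae (Filter.Eventually.of_forall fun x => ?_)
        simp only [Submodule.coe_smul, eval_smul, smul_eq_mul]; ring)
  have hfd : ∀ n, FiniteDimensional ℝ (degreeLT ℝ n) := fun n =>
    (degreeLTEquiv ℝ n).symm.finiteDimensional
  have hfr : ∀ n, Module.finrank ℝ (degreeLT ℝ n) = n := fun n => by
    rw [(degreeLTEquiv ℝ n).finrank_eq, Module.finrank_fin_fun]
  have := hfd m
  have := hfd (m + 1)
  have hker : LinearMap.ker L ≠ ⊥ := LinearMap.ker_ne_bot_of_finrank_lt (by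
    rw [show Module.finrank ℝ (degreeLT ℝ m →ₗ[ℝ] ℝ) = m from
      (Subspace.dual_finrank_eq (K := ℝ) (V := degreeLT ℝ m)).trans (hfr m), hfr (m + 1)]
    exact Nat.lt_succ_self m)
  obtain ⟨q, hq, hq0⟩ := Submodule.exists_mem_ne_zero_of_ne_bot hker
  have hq0' : (q : ℝ[X]) ≠ 0 := fun h => hq0 (Subtype.ext h)
  refine ⟨q, hq0', ?_, fun h hh => ?_⟩
  · exact Nat.lt_succ_iff.1 ((natDegree_lt_iff_degree_lt hq0').2 (mem_degreeLT.1 q.2))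
  · exact LinearMap.congr_fun (LinearMap.mem_ker.1 hq) ⟨h, mem_degreeLT.2 hh⟩

/-- A continuous function without zeros on the cut has constant sign there. -/
theorem exists_sign {g : ℝ → ℝ} (hg : ContinuousOn g (realCut α β))
    (h0 : ∀ x ∈ realCut α β, g x ≠ 0) :
    ∃ ε : ℝ, |ε| = 1 ∧ ∀ x ∈ realCut α β, 0 < ε * g x := by
  have hpre := (ordConnected_realCut α β).isPreconnected
  by_cases hp : ∃ x ∈ realCut α β, 0 < g x
  · obtain ⟨x, hx, hgx⟩ := hp
    refine ⟨1, abs_one, fun y hy => ?_⟩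
    rw [one_mul]
    by_contra! hle
    obtain ⟨t, ht, ht0⟩ := hpre.intermediate_value hy hx hg ⟨hle, hgx.le⟩
    exact h0 t ht ht0
  · push Not at hp
    refine ⟨-1, by simp, fun y hy => ?_⟩
    have := lt_of_le_of_ne (hp y hy) (h0 y hy)
    linarith

theorem IsMarkovMeasure.eq_zero_of_ae_eval_eq_zero (hμ : IsMarkovMeasure α β μ) {h : ℝ[X]}
    (hh : ∀ᵐ x ∂μ, h.eval x = 0) : h = 0 := by
  by_contra h0
  refine hμ.support_infinite (((finite_setOfPred_isRoot h0)).subset ?_)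
  refine Measure.support_subset_of_isClosed ?_ hh
  exact isClosed_eq h.continuous continuous_const

/-- The quadratic form `h ↦ ∫ d h² / ω dμ` is definite when `d` and `ω` do not vanish on the
cut. -/
theorem IsMarkovMeasure.eq_zero_of_integral_sq (hμ : IsMarkovMeasure α β μ)
    {ω d h : ℝ[X]} (hω : ∀ x ∈ realCut α β, ω.eval x ≠ 0) (hd : ∀ x ∈ realCut α β, d.eval x ≠ 0)
    (hdeg : (d * h ^ 2).natDegree < ω.natDegree)
    (h0 : ∫ x, d.eval x * h.eval x ^ 2 / ω.eval x ∂μ = 0) : h = 0 := by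
  obtain ⟨ε, -, hε⟩ := exists_sign (g := fun x => d.eval x / ω.eval x)
    (d.continuous.continuousOn.div ω.continuous.continuousOn hω)
    fun x hx => div_ne_zero (hd x hx) (hω x hx)
  have hint := hμ.integrable_real_div (N := d * h ^ 2) hω hdeg
  simp only [eval_mul, eval_pow] at hint
  have h1 : ∫ x, ε * (d.eval x * h.eval x ^ 2 / ω.eval x) ∂μ = 0 := by
    rw [integral_const_mul, h0, mul_zero]
  have h2 : ∀ x, ε * (d.eval x * h.eval x ^ 2 / ω.eval x) =
      ε * (d.eval x / ω.eval x) * h.eval x ^ 2 := fun x => by ring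
  rw [integral_eq_zero_iff_of_nonneg_ae ?_ (hint.const_mul ε)] at h1
  · refine hμ.eq_zero_of_ae_eval_eq_zero ?_
    filter_upwards [h1, hμ.ae_mem] with x hx hxc
    rw [h2] at hx
    simpa using (mul_eq_zero.1 hx).resolve_left (hε x hxc).ne'
  · filter_upwards [hμ.ae_mem] with x hxc
    rw [h2]
    exact mul_nonneg (hε x hxc).le (sq_nonneg _)

/-- The zeros of an orthogonal denominator lie on the cut: if `d` is a real factor without zeros on
the cut, then the denominator `d h` is orthogonal to `h`. -/
theorem IsMarkovMeasure.orthogonal_eval_ne_zero (hμ : IsMarkovMeasure α β μ) {m : ℕ}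
    {ω : ℝ[X]} (hω : ∀ x ∈ realCut α β, ω.eval x ≠ 0) (hdeg : ω.natDegree = 2 * m)
    {q : ℝ[X]} (hq0 : q ≠ 0) (hqm : q.natDegree ≤ m)
    (hq : ∀ h : ℝ[X], h.degree < (m : WithBot ℕ) →
      ∫ x, q.eval x * h.eval x / ω.eval x ∂μ = 0)
    {z : ℂ} (hz : z ∉ complexCut α β) : (q.map Complex.ofRealHom).eval z ≠ 0 := by
  intro hroot
  have key : ∀ d : ℝ[X], 0 < d.natDegree → (∀ x ∈ realCut α β, d.eval x ≠ 0) → ¬ d ∣ q := by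
    rintro d hd hdc ⟨h, rfl⟩
    have hh0 : h ≠ 0 := right_ne_zero_of_mul hq0
    have hd0 : d ≠ 0 := left_ne_zero_of_mul hq0
    rw [natDegree_mul hd0 hh0] at hqm
    refine hh0 (hμ.eq_zero_of_integral_sq hω hdc ?_ ?_)
    · rw [natDegree_mul hd0 (pow_ne_zero 2 hh0), natDegree_pow, hdeg]
      omega
    · rw [← hq h ?_]
      · refine integral_congr_ae (Filter.Eventually.of_forall fun x => ?_)
        simp only [eval_mul]
        ring
      · rw [← natDegree_lt_iff_degree_lt hh0]
        omega
  rcases eq_or_ne z.im 0 with him | him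
  · have hzr : z = (z.re : ℂ) := Complex.ext rfl (by simp [him])
    rw [hzr, eval_map_ofReal, Complex.ofReal_eq_zero] at hroot
    refine key (X - C z.re) (by simp) (fun x hx => ?_) (dvd_iff_isRoot.2 hroot)
    rw [hzr, ofReal_mem_complexCut] at hz
    simp only [eval_sub, eval_X, eval_C, ne_eq, sub_eq_zero]
    rintro rfl
    exact hz hx
  · have h1 : aeval z q = 0 := by rw [← hroot, aeval_def, ← eval_map]; rfl
    have h2 : (X ^ 2 - C (2 * z.re) * X + C (‖z‖ ^ 2) : ℝ[X]).natDegree = 2 := by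
      compute_degree!
    refine key _ (by rw [h2]; norm_num) (fun x _ => ?_)
      (q.quadratic_dvd_of_aeval_eq_zero_im_ne_zero h1 him)
    have h3 : 0 < z.im ^ 2 := by positivity
    have h4 : ‖z‖ ^ 2 = z.re ^ 2 + z.im ^ 2 := by rw [Complex.sq_norm, Complex.normSq_apply]; ring
    simp only [eval_add, eval_sub, eval_pow, eval_X, eval_mul, eval_C, h4]
    nlinarith [sq_nonneg (x - z.re)]

theorem IsMarkovMeasure.orthogonal_complex (hμ : IsMarkovMeasure α β μ) {m : ℕ} (hm : 0 < m)
    {ω : ℝ[X]} (hω : ∀ x ∈ realCut α β, ω.eval x ≠ 0) (hdeg : ω.natDegree = 2 * m)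
    {q : ℝ[X]} (hqm : q.natDegree ≤ m)
    (hq : ∀ h : ℝ[X], h.degree < (m : WithBot ℕ) →
      ∫ x, q.eval x * h.eval x / ω.eval x ∂μ = 0) {h : ℂ[X]} (hh : h.degree < (m : WithBot ℕ)) :
    ∫ x : ℝ, ((q.eval x : ℝ) : ℂ) * h.eval (x : ℂ) / (ω.eval x : ℝ) ∂μ = 0 := by
  have hsum : ∀ x : ℝ, ((q.eval x : ℝ) : ℂ) * h.eval (x : ℂ) / (ω.eval x : ℝ) =
      ∑ i ∈ Finset.range m, h.coeff i * ((q.eval x * (X ^ i : ℝ[X]).eval x / ω.eval x : ℝ) : ℂ) := by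
    intro x
    have hlt : h.natDegree < m := by
      rcases eq_or_ne h 0 with rfl | h0
      · simpa using hm
      · exact (natDegree_lt_iff_degree_lt h0).2 hh
    rw [eval_eq_sum_range' hlt, Finset.mul_sum, Finset.sum_div]
    refine Finset.sum_congr rfl fun i _ => ?_
    rw [eval_pow, eval_X]
    push_cast
    ring
  have hXdeg : ∀ i ∈ Finset.range m, (X ^ i : ℝ[X]).degree < (m : WithBot ℕ) := fun i hi => by
    rw [degree_X_pow]; exact_mod_cast Finset.mem_range.1 hi
  simp_rw [hsum]
  rw [integral_finsetSum]
  · refine Finset.sum_eq_zero fun i hi => ?_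
    rw [integral_const_mul, integral_complex_ofReal, hq _ (hXdeg i hi)]
    simp
  · intro i hi
    have := hμ.integrable_real_div (N := q * X ^ i) hω (by
      have := natDegree_mul_le (p := q) (q := (X ^ i : ℝ[X]))
      rw [natDegree_X_pow] at this
      have := Finset.mem_range.1 hi
      omega)
    simp only [eval_mul] at this
    exact this.ofReal.const_mul _

end Orthogonal

/-! ### The interpolant of a Markov function and its error -/

section Interpolant

open Polynomial

variable {α : EReal} {β : ℝ} {μ : Measure ℝ}

/-- The error formula `f q - p = ω ∫ q(x) / (ω(x) (z - x)) dμ(x)`. The numerator has degree less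
than `m` because, by orthogonality, half of the factors of `ω` may be moved under the integral:
then `p(z)` is the integral of `(q(z) ω₁(x) - ω₁(z) q(x)) / ((z - x) ω₁(x))`, where `q` and `ω₁`
have degree at most `m`. -/
theorem IsMarkovMeasure.exists_numerator (hμ : IsMarkovMeasure α β μ) {m : ℕ} (hm : 0 < m)
    {ω : ℝ[X]} (hω : ∀ x ∈ realCut α β, ω.eval x ≠ 0) (hdeg : ω.natDegree = 2 * m)
    {ω₁ ω₂ : ℂ[X]} (hfac : ω.map Complex.ofRealHom = ω₁ * ω₂) (h₁ : ω₁.natDegree = m)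
    (h₂ : ω₂.natDegree = m)
    {q : ℝ[X]} (hqm : q.natDegree ≤ m)
    (hq : ∀ h : ℝ[X], h.degree < (m : WithBot ℕ) →
      ∫ x, q.eval x * h.eval x / ω.eval x ∂μ = 0) :
    ∃ p : ℂ[X], p.degree < (m : WithBot ℕ) ∧ ∀ z ∉ complexCut α β,
      markov μ z * (q.map Complex.ofRealHom).eval z - p.eval z =
        (ω.map Complex.ofRealHom).eval z *
          ∫ x : ℝ, ((q.eval x / ω.eval x : ℝ) : ℂ) / (z - x) ∂μ := by
  set Q := q.map Complex.ofRealHom with hQ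
  have hQm : Q.natDegree ≤ m := by rwa [hQ, natDegree_map]
  have hfacx : ∀ x : ℝ, ((ω.eval x : ℝ) : ℂ) = ω₁.eval (x : ℂ) * ω₂.eval (x : ℂ) := fun x => by
    rw [← eval_mul, ← hfac, eval_map_ofReal]
  have hω' : ∀ x ∈ realCut α β, ω₁.eval (x : ℂ) * ω₂.eval (x : ℂ) ≠ 0 := fun x hx => by
    rw [← hfacx]; exact_mod_cast hω x hx
  have hω₁ : ∀ x ∈ realCut α β, ω₁.eval (x : ℂ) ≠ 0 := fun x hx => left_ne_zero_of_mul (hω' x hx)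
  have hω₂ : ∀ x ∈ realCut α β, ω₂.eval (x : ℂ) ≠ 0 := fun x hx => right_ne_zero_of_mul (hω' x hx)
  have hωc : ∀ x ∈ realCut α β, (ω₁ * ω₂).eval (x : ℂ) ≠ 0 := fun x hx => by
    rw [eval_mul]; exact hω' x hx
  have hdegc : (ω₁ * ω₂).natDegree = 2 * m := by rw [← hfac, natDegree_map, hdeg]
  have hI₁ : ∀ z ∉ complexCut α β,
      Integrable (fun x : ℝ => Q.eval (x : ℂ) / ω₁.eval (x : ℂ) / (z - x)) μ := fun z hz =>
    hμ.integrable_div_mul_sub hω₁ (by rw [h₁]; exact hQm) hz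
  have hI : ∀ z ∉ complexCut α β,
      Integrable (fun x : ℝ => Q.eval (x : ℂ) / (ω₁ * ω₂).eval (x : ℂ) / (z - x)) μ := fun z hz =>
    hμ.integrable_div_mul_sub hωc (by rw [hdegc]; omega) hz
  -- moving the factor `ω₂` under the integral
  have hmove : ∀ z ∉ complexCut α β,
      ω₂.eval z * ∫ x : ℝ, Q.eval (x : ℂ) / (ω₁ * ω₂).eval (x : ℂ) / (z - x) ∂μ =
        ∫ x : ℝ, Q.eval (x : ℂ) / ω₁.eval (x : ℂ) / (z - x) ∂μ := by
    intro z hz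
    obtain ⟨g, hg, hgdeg⟩ := exists_eq_C_eval_add_mul hm ω₂ h₂.le z
    rw [← integral_const_mul, ← sub_eq_zero, ← integral_sub ((hI z hz).const_mul _) (hI₁ z hz),
      ← hμ.orthogonal_complex hm hω hdeg hqm hq hgdeg]
    refine integral_congr_ae ?_
    filter_upwards [hμ.ae_mem] with x hx
    have hx₁ := hω₁ x hx
    have hx₂ := hω₂ x hx
    have hzx := sub_ofReal_ne_zero hz hx
    have hgx : ω₂.eval (x : ℂ) = ω₂.eval z + (x - z) * g.eval (x : ℂ) := by
      conv_lhs => rw [hg]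
      simp
    rw [hfacx, eval_mul, ← eval_map_ofReal q]
    rw [← hQ]
    field_simp
    rw [hgx]
    ring
  -- `p` interpolates the function `G` below at `m` points off the cut; it agrees with `G` off the
  -- cut because the integrand in `hG` is a polynomial of degree less than `m` in `z`
  let node : Fin m → ℂ := fun i => ((i : ℕ) + 1 : ℝ) * Complex.I
  have hnode_im : ∀ i, (node i).im = (i : ℕ) + 1 := fun i => by simp [node]
  have hnode_inj : Set.InjOn node (Finset.univ : Finset (Fin m)) := by
    intro i _ j _ hij
    have := congrArg Complex.im hij
    rw [hnode_im, hnode_im] at this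
    exact Fin.ext (by exact_mod_cast add_right_cancel this)
  have hnode : ∀ i, node i ∉ complexCut α β := fun i =>
    notMem_complexCut_of_im_ne_zero (by rw [hnode_im]; positivity)
  let G : ℂ → ℂ := fun z => markov μ z * Q.eval z -
    ω₁.eval z * ∫ x : ℝ, Q.eval (x : ℂ) / ω₁.eval (x : ℂ) / (z - x) ∂μ
  have hG : ∀ z ∉ complexCut α β, G z = ∫ x : ℝ, (1 / (z - x) * Q.eval z -
      ω₁.eval z * (Q.eval (x : ℂ) / ω₁.eval (x : ℂ) / (z - x))) ∂μ := by
    intro z hz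
    rw [integral_sub ((hμ.integrable z hz).mul_const _) ((hI₁ z hz).const_mul _),
      integral_mul_const, integral_const_mul]
    rfl
  have hGint : ∀ z ∉ complexCut α β, Integrable (fun x : ℝ => (1 / (z - x) * Q.eval z -
      ω₁.eval z * (Q.eval (x : ℂ) / ω₁.eval (x : ℂ) / (z - x)))) μ := fun z hz =>
    ((hμ.integrable z hz).mul_const _).sub ((hI₁ z hz).const_mul _)
  refine ⟨Lagrange.interpolate Finset.univ node fun i => G (node i), ?_, fun z hz => ?_⟩
  · simpa using Lagrange.degree_interpolate_lt (s := Finset.univ) (fun i => G (node i)) hnode_inj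
  have hL : (Lagrange.interpolate Finset.univ node fun i => G (node i)).eval z = G z := by
    rw [Lagrange.interpolate_apply, eval_finsetSum, hG z hz]
    simp_rw [eval_mul, eval_C]
    simp_rw [fun i => hG (node i) (hnode i), ← integral_mul_const]
    rw [← integral_finsetSum _ fun i _ => (hGint _ (hnode i)).mul_const _]
    refine integral_congr_ae ?_
    filter_upwards [hμ.ae_mem] with x hx
    have hx₁ := hω₁ x hx
    -- `N` vanishes at `x`, so that `N / (X - x)` is a polynomial of degree less than `m`
    set N : ℂ[X] := Q * C (ω₁.eval (x : ℂ)) - ω₁ * C (Q.eval (x : ℂ)) with hN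
    obtain ⟨g, hg, hgdeg⟩ := exists_eq_C_eval_add_mul hm N (by
      refine (natDegree_sub_le _ _).trans (max_le ?_ ?_)
      · exact (natDegree_mul_C_le _ _).trans hQm
      · exact (natDegree_mul_C_le _ _).trans h₁.le) (x : ℂ)
    have hNx : N.eval (x : ℂ) = 0 := by simp [hN]; ring
    have hval : ∀ w ∉ complexCut α β, 1 / (w - x) * Q.eval w -
        ω₁.eval w * (Q.eval (x : ℂ) / ω₁.eval (x : ℂ) / (w - x)) =
        g.eval w / ω₁.eval (x : ℂ) := by
      intro w hw
      have hwx := sub_ofReal_ne_zero hw hx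
      have h1 : N.eval w = (w - x) * g.eval w := by
        conv_lhs => rw [hg, hNx]
        simp
      have h2 : N.eval w = Q.eval w * ω₁.eval (x : ℂ) - ω₁.eval w * Q.eval (x : ℂ) := by
        simp [hN]
      rw [h2] at h1
      field_simp
      linear_combination h1
    rw [hval z hz]
    simp_rw [fun i => hval (node i) (hnode i)]
    have hgL := congrArg (eval z) (Lagrange.eq_interpolate (s := Finset.univ) hnode_inj
      (f := g) (by simpa using hgdeg))
    rw [Lagrange.interpolate_apply, eval_finsetSum] at hgL
    simp_rw [eval_mul, eval_C] at hgL
    rw [hgL, Finset.sum_div]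
    exact Finset.sum_congr rfl fun i _ => by ring
  rw [hL]
  have hJ : ∫ x : ℝ, ((q.eval x / ω.eval x : ℝ) : ℂ) / (z - x) ∂μ =
      ∫ x : ℝ, Q.eval (x : ℂ) / (ω₁ * ω₂).eval (x : ℂ) / (z - x) ∂μ := by
    refine integral_congr_ae (Filter.Eventually.of_forall fun x => ?_)
    simp only [← hfac, hQ, eval_map_ofReal]
    push_cast
    rfl
  rw [hJ, hfac, eval_mul, mul_assoc, hmove z hz]
  simp only [G]
  ring

/-- The extremal property of the orthogonal denominators: among all polynomials of degree at most
`m` with a prescribed value at the real point `x₀` off the cut, the multiples of `q` minimize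
`|∫ Q² / (ω (x₀ - x)) dμ|`. Indeed `1 / (ω (x₀ - x))` has constant sign on the cut, and `q` is
orthogonal to `Q - l q` with respect to `dμ / (ω (x₀ - x))`, since `Q - l q` is divisible
by `x - x₀`. -/
theorem IsMarkovMeasure.extremal (hμ : IsMarkovMeasure α β μ) {m : ℕ} (hm : 0 < m)
    {ω : ℝ[X]} (hω : ∀ x ∈ realCut α β, ω.eval x ≠ 0) (hdeg : ω.natDegree = 2 * m)
    {q : ℝ[X]} (hqm : q.natDegree ≤ m)
    (hq : ∀ h : ℝ[X], h.degree < (m : WithBot ℕ) →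
      ∫ x, q.eval x * h.eval x / ω.eval x ∂μ = 0)
    {x₀ : ℝ} (hx₀ : x₀ ∉ realCut α β) {Q : ℝ[X]} (hQm : Q.natDegree ≤ m) {l : ℝ}
    (hl : Q.eval x₀ = l * q.eval x₀) :
    l ^ 2 * |∫ x, q.eval x ^ 2 / ω.eval x / (x₀ - x) ∂μ| ≤
      |∫ x, Q.eval x ^ 2 / ω.eval x / (x₀ - x) ∂μ| := by
  have hx : ∀ x ∈ realCut α β, x₀ - x ≠ 0 := fun x hx h => hx₀ (by rwa [sub_eq_zero.1 h])
  obtain ⟨ε, hεabs, hε⟩ := exists_sign (α := α) (β := β) (g := fun x => 1 / (ω.eval x * (x₀ - x)))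
    (continuousOn_const.div (ω.continuous.continuousOn.mul (by fun_prop))
      fun x hx' => mul_ne_zero (hω x hx') (hx x hx'))
    fun x hx' => one_div_ne_zero (mul_ne_zero (hω x hx') (hx x hx'))
  have hI : ∀ P : ℝ[X], P.natDegree ≤ m →
      Integrable (fun x : ℝ => P.eval x ^ 2 / ω.eval x / (x₀ - x)) μ := by
    intro P hP
    have := hμ.integrable_real_div_sub (N := P ^ 2) hω (by
      rw [hdeg, natDegree_pow]; omega) hx₀
    simpa only [eval_pow] using this
  have hpos : ∀ P : ℝ[X], 0 ≤ ε * ∫ x, P.eval x ^ 2 / ω.eval x / (x₀ - x) ∂μ := by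
    intro P
    rw [← integral_const_mul]
    refine integral_nonneg_of_ae ?_
    filter_upwards [hμ.ae_mem] with x hx'
    have := hε x hx'
    have h2 : ε * (P.eval x ^ 2 / ω.eval x / (x₀ - x)) =
      ε * (1 / (ω.eval x * (x₀ - x))) * P.eval x ^ 2 := by
      rw [div_div]; ring
    rw [h2]
    exact mul_nonneg this.le (sq_nonneg _)
  have habs : ∀ P : ℝ[X], |∫ x, P.eval x ^ 2 / ω.eval x / (x₀ - x) ∂μ| =
      ε * ∫ x, P.eval x ^ 2 / ω.eval x / (x₀ - x) ∂μ := fun P => by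
    rw [← abs_of_nonneg (hpos P), abs_mul, hεabs, one_mul]
  obtain ⟨g, hg, hgdeg⟩ := exists_eq_C_eval_add_mul hm (Q - C l * q)
    ((natDegree_sub_le _ _).trans (max_le hQm ((natDegree_C_mul_le _ _).trans hqm))) x₀
  have hR0 : (Q - C l * q).eval x₀ = 0 := by simp [hl]
  rw [hR0, C_0, zero_add] at hg
  have hRm : (Q - C l * q).natDegree ≤ m :=
    (natDegree_sub_le _ _).trans (max_le hQm ((natDegree_C_mul_le _ _).trans hqm))
  have hqg := hq g hgdeg
  have hqgI : Integrable (fun x => q.eval x * g.eval x / ω.eval x) μ := by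
    have := hμ.integrable_real_div (N := q * g) hω (by
      rw [hdeg]
      rcases eq_or_ne g 0 with rfl | g0
      · rw [mul_zero, natDegree_zero]; omega
      have h1 := (natDegree_lt_iff_degree_lt g0).2 hgdeg
      have := natDegree_mul_le (p := q) (q := g)
      omega)
    simpa only [eval_mul] using this
  have hexp : ∫ x, Q.eval x ^ 2 / ω.eval x / (x₀ - x) ∂μ =
      l ^ 2 * ∫ x, q.eval x ^ 2 / ω.eval x / (x₀ - x) ∂μ +
      (-2 * l) * ∫ x, q.eval x * g.eval x / ω.eval x ∂μ +
      ∫ x, (Q - C l * q).eval x ^ 2 / ω.eval x / (x₀ - x) ∂μ := by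
    rw [← integral_const_mul, ← integral_const_mul,
      ← integral_add ((hI q hqm).const_mul _) (hqgI.const_mul _)]
    refine Eq.trans ?_ (integral_add (((hI q hqm).const_mul _).add (hqgI.const_mul _)) (hI _ hRm))
    refine integral_congr_ae ?_
    filter_upwards [hμ.ae_mem] with x hx'
    have h1 := hω x hx'
    have h2 := hx x hx'
    have h3 : Q.eval x = l * q.eval x + (x - x₀) * g.eval x := by
      have := congrArg (eval x) hg
      simp only [eval_sub, eval_mul, eval_C, eval_X] at this
      linarith
    have h4 : (Q - C l * q).eval x = (x - x₀) * g.eval x := by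
      rw [hg]; simp
    rw [h4, h3]
    field_simp
    ring
  rw [hqg, mul_zero, add_zero] at hexp
  rw [habs, habs, hexp, mul_add]
  have := hpos (Q - C l * q)
  linarith

theorem markov_ofReal (μ : Measure ℝ) (x₀ : ℝ) :
    markov μ x₀ = ((∫ x, 1 / (x₀ - x) ∂μ : ℝ) : ℂ) := by
  rw [markov, ← integral_complex_ofReal]
  refine integral_congr_ae (Filter.Eventually.of_forall fun x => ?_)
  push_cast
  rfl

theorem IsMarkovMeasure.integrable_real (hμ : IsMarkovMeasure α β μ) {x₀ : ℝ}
    (hx₀ : x₀ ∉ realCut α β) : Integrable (fun x => 1 / (x₀ - x)) μ := by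
  refine (hμ.integrable (x₀ : ℂ) (by simpa using hx₀)).re.congr
    (Filter.Eventually.of_forall fun x => ?_)
  simp only [← Complex.ofReal_sub, ← Complex.ofReal_one, ← Complex.ofReal_div]
  exact Complex.ofReal_re _

theorem exists_sign_sub {x₀ : ℝ} (hx₀ : x₀ ∉ realCut α β) :
    ∃ ε : ℝ, |ε| = 1 ∧ ∀ x ∈ realCut α β, 0 < ε * (1 / (x₀ - x)) := by
  have hx : ∀ x ∈ realCut α β, x₀ - x ≠ 0 := fun x hx h => hx₀ (by rwa [sub_eq_zero.1 h])
  exact exists_sign (continuousOn_const.div (by fun_prop) hx) fun x hx' => one_div_ne_zero (hx x hx')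

theorem IsMarkovMeasure.markov_ne_zero (hμ : IsMarkovMeasure α β μ) {x₀ : ℝ}
    (hx₀ : x₀ ∉ realCut α β) : markov μ x₀ ≠ 0 := by
  obtain ⟨ε, -, hε⟩ := exists_sign_sub hx₀
  rw [markov_ofReal, Complex.ofReal_ne_zero]
  intro h0
  have h1 : ∫ x, ε * (1 / (x₀ - x)) ∂μ = 0 := by rw [integral_const_mul, h0, mul_zero]
  rw [integral_eq_zero_iff_of_nonneg_ae ?_ ((hμ.integrable_real hx₀).const_mul ε)] at h1
  · have h2 : (1 : ℝ[X]) = 0 := hμ.eq_zero_of_ae_eval_eq_zero (by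
      filter_upwards [h1, hμ.ae_mem] with x hx hxc
      exact absurd hx (hε x hxc).ne')
    exact one_ne_zero h2
  · filter_upwards [hμ.ae_mem] with x hxc using (hε x hxc).le

/-- The interpolant of a Markov function: it exists, its denominator has no zeros off the cut, and
its error at a real point is controlled by any polynomial `Q` of degree at most `m` whose square
is dominated by the node polynomial on the cut. -/
theorem IsMarkovMeasure.exists_interpolant (hμ : IsMarkovMeasure α β μ) {m : ℕ} (hm : 0 < m)
    {z : Fin (2 * m) → ℂ} (hz : ∀ j, z j ∉ complexCut α β) {ω : ℝ[X]}
    (hω : ω.map Complex.ofRealHom = nodePoly z) :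
    ∃ r : RatFunc ℂ, IsRationalInterpolant m z (markov μ) r ∧
      ∀ x₀ : ℝ, x₀ ∉ realCut α β → r.denom.eval (x₀ : ℂ) ≠ 0 ∧
        ∀ (Q : ℝ[X]) (M : ℝ), Q.natDegree ≤ m →
          (∀ x ∈ realCut α β, Q.eval x ^ 2 ≤ M * |ω.eval x|) →
          ‖markov μ x₀ - ratVal r x₀‖ * Q.eval x₀ ^ 2 ≤ M * |ω.eval x₀| * ‖markov μ x₀‖ := by
  have hω0 : ∀ x ∈ realCut α β, ω.eval x ≠ 0 := by
    intro x hx h0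
    have h1 : (nodePoly z).eval (x : ℂ) = 0 := by rw [← hω, eval_map_ofReal, h0]; simp
    rw [nodePoly_eval, Finset.prod_eq_zero_iff] at h1
    obtain ⟨j, -, hj⟩ := h1
    exact hz j ⟨x, hx, (sub_eq_zero.1 hj).symm⟩
  have hdeg : ω.natDegree = 2 * m := by
    rw [← natDegree_map Complex.ofRealHom, hω, nodePoly_natDegree]
  obtain ⟨q, hq0, hqm, hq⟩ := hμ.exists_orthogonal hm hω0 hdeg
  have hqz : ∀ w ∉ complexCut α β, (q.map Complex.ofRealHom).eval w ≠ 0 := fun w hw =>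
    hμ.orthogonal_eval_ne_zero hω0 hdeg hq0 hqm hq hw
  -- the nodes with indices below `m` give one half of the factors of `ω`
  let S : Finset (Fin (2 * m)) := Finset.univ.filter fun j => (j : ℕ) < m
  have hS : S.card = m := by
    simp only [S, Fin.card_filter_val_lt]
    omega
  have hSc : Sᶜ.card = m := by
    rw [Finset.card_compl, hS, Fintype.card_fin]; omega
  have hdegprod : ∀ T : Finset (Fin (2 * m)), (∏ j ∈ T, (X - C (z j))).natDegree = T.card :=
    fun T => by simp [natDegree_prod_of_monic _ _ fun j _ => monic_X_sub_C (z j)]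
  obtain ⟨p, hp, hpq⟩ := hμ.exists_numerator hm hω0 hdeg
    (ω₁ := ∏ j ∈ S, (X - C (z j))) (ω₂ := ∏ j ∈ Sᶜ, (X - C (z j)))
    (by rw [hω, Finset.prod_mul_prod_compl]; rfl) (by rw [hdegprod, hS]) (by rw [hdegprod, hSc])
    hqm hq
  have hJ : DifferentiableOn ℂ (fun w => ∫ x : ℝ, ((q.eval x / ω.eval x : ℝ) : ℂ) / (w - x) ∂μ)
      (complexCut α β)ᶜ := by
    refine differentiableOn_cauchyTransform hμ.ae_mem fun w hw => ?_
    refine (hμ.integrable_div_mul_sub (N := q.map Complex.ofRealHom)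
      (D := ω.map Complex.ofRealHom) (fun x hx => by
        rw [eval_map_ofReal]; exact_mod_cast hω0 x hx) (by
        rw [natDegree_map, natDegree_map, hdeg]; omega) hw).congr
      (Filter.Eventually.of_forall fun x => ?_)
    simp only [eval_map_ofReal]
    push_cast
    rfl
  have hopen : ∀ j, (complexCut α β)ᶜ ∈ nhds (z j) := fun j =>
    (isClosed_complexCut α β).isOpen_compl.mem_nhds (hz j)
  refine ⟨algebraMap ℂ[X] (RatFunc ℂ) p / algebraMap ℂ[X] (RatFunc ℂ) (q.map Complex.ofRealHom),
    isRationalInterpolant_div hp (by rwa [natDegree_map]) (fun j => hqz _ (hz j))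
      (fun j => hμ.differentiableOn_markov.analyticAt (hopen j))
      (fun j => hJ.analyticAt (hopen j)) fun j => ?_, fun x₀ hx₀ => ?_⟩
  · filter_upwards [hopen j] with w hw
    rw [hpq w hw, hω]
  have hx₀c : (x₀ : ℂ) ∉ complexCut α β := by simpa using hx₀
  obtain ⟨hden, hval⟩ := ratVal_div_eq (p := p) (hqz x₀ hx₀c)
  refine ⟨hden, fun Q M hQm hQ => ?_⟩
  have hqx : q.eval x₀ ≠ 0 := by
    have := hqz x₀ hx₀c
    rwa [eval_map_ofReal, Complex.ofReal_ne_zero] at this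
  -- by orthogonality a factor `q (x₀)` may be moved under the integral
  have hsq : q.eval x₀ * ∫ x, q.eval x / ω.eval x / (x₀ - x) ∂μ =
      ∫ x, q.eval x ^ 2 / ω.eval x / (x₀ - x) ∂μ := by
    obtain ⟨g, hg, hgdeg⟩ := exists_eq_C_eval_add_mul hm q hqm x₀
    have hI1 := hμ.integrable_real_div_sub (N := q) hω0 (by rw [hdeg]; omega) hx₀
    have hI2 := hμ.integrable_real_div_sub (N := q ^ 2) hω0 (by
      rw [hdeg, natDegree_pow]; omega) hx₀
    simp only [eval_pow] at hI2
    rw [← integral_const_mul, ← sub_eq_zero, ← integral_sub (hI1.const_mul _) hI2, ← hq g hgdeg]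
    refine integral_congr_ae ?_
    filter_upwards [hμ.ae_mem] with x hx
    have h1 := hω0 x hx
    have h2 : x₀ - x ≠ 0 := fun h => hx₀ (by rwa [sub_eq_zero.1 h])
    have h3 : q.eval x = q.eval x₀ + (x - x₀) * g.eval x := by
      conv_lhs => rw [hg]
      simp
    field_simp
    linear_combination (-q.eval x) * h3
  have hext := hμ.extremal hm hω0 hdeg hqm hq hx₀ hQm (Q := Q) (l := Q.eval x₀ / q.eval x₀)
    (by field_simp)
  have hM : |∫ x, Q.eval x ^ 2 / ω.eval x / (x₀ - x) ∂μ| ≤ M * ‖markov μ x₀‖ := by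
    obtain ⟨ε, hε1, hε⟩ := exists_sign_sub hx₀
    have h1 : ‖markov μ x₀‖ = ∫ x, ε * (1 / (x₀ - x)) ∂μ := by
      rw [markov_ofReal, Complex.norm_real, Real.norm_eq_abs, integral_const_mul,
        ← one_mul |∫ x, _ ∂μ|]
      nth_rw 1 [← hε1]
      rw [← abs_mul, abs_of_nonneg]
      rw [← integral_const_mul]
      refine integral_nonneg_of_ae ?_
      filter_upwards [hμ.ae_mem] with x hx using (hε x hx).le
    rw [h1, ← integral_const_mul, ← Real.norm_eq_abs]
    refine norm_integral_le_of_norm_le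
      (((hμ.integrable_real hx₀).const_mul ε).const_mul M) ?_
    filter_upwards [hμ.ae_mem] with x hx
    have h2 : |1 / (x₀ - x)| = ε * (1 / (x₀ - x)) := by
      rw [← abs_of_pos (hε x hx), abs_mul, hε1, one_mul]
    have h3 : 0 < |ω.eval x| := abs_pos.2 (hω0 x hx)
    rw [← h2, Real.norm_eq_abs, div_eq_mul_one_div _ (x₀ - x), abs_mul, abs_div,
      abs_of_nonneg (sq_nonneg _)]
    refine mul_le_mul_of_nonneg_right ?_ (abs_nonneg _)
    rw [div_le_iff₀ h3]
    exact hQ x hx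
  have herr : markov μ x₀ - p.eval (x₀ : ℂ) / (q.eval x₀ : ℝ) =
      ((ω.eval x₀ * (∫ x, q.eval x ^ 2 / ω.eval x / (x₀ - x) ∂μ) / q.eval x₀ ^ 2 : ℝ) : ℂ) := by
    have h1 := hpq x₀ hx₀c
    have h2 : ∫ x : ℝ, ((q.eval x / ω.eval x : ℝ) : ℂ) / ((x₀ : ℂ) - x) ∂μ =
        ((∫ x, q.eval x / ω.eval x / (x₀ - x) ∂μ : ℝ) : ℂ) := by
      rw [← integral_complex_ofReal]
      refine integral_congr_ae (Filter.Eventually.of_forall fun x => ?_)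
      push_cast
      rfl
    rw [h2, eval_map_ofReal, eval_map_ofReal] at h1
    rw [← hsq]
    generalize (∫ x, q.eval x / ω.eval x / (x₀ - x) ∂μ) = I at h1 ⊢
    have hqc : ((q.eval x₀ : ℝ) : ℂ) ≠ 0 := by exact_mod_cast hqx
    push_cast
    field_simp
    linear_combination h1
  rw [hval, eval_map_ofReal, herr, Complex.norm_real, Real.norm_eq_abs, abs_div, abs_mul,
    abs_of_nonneg (sq_nonneg (q.eval x₀))]
  have hfin := mul_le_mul_of_nonneg_left (hext.trans hM) (abs_nonneg (ω.eval x₀))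
  calc _ = |ω.eval x₀| * ((Q.eval x₀ / q.eval x₀) ^ 2 *
        |∫ x, q.eval x ^ 2 / ω.eval x / (x₀ - x) ∂μ|) := by field_simp
    _ ≤ _ := hfin
    _ = _ := by ring

end Interpolant

/-! ### The slit coordinate and the Markov function of `ν` -/

section Slit

/-- Both cases of the interval `[α, β]` at once: with `a + b x = x - α` for finite `α` and
`a + b x = 1` for `α = -∞`, the interval is given by `x ≤ β` and `0 ≤ a + b x`, and the density of
`ν` is `c / (π √((a + b x) (β - x)))`. -/
structure IsSlitParam (α : EReal) (β a b c : ℝ) : Prop where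
  kappa_pos : 0 < a + b * β
  b_nonneg : 0 ≤ b
  c_pos : 0 < c
  mem_iff : ∀ x : ℝ, x ∈ realCut α β ↔ x ≤ β ∧ 0 ≤ a + b * x
  density : ∀ x : ℝ, nuDensity α β x = c / (Real.pi * √((a + b * x) * (β - x)))

theorem exists_isSlitParam {α : EReal} {β : ℝ} (hαβ : α < (β : EReal)) :
    ∃ a b c : ℝ, IsSlitParam α β a b c := by
  induction α with
  | bot =>
    refine ⟨1, 0, 1, by simp, le_rfl, one_pos, fun x => by simp [realCut], fun x => ?_⟩
    simp [nuDensity]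
  | top => exact absurd hαβ not_top_lt
  | coe A =>
    have hA : A < β := EReal.coe_lt_coe_iff.1 hαβ
    refine ⟨-A, 1, if A = 0 then 1 else √|A|, by linarith, zero_le_one, ?_, fun x => ?_,
      fun x => ?_⟩
    · split_ifs with h
      · exact one_pos
      · exact Real.sqrt_pos.2 (abs_pos.2 h)
    · simp only [realCut, mem_ofPred_eq, EReal.coe_le_coe_iff]
      constructor
      · rintro ⟨h1, h2⟩; exact ⟨h2, by linarith⟩
      · rintro ⟨h1, h2⟩; exact ⟨by linarith, h1⟩
    · simp only [nuDensity, EReal.coe_ne_bot, if_false, EReal.coe_eq_zero, EReal.toReal_coe]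
      rw [show -A + 1 * x = x - A by ring]

/-- The Möbius coordinate `y = (z - β) / (a + b z)`, which maps the cut onto the negative half-line
(with `0`, and with `∞` if `α` is finite). -/
noncomputable def slitCoord (a b β : ℝ) (z : ℂ) : ℂ := (z - β) / (a + b * z)

/-- The conformal coordinate `s = √y` from the complement of the cut to the right half-plane. -/
noncomputable def slitRoot (a b β : ℝ) (z : ℂ) : ℂ := Complex.sqrt (slitCoord a b β z)

theorem Complex.re_sqrt_pos {y : ℂ} (hy : y ∈ Complex.slitPlane) : 0 < (Complex.sqrt y).re := by
  have hy0 : y ≠ 0 := Complex.slitPlane_ne_zero hy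
  rw [_root_.sqrt_eq_exp hy0, Complex.exp_re]
  refine mul_pos (Real.exp_pos _) (Real.cos_pos_of_mem_Ioo ?_)
  have h1 : (Complex.log y / 2).im = y.arg / 2 := by
    rw [← Complex.log_im]; exact Complex.div_ofNat_im _ _
  rw [h1]
  have h2 := Complex.neg_pi_lt_arg y
  have h3 := lt_of_le_of_ne (Complex.arg_le_pi y) (Complex.mem_slitPlane_iff_arg.1 hy).1
  constructor <;> linarith

theorem Complex.sqrt_sq_self (y : ℂ) : Complex.sqrt y ^ 2 = y := by
  rcases eq_or_ne y 0 with rfl | hy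
  · simp
  rw [_root_.sqrt_eq_exp hy, ← Complex.exp_nat_mul]
  push_cast
  rw [mul_div_cancel₀ _ two_ne_zero, Complex.exp_log hy]

theorem Complex.sqrt_conj {y : ℂ} (hy : y ∈ Complex.slitPlane) :
    Complex.sqrt (starRingEnd ℂ y) = starRingEnd ℂ (Complex.sqrt y) := by
  have hy0 : y ≠ 0 := Complex.slitPlane_ne_zero hy
  rw [_root_.sqrt_eq_exp hy0, _root_.sqrt_eq_exp (by simpa using hy0), ← Complex.exp_conj,
    Complex.log_conj _ (Complex.mem_slitPlane_iff_arg.1 hy).1, map_div₀, Complex.conj_ofNat]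

variable {α : EReal} {β a b c : ℝ}

namespace IsSlitParam

theorem exists_real_of_coord_nonpos (h : IsSlitParam α β a b c) {z : ℂ} {t : ℝ} (ht : 0 ≤ t)
    (hz : z - β = -t * (a + b * z)) : z ∈ complexCut α β := by
  have h1 : 0 < 1 + b * t := by have := mul_nonneg h.b_nonneg ht; linarith
  have h1c : (1 + b * t : ℂ) ≠ 0 := by exact_mod_cast h1.ne'
  have hκ := h.kappa_pos
  have hzx : z = ((β - a * t) / (1 + b * t) : ℝ) := by
    push_cast
    rw [eq_div_iff h1c]
    linear_combination hz
  refine ⟨_, (h.mem_iff _).2 ⟨?_, ?_⟩, hzx⟩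
  · rw [div_le_iff₀ h1]
    nlinarith [mul_nonneg hκ.le ht]
  · have : a + b * ((β - a * t) / (1 + b * t)) = (a + b * β) / (1 + b * t) := by
      field_simp; ring
    rw [this]
    positivity

theorem lin_ne_zero (h : IsSlitParam α β a b c) {z : ℂ} (hz : z ∉ complexCut α β) :
    (a + b * z : ℂ) ≠ 0 := by
  intro h0
  have hκ := h.kappa_pos
  rcases h.b_nonneg.eq_or_lt with hb | hb
  · rw [← hb] at h0 hκ
    have : a = 0 := by simpa using h0
    simp [this] at hκ
  · have hb' : (b : ℂ) ≠ 0 := by exact_mod_cast hb.ne'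
    have h1 : a + b * (-a / b) = 0 := by field_simp; ring
    refine hz ⟨-a / b, (h.mem_iff _).2 ⟨?_, h1.ge⟩, ?_⟩
    · by_contra! hlt
      have := mul_lt_mul_of_pos_left hlt hb
      linarith
    · push_cast
      field_simp
      linear_combination h0

theorem coord_mem_slitPlane (h : IsSlitParam α β a b c) {z : ℂ} (hz : z ∉ complexCut α β) :
    slitCoord a b β z ∈ Complex.slitPlane := by
  by_contra hns
  rw [Complex.mem_slitPlane_iff, not_or, not_lt, not_not] at hns
  refine hz (h.exists_real_of_coord_nonpos (t := -(slitCoord a b β z).re) (by linarith [hns.1]) ?_)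
  have h1 : slitCoord a b β z = ((slitCoord a b β z).re : ℂ) :=
    Complex.ext rfl (by simp [hns.2])
  push_cast
  rw [neg_neg, ← h1, slitCoord, div_mul_cancel₀ _ (h.lin_ne_zero hz)]

theorem re_root_pos (h : IsSlitParam α β a b c) {z : ℂ} (hz : z ∉ complexCut α β) :
    0 < (slitRoot a b β z).re := Complex.re_sqrt_pos (h.coord_mem_slitPlane hz)

theorem root_ne_zero (h : IsSlitParam α β a b c) {z : ℂ} (hz : z ∉ complexCut α β) :
    slitRoot a b β z ≠ 0 := fun h0 => by
  have := h.re_root_pos hz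
  simp [h0] at this

theorem root_add_ne_zero (h : IsSlitParam α β a b c) {z w : ℂ} (hz : z ∉ complexCut α β)
    (hw : w ∉ complexCut α β) : slitRoot a b β z + slitRoot a b β w ≠ 0 := fun h0 => by
  have h1 := h.re_root_pos hz
  have h2 := h.re_root_pos hw
  have := congrArg Complex.re h0
  simp only [Complex.add_re, Complex.zero_re] at this
  linarith

theorem differentiableOn_root (h : IsSlitParam α β a b c) :
    DifferentiableOn ℂ (slitRoot a b β) (complexCut α β)ᶜ := by
  intro z hz
  refine DifferentiableAt.differentiableWithinAt ?_
  refine (Complex.differentiableAt_sqrt (h.coord_mem_slitPlane hz)).comp z ?_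
  exact DifferentiableAt.div (by fun_prop) (by fun_prop) (h.lin_ne_zero hz)

theorem root_conj (h : IsSlitParam α β a b c) {z : ℂ} (hz : z ∉ complexCut α β) :
    slitRoot a b β (starRingEnd ℂ z) = starRingEnd ℂ (slitRoot a b β z) := by
  rw [slitRoot, slitRoot, ← Complex.sqrt_conj (h.coord_mem_slitPlane hz)]
  congr 1
  simp [slitCoord]

theorem lin_mul_pos (h : IsSlitParam α β a b c) {x : ℝ} (hx : x ∉ realCut α β) :
    0 < (x - β) * (a + b * x) := by
  have hb := h.b_nonneg
  have hκ := h.kappa_pos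
  rw [h.mem_iff, not_and, not_le] at hx
  rcases le_or_gt x β with hxβ | hxβ
  · have h1 := hx hxβ
    have h2 : x ≠ β := by rintro rfl; linarith
    exact mul_pos_of_neg_of_neg (by linarith [lt_of_le_of_ne hxβ h2]) h1
  · exact mul_pos (by linarith) (by nlinarith)

theorem root_ofReal (h : IsSlitParam α β a b c) {x : ℝ} (hx : x ∉ realCut α β) :
    slitRoot a b β x = ((√((x - β) / (a + b * x)) : ℝ) : ℂ) ∧ 0 < √((x - β) / (a + b * x)) := by
  have h1 : 0 < (x - β) / (a + b * x) := by
    have := h.lin_mul_pos hx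
    rcases pos_and_pos_or_neg_and_neg_of_mul_pos this with ⟨h1, h2⟩ | ⟨h1, h2⟩
    · exact div_pos h1 h2
    · exact div_pos_of_neg_of_neg h1 h2
  refine ⟨?_, Real.sqrt_pos.2 h1⟩
  have h2 : slitCoord a b β x = (((x - β) / (a + b * x) : ℝ) : ℂ) := by
    simp [slitCoord]
  rw [slitRoot, h2, Complex.sqrt_of_nonneg (by exact_mod_cast h1.le), Complex.ofReal_re]

theorem coord_sub {a b β : ℝ} {z w : ℂ} (hz : (a + b * z : ℂ) ≠ 0)
    (hw : (a + b * w : ℂ) ≠ 0) :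
    slitCoord a b β z - slitCoord a b β w =
      (a + b * β) * (z - w) / ((a + b * z) * (a + b * w)) := by
  rw [slitCoord, slitCoord, div_sub_div _ _ hz hw]
  congr 1
  ring

end IsSlitParam

/-- For `Re s > 0` the logarithms give the antiderivative
`(log (s + iτ) - log (s - iτ)) / (2 i s)` of `1 / (s² + τ²)`. -/
theorem integral_Ioi_one_div_sq_add_sq {s : ℂ} (hs : 0 < s.re) :
    ∫ t in Ioi (0 : ℝ), 1 / (s ^ 2 + (t : ℂ) ^ 2) = Real.pi / (2 * s) := by
  have hs0 : s ≠ 0 := fun h => by simp [h] at hs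
  have hslit : ∀ t : ℝ, s + t * Complex.I ∈ Complex.slitPlane := fun t => by
    left; simpa using hs
  have hslit' : ∀ t : ℝ, s - t * Complex.I ∈ Complex.slitPlane := fun t => by
    left; simpa using hs
  have hfac : ∀ t : ℝ, s ^ 2 + (t : ℂ) ^ 2 = (s + t * Complex.I) * (s - t * Complex.I) := fun t => by
    linear_combination ((t : ℂ) ^ 2) * Complex.I_sq
  have hne : ∀ t : ℝ, s ^ 2 + (t : ℂ) ^ 2 ≠ 0 := fun t => by
    rw [hfac]
    exact mul_ne_zero (Complex.slitPlane_ne_zero (hslit t)) (Complex.slitPlane_ne_zero (hslit' t))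
  have hderiv : ∀ t ∈ Ici (0 : ℝ), HasDerivAt (fun t : ℝ =>
      (Complex.log (s + t * Complex.I) - Complex.log (s - t * Complex.I)) / (2 * Complex.I * s))
      (1 / (s ^ 2 + (t : ℂ) ^ 2)) t := by
    intro t _
    have h0 : HasDerivAt (fun t : ℝ => (t : ℂ) * Complex.I) Complex.I t := by
      simpa using (Complex.ofRealCLM.hasDerivAt (x := t)).mul_const Complex.I
    have h1 := (h0.const_add s).clog_real (hslit t)
    have h2 := (h0.const_sub s).clog_real (hslit' t)
    refine ((h1.sub h2).div_const (2 * Complex.I * s)).congr_deriv ?_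
    have h3 := Complex.slitPlane_ne_zero (hslit t)
    have h4 := Complex.slitPlane_ne_zero (hslit' t)
    have hI := Complex.I_ne_zero
    rw [hfac, div_sub_div _ _ h3 h4, div_div, div_eq_div_iff (mul_ne_zero (mul_ne_zero h3 h4)
      (mul_ne_zero (mul_ne_zero two_ne_zero hI) hs0)) (mul_ne_zero h3 h4)]
    ring
  have hint : IntegrableOn (fun t : ℝ => 1 / (s ^ 2 + (t : ℂ) ^ 2)) (Ioi 0) := by
    have hcont : Continuous fun t : ℝ => 1 / (s ^ 2 + (t : ℂ) ^ 2) :=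
      continuous_const.div (by fun_prop) hne
    have hO : (fun t : ℝ => 1 / (s ^ 2 + (t : ℂ) ^ 2)) =O[Filter.atTop] fun t : ℝ => t ^ (-2 : ℝ) := by
      refine Asymptotics.IsBigO.of_bound 2 ?_
      filter_upwards [Filter.eventually_ge_atTop (2 * ‖s‖ + 1)] with t ht
      have ht0 : 0 < t := by linarith [norm_nonneg s]
      have h1 : t ^ 2 / 2 ≤ ‖s ^ 2 + (t : ℂ) ^ 2‖ := by
        have h2 : ‖(t : ℂ) ^ 2‖ ≤ ‖s ^ 2 + (t : ℂ) ^ 2‖ + ‖s ^ 2‖ := by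
          have := norm_sub_le (s ^ 2 + (t : ℂ) ^ 2) (s ^ 2)
          simpa using this
        rw [norm_pow, norm_pow, Complex.norm_real, Real.norm_of_nonneg ht0.le] at h2
        nlinarith [norm_nonneg s]
      rw [norm_div, norm_one, Real.norm_of_nonneg (by positivity), Real.rpow_neg ht0.le,
        Real.rpow_two, div_le_iff₀ (norm_pos_iff.2 (hne t))]
      calc (1 : ℝ) = 2 * (t ^ 2)⁻¹ * (t ^ 2 / 2) := by field_simp
        _ ≤ _ := by gcongr
    have := (hcont.locallyIntegrable.locallyIntegrableOn (Ici 0)).integrableOn_of_isBigO_atTop hO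
      ⟨Ioi 1, Filter.Ioi_mem_atTop 1, integrableOn_Ioi_rpow_of_lt (by norm_num) one_pos⟩
    exact this.mono_set Ioi_subset_Ici_self
  have hlim : Filter.Tendsto (fun t : ℝ =>
      (Complex.log (s + t * Complex.I) - Complex.log (s - t * Complex.I)) / (2 * Complex.I * s))
      Filter.atTop (nhds (Real.pi / (2 * s))) := by
    have h0 : Filter.Tendsto (fun t : ℝ => s / (t : ℂ)) Filter.atTop (nhds 0) := by
      have := (Complex.continuous_ofReal.tendsto 0).comp tendsto_inv_atTop_zero
      have := this.const_mul s
      simpa [div_eq_mul_inv, Function.comp_def] using this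
    have hI : Complex.I ∈ Complex.slitPlane := by
      rw [Complex.mem_slitPlane_iff]; simp
    have hI' : -Complex.I ∈ Complex.slitPlane := by
      rw [Complex.mem_slitPlane_iff]; simp
    have h1 : Filter.Tendsto (fun t : ℝ => Complex.log (s / t + Complex.I)) Filter.atTop
        (nhds (Complex.log Complex.I)) := by
      have := (h0.add_const Complex.I)
      rw [zero_add] at this
      exact this.clog hI
    have h2 : Filter.Tendsto (fun t : ℝ => Complex.log (s / t - Complex.I)) Filter.atTop
        (nhds (Complex.log (-Complex.I))) := by
      have := (h0.sub_const Complex.I)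
      rw [zero_sub] at this
      exact this.clog hI'
    have h3 := (h1.sub h2).div_const (2 * Complex.I * s)
    rw [Complex.log_I, Complex.log_neg_I] at h3
    have h4 : (Real.pi / 2 * Complex.I - -(Real.pi / 2) * Complex.I) / (2 * Complex.I * s) =
        Real.pi / (2 * s) := by
      have hI := Complex.I_ne_zero
      field_simp
      ring
    rw [h4] at h3
    refine h3.congr' ?_
    filter_upwards [Filter.eventually_gt_atTop 0] with t ht
    have ht' : (t : ℂ) ≠ 0 := by exact_mod_cast ht.ne'
    have e1 : s + t * Complex.I = t * (s / t + Complex.I) := by field_simp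
    have e2 : s - t * Complex.I = t * (s / t - Complex.I) := by field_simp
    have n1 : s / t + Complex.I ≠ 0 := fun h => by
      have := Complex.slitPlane_ne_zero (hslit t)
      rw [e1, h, mul_zero] at this; exact this rfl
    have n2 : s / t - Complex.I ≠ 0 := fun h => by
      have := Complex.slitPlane_ne_zero (hslit' t)
      rw [e2, h, mul_zero] at this; exact this rfl
    rw [e1, e2, Complex.log_ofReal_mul ht n1, Complex.log_ofReal_mul ht n2]
    ring
  rw [integral_Ioi_of_hasDerivAt_of_tendsto' hderiv hint hlim]
  simp

/-- The Markov function of `ν` is `c / ((a + b z) √y)`; the substitution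
`x = (β - a τ²) / (1 + b τ²)`, that is `y = -τ²`, turns the integral into
`∫ 2 c dτ / (π (a + b z) (s² + τ²))`. -/
theorem IsSlitParam.markov_nu (h : IsSlitParam α β a b c) {z : ℂ} (hz : z ∉ complexCut α β) :
    markov (nu α β) z = c / ((a + b * z) * slitRoot a b β z) := by
  have hκ := h.kappa_pos
  have hb := h.b_nonneg
  have hdens : nuDensity α β = fun x => c / (Real.pi * √((a + b * x) * (β - x))) :=
    funext h.density
  have hmeas : Measurable fun x => ENNReal.ofReal (nuDensity α β x) := by
    rw [hdens]; fun_prop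
  have hnn : ∀ x, 0 ≤ nuDensity α β x := fun x => by
    rw [h.density]; have := h.c_pos; positivity
  let X : ℝ → ℝ := fun t => (β - a * t ^ 2) / (1 + b * t ^ 2)
  have hden : ∀ t : ℝ, 0 < 1 + b * t ^ 2 := fun t => by
    have := mul_nonneg hb (sq_nonneg t); linarith
  have hX1 : ∀ t, a + b * X t = (a + b * β) / (1 + b * t ^ 2) := fun t => by
    have := (hden t).ne'
    simp only [X]; field_simp; ring
  have hX2 : ∀ t, β - X t = (a + b * β) * t ^ 2 / (1 + b * t ^ 2) := fun t => by
    have := (hden t).ne'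
    simp only [X]; field_simp; ring
  have hXd : ∀ t ∈ Ioi (0 : ℝ), HasDerivWithinAt X
      (-(2 * t * (a + b * β) / (1 + b * t ^ 2) ^ 2)) (Ioi 0) t := by
    intro t _
    have h1 : HasDerivAt (fun t : ℝ => β - a * t ^ 2) (-(a * (2 * t))) t := by
      simpa using ((hasDerivAt_pow 2 t).const_mul a).const_sub β
    have h2 : HasDerivAt (fun t : ℝ => 1 + b * t ^ 2) (b * (2 * t)) t := by
      simpa using ((hasDerivAt_pow 2 t).const_mul b).const_add 1
    refine (h1.div h2 (hden t).ne').hasDerivWithinAt.congr_deriv ?_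
    have := (hden t).ne'
    field_simp
    ring
  have hinj : InjOn X (Ioi 0) := by
    intro t ht t' ht' htt
    have e1 := hX1 t
    have e2 := hX2 t
    rw [htt, hX1 t'] at e1
    rw [htt, hX2 t'] at e2
    have d := (hden t).ne'
    have d' := (hden t').ne'
    rw [div_eq_div_iff d' d] at e1
    rw [mul_left_cancel₀ hκ.ne' e1] at e2
    have e3 : t' ^ 2 = t ^ 2 := by
      field_simp at e2
      exact e2
    exact ((pow_left_inj₀ (le_of_lt ht') (le_of_lt ht) two_ne_zero).1 e3).symm
  have himg : X '' Ioi 0 = {x | x < β ∧ 0 < a + b * x} := by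
    ext x
    constructor
    · rintro ⟨t, ht, rfl⟩
      have ht : 0 < t := ht
      have := hden t
      refine ⟨?_, ?_⟩
      · rw [← sub_pos, hX2]; positivity
      · rw [hX1]; positivity
    · rintro ⟨h1, h2⟩
      have h3 : 0 < (β - x) / (a + b * x) := div_pos (sub_pos.2 h1) h2
      refine ⟨√((β - x) / (a + b * x)), Real.sqrt_pos.2 h3, ?_⟩
      simp only [X, Real.sq_sqrt h3.le]
      have := h2.ne'
      have h4 : (a + b * x) + b * (β - x) ≠ 0 := by
        rw [show a + b * x + b * (β - x) = a + b * β by ring]; exact hκ.ne'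
      rw [div_eq_iff (by rw [← mul_div_assoc, one_add_div this]; exact div_ne_zero h4 this)]
      linear_combination -(div_mul_cancel₀ (β - x) this)
  have hae : realCut α β =ᵐ[volume] X '' Ioi 0 := by
    rw [himg]
    refine ae_eq_set.2 ⟨measure_mono_null (t := {β, -a / b}) ?_ ?_, ?_⟩
    · rintro x ⟨hx, hx'⟩
      rw [h.mem_iff] at hx
      simp only [mem_ofPred_eq, not_and, not_lt] at hx'
      rcases hx.1.eq_or_lt with h1 | h1
      · exact Or.inl h1
      · right
        have h2 := le_antisymm (hx' h1) hx.2
        have hb0 : b ≠ 0 := by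
          rintro rfl
          simp only [zero_mul, add_zero] at h2 hκ
          exact hκ.ne' h2
        rw [mem_singleton_iff]
        field_simp
        linarith
    · exact (Set.toFinite _).measure_zero _
    · refine measure_mono_null (t := ∅) ?_ measure_empty
      rintro x ⟨hx, hx'⟩
      exact hx' ((h.mem_iff x).2 ⟨hx.1.le, hx.2.le⟩)
  have hl := h.lin_ne_zero hz
  have hs2 : slitRoot a b β z ^ 2 = slitCoord a b β z := Complex.sqrt_sq_self _
  rw [markov, nu, integral_withDensity_eq_integral_toReal_smul hmeas
    (Filter.Eventually.of_forall fun _ => ENNReal.ofReal_lt_top), setIntegral_congr_set hae,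
    integral_image_eq_integral_abs_deriv_smul measurableSet_Ioi hXd hinj]
  have hcongr : ∀ t ∈ Ioi (0 : ℝ), |-(2 * t * (a + b * β) / (1 + b * t ^ 2) ^ 2)| •
      (ENNReal.ofReal (nuDensity α β (X t))).toReal • (1 / (z - ((X t : ℝ) : ℂ))) =
      (2 * c / (Real.pi * (a + b * z))) * (1 / (slitRoot a b β z ^ 2 + (t : ℂ) ^ 2)) := by
    intro t ht
    have ht : 0 < t := ht
    have hd := hden t
    have hdc : (1 + b * (t : ℂ) ^ 2) ≠ 0 := by exact_mod_cast hd.ne'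
    have hsq : (a + b * X t) * (β - X t) = ((a + b * β) * t / (1 + b * t ^ 2)) ^ 2 := by
      rw [hX1, hX2]; field_simp
    rw [ENNReal.toReal_ofReal (hnn _), h.density, hsq, Real.sqrt_sq (by positivity), abs_neg,
      abs_of_nonneg (by positivity), smul_smul]
    have e1 : 2 * t * (a + b * β) / (1 + b * t ^ 2) ^ 2 *
        (c / (Real.pi * ((a + b * β) * t / (1 + b * t ^ 2)))) =
        2 * c / (Real.pi * (1 + b * t ^ 2)) := by
      field_simp
    have e2 : z - ((X t : ℝ) : ℂ) = ((z - β) + t ^ 2 * (a + b * z)) / (1 + b * (t : ℂ) ^ 2) := by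
      have hX : (1 + b * (t : ℂ) ^ 2) * ((X t : ℝ) : ℂ) = β - a * t ^ 2 := by
        simp only [X]
        push_cast
        rw [mul_div_cancel₀ _ hdc]
      rw [eq_div_iff hdc]
      linear_combination -hX
    have e3 : slitRoot a b β z ^ 2 + (t : ℂ) ^ 2 =
        ((z - β) + t ^ 2 * (a + b * z)) / (a + b * z) := by
      rw [hs2, slitCoord, add_div, mul_div_cancel_right₀ _ hl]
    have e4 : (z - β) + t ^ 2 * (a + b * z) ≠ 0 := by
      intro h0
      refine hz (h.exists_real_of_coord_nonpos (sq_nonneg t) ?_)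
      push_cast
      linear_combination h0
    have hpi : (Real.pi : ℂ) ≠ 0 := by exact_mod_cast Real.pi_ne_zero
    rw [e1, e2, e3, Complex.real_smul]
    push_cast
    field_simp
  rw [setIntegral_congr_fun measurableSet_Ioi hcongr, integral_const_mul,
    integral_Ioi_one_div_sq_add_sq (h.re_root_pos hz)]
  have hpi : (Real.pi : ℂ) ≠ 0 := by exact_mod_cast Real.pi_ne_zero
  have hr := h.root_ne_zero hz
  field_simp

end Slit

/-! ### Conformal maps of the complement of the cut -/

section Conformal

/-- The inverse of an injective holomorphic function is holomorphic: it is continuous by the open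
mapping theorem and differentiable off the isolated critical values, which are removable. -/
theorem differentiableOn_leftInverse {Ω : Set ℂ} (hΩ : IsOpen Ω) {C k : ℂ → ℂ}
    (hC : DifferentiableOn ℂ C Ω) (hinj : InjOn C Ω) (hk : ∀ z ∈ Ω, k (C z) = z) :
    DifferentiableOn ℂ k (C '' Ω) := by
  have hnc : ∀ z ∈ Ω, ¬ ∀ᶠ w in nhds z, C w = C z := by
    intro z hz hev
    have h1 : ∀ᶠ w in nhds z, w = z := by
      filter_upwards [hev, hΩ.mem_nhds hz] with w hw hwΩ using hinj hwΩ hz hw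
    have h2 : ∀ᶠ w in nhdsWithin z {z}ᶜ, w = z := h1.filter_mono nhdsWithin_le_nhds
    obtain ⟨w, hw, hw'⟩ := (h2.and self_mem_nhdsWithin).exists
    exact hw' hw
  have han : ∀ z ∈ Ω, AnalyticAt ℂ C z := fun z hz => hC.analyticAt (hΩ.mem_nhds hz)
  have hmap : ∀ z ∈ Ω, nhds (C z) ≤ Filter.map C (nhds z) := fun z hz =>
    ((han z hz).eventually_constant_or_nhds_le_map_nhds).resolve_left (hnc z hz)
  have himg : ∀ z ∈ Ω, C '' Ω ∈ nhds (C z) := fun z hz =>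
    hmap z hz (Filter.image_mem_map (hΩ.mem_nhds hz))
  have hcont : ∀ z ∈ Ω, ContinuousAt k (C z) := by
    intro z hz
    rw [ContinuousAt, hk z hz]
    refine (Filter.map_mono (hmap z hz)).trans ?_
    rw [Filter.map_map]
    refine Filter.Tendsto.congr' ?_ Filter.tendsto_id
    filter_upwards [hΩ.mem_nhds hz] with w hw using (hk w hw).symm
  have hright : ∀ w ∈ C '' Ω, C (k w) = w := by
    rintro w ⟨z, hz, rfl⟩
    rw [hk z hz]
  have hder : ∀ z ∈ Ω, deriv C z ≠ 0 → DifferentiableAt ℂ k (C z) := by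
    intro z hz hne
    have h1 : HasDerivAt C (deriv C z) (k (C z)) := by
      rw [hk z hz]; exact (han z hz).differentiableAt.hasDerivAt
    refine (HasDerivAt.of_local_left_inverse (hcont z hz) h1 hne ?_).differentiableAt
    filter_upwards [himg z hz] with w hw using hright w hw
  rintro _ ⟨z, hz, rfl⟩
  have hpunct : ∀ᶠ w in nhdsWithin z {z}ᶜ, deriv C w ≠ 0 := by
    refine ((han z hz).deriv.eventually_eq_zero_or_eventually_ne_zero).resolve_left fun h0 => ?_
    obtain ⟨ε, hε, hball⟩ := Metric.eventually_nhds_iff_ball.1 (h0.and (hΩ.mem_nhds hz))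
    refine hnc z hz ?_
    filter_upwards [Metric.ball_mem_nhds z hε] with w hw
    exact Metric.isOpen_ball.is_const_of_deriv_eq_zero (Metric.isPreconnected_ball)
      (hC.mono fun y hy => (hball y hy).2) (fun y hy => (hball y hy).1) hw
      (Metric.mem_ball_self hε)
  have htend : Filter.Tendsto k (nhdsWithin (C z) {C z}ᶜ) (nhdsWithin z {z}ᶜ) := by
    refine tendsto_nhdsWithin_iff.2 ⟨?_, ?_⟩
    · have := hcont z hz
      rw [ContinuousAt, hk z hz] at this
      exact this.mono_left nhdsWithin_le_nhds
    · filter_upwards [self_mem_nhdsWithin, nhdsWithin_le_nhds (himg z hz)] with w hw hw'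
      intro hkw
      rw [mem_singleton_iff] at hkw
      exact hw (by rw [mem_singleton_iff, ← hright w hw', hkw])
  refine (Complex.analyticAt_of_differentiable_on_punctured_nhds_of_continuousAt ?_
    (hcont z hz)).differentiableAt.differentiableWithinAt
  filter_upwards [htend.eventually hpunct, nhdsWithin_le_nhds (himg z hz)] with w hw hw'
  obtain ⟨y, hy, rfl⟩ := hw'
  rw [hk y hy] at hw
  exact hder y hy hw

/-- The Schwarz lemma on the unit disk with at most one point removed. -/
theorem norm_le_norm_of_punctured_ball {U : Set ℂ}
    {p : ℂ} (hp : Metric.ball (0 : ℂ) 1 \ {p} ⊆ U) {g : ℂ → ℂ} (hg : DifferentiableOn ℂ g U)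
    (hg1 : ∀ w ∈ U, ‖g w‖ ≤ 1) (h0U : (0 : ℂ) ∈ U) (h0 : g 0 = 0) {w : ℂ} (hw : w ∈ U)
    (hw1 : ‖w‖ < 1) : ‖g w‖ ≤ ‖w‖ := by
  by_cases hb : Metric.ball (0 : ℂ) 1 ⊆ U
  · exact Complex.norm_le_norm_of_mapsTo_ball (hg.mono hb)
      (fun y hy => mem_closedBall_zero_iff.2 (hg1 y (hb hy))) h0 hw1
  have hpball : p ∈ Metric.ball (0 : ℂ) 1 := by
    by_contra hpb
    exact hb fun y hy => hp ⟨hy, fun hyp => hpb (by rwa [← mem_singleton_iff.1 hyp])⟩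
  have hpU : p ∉ U := by
    intro hpU
    refine hb fun y hy => ?_
    rcases eq_or_ne y p with rfl | hyp
    · exact hpU
    · exact hp ⟨hy, hyp⟩
  have hnhds := Metric.isOpen_ball.mem_nhds hpball
  have hbdd : ∀ y ∈ Metric.ball (0 : ℂ) 1 \ {p}, ‖g y‖ ≤ 1 := fun y hy => hg1 y (hp hy)
  set G := Function.update g p ((nhdsWithin p {p}ᶜ).limUnder g) with hG
  have hGd : DifferentiableOn ℂ G (Metric.ball 0 1) :=
    Complex.differentiableOn_update_limUnder_of_bddAbove hnhds (hg.mono hp)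
      ⟨1, by rintro _ ⟨y, hy, rfl⟩; exact hbdd y hy⟩
  have hGg : ∀ y ∈ U, G y = g y := fun y hy =>
    Function.update_of_ne (by rintro rfl; exact hpU hy) _ _
  have hGp : ‖G p‖ ≤ 1 := by
    have hc : ContinuousAt G p := (hGd.differentiableAt hnhds).continuousAt
    refine le_of_tendsto (hc.norm.tendsto.mono_left nhdsWithin_le_nhds :
      Filter.Tendsto (fun y => ‖G y‖) (nhdsWithin p {p}ᶜ) _) ?_
    filter_upwards [self_mem_nhdsWithin, nhdsWithin_le_nhds hnhds] with y hy hy'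
    rw [hGg y (hp ⟨hy', hy⟩)]
    exact hbdd y ⟨hy', hy⟩
  rw [← hGg w hw]
  refine Complex.norm_le_norm_of_mapsTo_ball hGd (fun y hy => mem_closedBall_zero_iff.2 ?_)
    (by rw [hGg 0 h0U, h0]) hw1
  rcases eq_or_ne y p with rfl | hyp
  · exact hGp
  · rw [hGg y (hp ⟨hy, hyp⟩)]
    exact hbdd y ⟨hy, hyp⟩

/-- A holomorphic function `A` bounded by `1` is dominated by an injective holomorphic function `C`
onto the unit disk, possibly without a point, with the same zero: apply the Schwarz lemma
to `A ∘ C⁻¹`. -/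
theorem norm_le_norm_of_injOn {Ω : Set ℂ} (hΩ : IsOpen Ω) {A C : ℂ → ℂ}
    (hA : DifferentiableOn ℂ A Ω) (hC : DifferentiableOn ℂ C Ω) (hinj : InjOn C Ω)
    (hA1 : ∀ z ∈ Ω, ‖A z‖ ≤ 1) (hC1 : ∀ z ∈ Ω, ‖C z‖ < 1) {p : ℂ}
    (hp : Metric.ball (0 : ℂ) 1 \ {p} ⊆ C '' Ω) {x : ℂ} (hx : x ∈ Ω) (hAx : A x = 0)
    (hCx : C x = 0) {z : ℂ} (hz : z ∈ Ω) : ‖A z‖ ≤ ‖C z‖ := by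
  have hk : ∀ z ∈ Ω, Function.invFunOn C Ω (C z) = z := fun z hz => hinj.leftInvOn_invFunOn hz
  have hkd := differentiableOn_leftInverse hΩ hC hinj hk
  have hmaps : MapsTo (Function.invFunOn C Ω) (C '' Ω) Ω := by
    rintro _ ⟨y, hy, rfl⟩
    rwa [hk y hy]
  have := norm_le_norm_of_punctured_ball hp (hA.comp hkd hmaps)
    (fun w hw => hA1 _ (hmaps hw)) ⟨x, hx, hCx⟩
    (by conv_lhs => rw [← hCx, Function.comp_apply, hk x hx, hAx]) (mem_image_of_mem C hz) (hC1 z hz)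
  rwa [Function.comp_apply, hk z hz] at this

theorem recipChart_injOn : InjOn recipChart exteriorDisk := by
  rintro p hp q hq hpq
  rcases hp with rfl | ⟨w, hw, rfl⟩ <;> rcases hq with rfl | ⟨v, hv, rfl⟩
  · rfl
  · have h1 : (0 : ℂ) = v⁻¹ := hpq
    have : v = 0 := by rw [← inv_inv v, ← h1, inv_zero]
    rw [this, norm_zero] at hv
    linarith
  · have h1 : w⁻¹ = (0 : ℂ) := hpq
    have : w = 0 := by rw [← inv_inv w, h1, inv_zero]
    rw [this, norm_zero] at hw
    linarith
  · have h1 : w⁻¹ = v⁻¹ := hpq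
    rw [inv_injective h1]

theorem norm_recipChart_lt {p : OnePoint ℂ} (hp : p ∈ exteriorDisk) : ‖recipChart p‖ < 1 := by
  rcases hp with rfl | ⟨w, hw, rfl⟩
  · change ‖(0 : ℂ)‖ < 1
    simp
  · change ‖w⁻¹‖ < 1
    rw [norm_inv]
    exact inv_lt_one_of_one_lt₀ hw

theorem exists_recipChart_eq {u : ℂ} (hu : ‖u‖ < 1) : ∃ p ∈ exteriorDisk, recipChart p = u := by
  rcases eq_or_ne u 0 with rfl | h0
  · exact ⟨∞, Or.inl rfl, rfl⟩
  · refine ⟨((u⁻¹ : ℂ) : OnePoint ℂ), Or.inr ⟨u⁻¹, ?_, rfl⟩, inv_inv u⟩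
    rw [norm_inv]
    exact (one_lt_inv₀ (norm_pos_iff.2 h0)).2 hu

theorem recipChart_map_conj (p : OnePoint ℂ) :
    recipChart (OnePoint.map (starRingEnd ℂ) p) = starRingEnd ℂ (recipChart p) := by
  induction p using OnePoint.rec with
  | infty => exact (map_zero (starRingEnd ℂ)).symm
  | coe w => exact (map_inv₀ (starRingEnd ℂ) w).symm

theorem blaschkeFactor_eq {p q : OnePoint ℂ} (hp : p ∈ exteriorDisk) (hq : q ∈ exteriorDisk) :
    blaschkeFactor p q =
      (recipChart p - recipChart q) / (1 - recipChart p * recipChart q) := by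
  rcases hp with rfl | ⟨w, hw, rfl⟩ <;> rcases hq with rfl | ⟨v, hv, rfl⟩
  · change (0 : ℂ) = (0 - 0) / (1 - 0 * 0)
    simp
  · change -v⁻¹ = (0 - v⁻¹) / (1 - 0 * v⁻¹)
    simp
  · change w⁻¹ = (w⁻¹ - 0) / (1 - w⁻¹ * 0)
    simp
  · change (w - v) / (1 - w * v) = (w⁻¹ - v⁻¹) / (1 - w⁻¹ * v⁻¹)
    have hw0 : w ≠ 0 := by rintro rfl; simp at hw; linarith
    have hv0 : v ≠ 0 := by rintro rfl; simp at hv; linarith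
    have hwv : 1 < ‖w * v‖ := by
      rw [norm_mul]; exact one_lt_mul_of_lt_of_le hw hv.le
    have h1 : 1 - w * v ≠ 0 := fun h => by
      rw [← sub_eq_zero.1 h, norm_one] at hwv; exact lt_irrefl _ hwv
    have h2 : 1 - w⁻¹ * v⁻¹ ≠ 0 := fun h => by
      rw [← mul_inv, sub_eq_zero, eq_comm, inv_eq_one] at h
      exact h1 (by rw [h, sub_self])
    rw [div_eq_div_iff h1 h2]
    field_simp
    ring

/-- The Möbius transformation `u ↦ (u - r) / (1 - r u)`, for real `r`, maps the disk into itself. -/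
theorem norm_moebius_lt {r : ℝ} (hr : |r| < 1) {u : ℂ} (hu : ‖u‖ < 1) :
    1 - r * u ≠ 0 ∧ ‖(u - r) / (1 - r * u)‖ < 1 := by
  have hru : ‖(r : ℂ) * u‖ < 1 := by
    rw [norm_mul, Complex.norm_real, Real.norm_eq_abs]
    exact mul_lt_one_of_nonneg_of_lt_one_left (abs_nonneg r) hr hu.le
  have h1 : 1 - (r : ℂ) * u ≠ 0 := fun h => by
    rw [← sub_eq_zero.1 h, norm_one] at hru; exact lt_irrefl _ hru
  refine ⟨h1, ?_⟩
  rw [norm_div, div_lt_one (norm_pos_iff.2 h1), ← sq_lt_sq₀ (norm_nonneg _) (norm_nonneg _),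
    Complex.sq_norm, Complex.sq_norm, Complex.normSq_apply, Complex.normSq_apply]
  have hu2 : u.re ^ 2 + u.im ^ 2 < 1 := by
    have : ‖u‖ ^ 2 < 1 := by nlinarith [norm_nonneg u]
    rw [Complex.sq_norm, Complex.normSq_apply] at this
    linarith
  have hr2 : r ^ 2 < 1 := by rw [← sq_abs]; nlinarith [abs_nonneg r]
  simp only [Complex.sub_re, Complex.sub_im, Complex.mul_re, Complex.mul_im, Complex.ofReal_re,
    Complex.ofReal_im, Complex.one_re, Complex.one_im]
  nlinarith [mul_pos (sub_pos.2 hu2) (sub_pos.2 hr2)]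

variable {α : EReal} {β a b c : ℝ}

theorem coe_notMem_sphereCut {z : ℂ} (hz : z ∉ complexCut α β) :
    (z : OnePoint ℂ) ∉ sphereCut α β := by
  rintro (⟨x, hx, h⟩ | ⟨-, h⟩)
  · exact hz ⟨x, hx, OnePoint.coe_injective h⟩
  · exact OnePoint.coe_ne_infty z h

/-- For every conformal map `φ` the factors of `G` dominate the factors `(s - s_j) / (s + s_j)` of
the explicit Blaschke product. -/
theorem IsSlitParam.norm_root_factor_le (h : IsSlitParam α β a b c) {φ : OnePoint ℂ → OnePoint ℂ}
    (hφ : IsConformalExteriorMap α β φ) {x : ℝ} (hx : x ∉ realCut α β) {w : ℂ}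
    (hw : w ∉ complexCut α β) :
    ‖(slitRoot a b β x - slitRoot a b β w) / (slitRoot a b β x + slitRoot a b β w)‖ ≤
      ‖blaschkeFactor (φ (x : ℂ)) (φ w)‖ := by
  have hxc : (x : ℂ) ∉ complexCut α β := by simpa using hx
  set u : ℂ → ℂ := fun z => recipChart (φ (z : OnePoint ℂ)) with hu
  have hext : ∀ z ∉ complexCut α β, φ (z : OnePoint ℂ) ∈ exteriorDisk := fun z hz =>
    hφ.bijOn.mapsTo (coe_notMem_sphereCut hz)
  have hu1 : ∀ z ∉ complexCut α β, ‖u z‖ < 1 := fun z hz => norm_recipChart_lt (hext z hz)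
  obtain ⟨r, hr⟩ : ∃ r : ℝ, u x = r := by
    have h1 := hφ.map_conj _ (coe_notMem_sphereCut hxc)
    have h2 := congrArg recipChart h1
    rw [recipChart_map_conj, OnePoint.map_some, Complex.conj_ofReal] at h2
    obtain ⟨r, hr⟩ := Complex.conj_eq_iff_real.1 h2.symm
    exact ⟨r, hr⟩
  have hr1 : |r| < 1 := by
    have := hu1 x hxc
    rwa [hr, Complex.norm_real] at this
  -- the Schwarz lemma is applied to `A = (s - s(x)) / (s + s(x))` and `C = (u - r) / (1 - r u)`;
  -- as `r` is real, `|C|` is the modulus of the factor of `G`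
  set C : ℂ → ℂ := fun z => (u z - r) / (1 - r * u z) with hC
  have hbl : ‖blaschkeFactor (φ (x : ℂ)) (φ w)‖ = ‖C w‖ := by
    rw [blaschkeFactor_eq (hext x hxc) (hext w hw)]
    change ‖(u x - u w) / (1 - u x * u w)‖ = _
    rw [hr, hC, ← norm_neg, ← neg_div, neg_sub]
  set σ : ℝ := √((x - β) / (a + b * x)) with hσ
  obtain ⟨hroot, hσ0⟩ := h.root_ofReal hx
  set A : ℂ → ℂ := fun z => (slitRoot a b β z - slitRoot a b β x) /
    (slitRoot a b β z + slitRoot a b β x) with hA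
  have hAw : ‖(slitRoot a b β x - slitRoot a b β w) / (slitRoot a b β x + slitRoot a b β w)‖ =
      ‖A w‖ := by
    rw [hA, ← norm_neg, ← neg_div, neg_sub, add_comm (slitRoot a b β x)]
  rw [hbl, hAw]
  have hopen : IsOpen (complexCut α β)ᶜ := (isClosed_complexCut α β).isOpen_compl
  -- if `∞` is not in the cut, the image of `C` omits its value at `∞`
  refine norm_le_norm_of_injOn (p := (recipChart (φ ∞) - r) / (1 - r * recipChart (φ ∞)))
    hopen (A := A) (C := C) ?_ ?_ ?_ ?_ ?_ ?_ hxc ?_ ?_ hw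
  · exact (h.differentiableOn_root.sub_const _).div (h.differentiableOn_root.add_const _)
      fun z hz => h.root_add_ne_zero hz hxc
  · exact (hφ.holomorphic.sub_const _).div ((hφ.holomorphic.const_mul _).const_sub _)
      fun z hz => (norm_moebius_lt hr1 (hu1 z hz)).1
  · intro z hz z' hz' hzz
    have h1 := (norm_moebius_lt hr1 (hu1 z hz)).1
    have h2 := (norm_moebius_lt hr1 (hu1 z' hz')).1
    simp only [hC] at hzz
    rw [div_eq_div_iff h1 h2] at hzz
    have h3 : (1 - (r : ℂ) ^ 2) * (u z - u z') = 0 := by linear_combination hzz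
    have h4 : 1 - (r : ℂ) ^ 2 ≠ 0 := by
      have : r ^ 2 < 1 := by rw [← sq_abs]; nlinarith [abs_nonneg r]
      exact_mod_cast (sub_pos.2 this).ne'
    have h5 := sub_eq_zero.1 ((mul_eq_zero.1 h3).resolve_left h4)
    exact OnePoint.coe_injective (hφ.bijOn.injOn (coe_notMem_sphereCut hz)
      (coe_notMem_sphereCut hz') (recipChart_injOn (hext z hz) (hext z' hz') h5))
  · intro z hz
    have h1 := h.re_root_pos hz
    have h2 := h.root_add_ne_zero hz hxc
    simp only [hA]
    rw [norm_div, div_le_one (norm_pos_iff.2 h2), ← sq_le_sq₀ (norm_nonneg _) (norm_nonneg _),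
      Complex.sq_norm, Complex.sq_norm, Complex.normSq_apply, Complex.normSq_apply, hroot]
    simp only [Complex.sub_re, Complex.sub_im, Complex.add_re, Complex.add_im, Complex.ofReal_re,
      Complex.ofReal_im]
    nlinarith [mul_pos h1 hσ0]
  · intro z hz
    exact (norm_moebius_lt hr1 (hu1 z hz)).2
  · rintro v ⟨hv, hvp⟩
    rw [mem_ball_zero_iff] at hv
    -- the inverse Möbius transformation
    obtain ⟨hne, hlt⟩ := norm_moebius_lt (r := -r) (by rwa [abs_neg]) hv
    obtain ⟨q, hq, hqv⟩ := exists_recipChart_eq hlt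
    obtain ⟨P, hP, hPq⟩ := hφ.bijOn.surjOn hq
    have hr2 : 1 - (r : ℂ) ^ 2 ≠ 0 := by
      have : r ^ 2 < 1 := by rw [← sq_abs]; nlinarith [abs_nonneg r]
      exact_mod_cast (sub_pos.2 this).ne'
    have hM : (recipChart (φ P) - r) / (1 - r * recipChart (φ P)) = v := by
      rw [hPq, hqv]
      have hne' := (norm_moebius_lt hr1 hlt).1
      rw [div_eq_iff hne']
      linear_combination (norm := (push_cast; ring)) div_mul_cancel₀ (v - ((-r : ℝ) : ℂ)) hne
    induction P using OnePoint.rec with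
    | infty => exact absurd hM.symm hvp
    | coe z =>
      refine ⟨z, fun hz => hP ?_, hM⟩
      obtain ⟨y, hy, rfl⟩ := hz
      exact Or.inl ⟨y, hy, rfl⟩
  · simp [hA]
  · simp [hC, hr]

end Conformal

/-! ### The explicit interpolant of the Markov function of `ν` -/

section Explicit

open Polynomial

variable {α : EReal} {β a b c : ℝ}

theorem prod_conj_nodes {n : ℕ} {z : Fin n → ℂ}
    (hconj : ∀ w : ℂ, pointMultiplicity z (starRingEnd ℂ w) = pointMultiplicity z w)
    {M : Type*} [CommMonoid M] (F : ℂ → M) : ∏ j, F (starRingEnd ℂ (z j)) = ∏ j, F (z j) := by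
  have h1 : Finset.univ.val.map (fun j => starRingEnd ℂ (z j)) = Finset.univ.val.map z := by
    ext w
    rw [← pointMultiplicity_eq_count, ← pointMultiplicity_eq_count, ← hconj w,
      pointMultiplicity_eq_card, pointMultiplicity_eq_card]
    congr 1
    ext j
    simp only [Finset.mem_filter, Finset.mem_univ, true_and]
    constructor
    · rintro rfl; simp
    · intro hj; rw [hj]; simp
  have h2 := congrArg (fun s => (Multiset.map F s).prod) h1
  simp only [Multiset.map_map, Function.comp_def] at h2
  exact h2

theorem exists_real_polynomial {P : ℂ[X]} (hP : P.map (starRingEnd ℂ) = P) :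
    ∃ R : ℝ[X], R.map Complex.ofRealHom = P := by
  refine (mem_lifts _).1 ((lifts_iff_coeff_lifts _).2 fun n => ?_)
  have h1 := congrArg (fun p => p.coeff n) hP
  simp only [coeff_map] at h1
  obtain ⟨r, hr⟩ := Complex.conj_eq_iff_real.1 h1
  exact ⟨r, hr.symm⟩

theorem exists_real_nodePoly {n : ℕ} {z : Fin n → ℂ}
    (hconj : ∀ w : ℂ, pointMultiplicity z (starRingEnd ℂ w) = pointMultiplicity z w) :
    ∃ ω : ℝ[X], ω.map Complex.ofRealHom = nodePoly z := by
  refine exists_real_polynomial ?_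
  rw [nodePoly, Polynomial.map_prod, ← prod_conj_nodes hconj fun w => X - C w]
  simp

/-- The decomposition of a polynomial into its even and odd parts. -/
theorem eq_expand_add_X_mul_expand {R : Type*} [CommRing R] (P : R[X]) :
    P = expand R 2 (contract 2 P) + X * expand R 2 (contract 2 P.divX) := by
  ext n
  rw [coeff_add, coeff_expand two_pos]
  rcases n with _ | n
  · simp [coeff_contract]
  rw [coeff_X_mul, coeff_expand two_pos]
  rcases Nat.even_or_odd' n with ⟨k, rfl | rfl⟩
  · rw [if_neg (by omega), if_pos (by omega), coeff_contract two_ne_zero, coeff_divX, zero_add]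
    congr 1; omega
  · rw [if_pos (by omega), if_neg (by omega), coeff_contract two_ne_zero, add_zero]
    congr 1; omega

/-- The homogenization `(a + b z)^n T(y)`, `y = (z - β) / (a + b z)`, of a polynomial `T` of degree
at most `n` in the slit coordinate. -/
noncomputable def slitHomog (a b β : ℝ) (n : ℕ) (T : ℝ[X]) : ℝ[X] :=
  ∑ i ∈ Finset.range (n + 1), C (T.coeff i) * ((X - C β) ^ i * (C a + C b * X) ^ (n - i))

theorem natDegree_slitHomog_le (a b β : ℝ) (n : ℕ) (T : ℝ[X]) :
    (slitHomog a b β n T).natDegree ≤ n := by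
  refine natDegree_sum_le_of_forall_le _ _ fun i hi => ?_
  have hi := Finset.mem_range_succ_iff.1 hi
  have h1 : ((X - C β : ℝ[X]) ^ i).natDegree ≤ i :=
    (natDegree_pow_le_of_le i (natDegree_X_sub_C_le β)).trans (by simp)
  have h2 : ((C a + C b * X : ℝ[X]) ^ (n - i)).natDegree ≤ n - i := by
    refine (natDegree_pow_le_of_le (n - i) (m := 1) ?_).trans (by simp)
    rw [add_comm]
    exact natDegree_linear_le
  refine (natDegree_C_mul_le _ _).trans (natDegree_mul_le.trans ?_)
  omega

theorem eval_slitHomog {n : ℕ} {T : ℝ[X]} (hT : T.natDegree ≤ n) {w : ℂ}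
    (hw : (a + b * w : ℂ) ≠ 0) :
    ((slitHomog a b β n T).map Complex.ofRealHom).eval w =
      (a + b * w) ^ n * (T.map Complex.ofRealHom).eval (slitCoord a b β w) := by
  rw [eval_eq_sum_range' (p := T.map _) (n := n + 1) (by rw [natDegree_map]; omega),
    slitHomog, Polynomial.map_sum, eval_finsetSum, Finset.mul_sum]
  refine Finset.sum_congr rfl fun i hi => ?_
  have hi := Finset.mem_range_succ_iff.1 hi
  have h1 : (a + b * w) ^ n = (a + b * w) ^ i * (a + b * w) ^ (n - i) := by
    rw [← pow_add]; congr 1; omega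
  simp only [Polynomial.map_mul, map_C, Polynomial.map_pow, Polynomial.map_sub, map_X,
    Polynomial.map_add, eval_mul, eval_C, eval_pow, eval_sub, eval_X, eval_add, coeff_map, slitCoord,
    Complex.ofRealHom_eq_coe]
  have hwi := pow_ne_zero i hw
  rw [div_pow, h1]
  generalize (a + b * w : ℂ) ^ i = L at hwi ⊢
  field_simp

/-- The Blaschke product `∏_j (s - s_j) / (s + s_j)` in the coordinate `s` of the right
half-plane. -/
noncomputable def slitBlaschke (a b β : ℝ) {n : ℕ} (z : Fin n → ℂ) (w : ℂ) : ℂ :=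
  ∏ j, (slitRoot a b β w - slitRoot a b β (z j)) / (slitRoot a b β w + slitRoot a b β (z j))

theorem IsSlitParam.norm_slitBlaschke_lt (h : IsSlitParam α β a b c) {n : ℕ} (hn : 0 < n)
    {z : Fin n → ℂ} (hz : ∀ j, z j ∉ complexCut α β) {x : ℝ} (hx : x ∉ realCut α β) :
    ‖slitBlaschke a b β z x‖ < 1 := by
  obtain ⟨hroot, hσ⟩ := h.root_ofReal hx
  have hxc : (x : ℂ) ∉ complexCut α β := by simpa using hx
  rw [slitBlaschke, norm_prod]
  have hlt : ∀ j, ‖(slitRoot a b β x - slitRoot a b β (z j)) /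
      (slitRoot a b β x + slitRoot a b β (z j))‖ < 1 := by
    intro j
    have h1 := h.re_root_pos (hz j)
    have h2 := h.root_add_ne_zero hxc (hz j)
    rw [norm_div, div_lt_one (norm_pos_iff.2 h2), ← sq_lt_sq₀ (norm_nonneg _) (norm_nonneg _),
      Complex.sq_norm, Complex.sq_norm, Complex.normSq_apply, Complex.normSq_apply, hroot]
    simp only [Complex.sub_re, Complex.sub_im, Complex.add_re, Complex.add_im, Complex.ofReal_re,
      Complex.ofReal_im]
    nlinarith [mul_pos h1 hσ]
  calc ∏ j, ‖(slitRoot a b β x - slitRoot a b β (z j)) /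
        (slitRoot a b β x + slitRoot a b β (z j))‖
      ≤ ‖(slitRoot a b β x - slitRoot a b β (z ⟨0, hn⟩)) /
        (slitRoot a b β x + slitRoot a b β (z ⟨0, hn⟩))‖ := by
        rw [← Finset.mul_prod_erase _ _ (Finset.mem_univ (⟨0, hn⟩ : Fin n))]
        exact mul_le_of_le_one_right (norm_nonneg _)
          (Finset.prod_le_one (fun _ _ => norm_nonneg _) fun j _ => (hlt j).le)
    _ < 1 := hlt _

theorem IsSlitParam.slitBlaschke_le (h : IsSlitParam α β a b c) {φ : OnePoint ℂ → OnePoint ℂ}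
    (hφ : IsConformalExteriorMap α β φ) {n : ℕ} {z : Fin n → ℂ}
    (hz : ∀ j, z j ∉ complexCut α β) {x : ℝ} (hx : x ∉ realCut α β) :
    ‖slitBlaschke a b β z x‖ ≤ ‖blaschkeProduct φ z x‖ := by
  rw [slitBlaschke, blaschkeProduct, norm_prod, norm_prod]
  exact Finset.prod_le_prod (fun _ _ => norm_nonneg _)
    fun j _ => h.norm_root_factor_le hφ hx (hz j)

/-- With `∏_j (s ± s_j) = Q(s²) ± s S(s²)`, homogenizing `Q` and `S` gives polynomials in the
original variable. On the cut `s` is imaginary and `|Q(s²)|² ≤ |∏_j (s² - s_j²)|`, which bounds the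
square of the homogenization of `Q` by a multiple of the node polynomial. -/
theorem IsSlitParam.exists_explicit (h : IsSlitParam α β a b c) {m : ℕ} (hm : 0 < m)
    {z : Fin (2 * m) → ℂ} (hz : ∀ j, z j ∉ complexCut α β)
    (hconj : ∀ w : ℂ, pointMultiplicity z (starRingEnd ℂ w) = pointMultiplicity z w)
    {ω : ℝ[X]} (hω : ω.map Complex.ofRealHom = nodePoly z) :
    ∃ Q S : ℝ[X], Q.natDegree ≤ m ∧ S.degree < (m : WithBot ℕ) ∧
      (∀ w ∉ complexCut α β,
        2 * (Q.map Complex.ofRealHom).eval w = (a + b * w) ^ m *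
          (∏ j, (slitRoot a b β w + slitRoot a b β (z j)) +
            ∏ j, (slitRoot a b β w - slitRoot a b β (z j))) ∧
        2 * slitRoot a b β w * (a + b * w) * (S.map Complex.ofRealHom).eval w = (a + b * w) ^ m *
          (∏ j, (slitRoot a b β w + slitRoot a b β (z j)) -
            ∏ j, (slitRoot a b β w - slitRoot a b β (z j)))) ∧
      ∀ t ∈ realCut α β, Q.eval t ^ 2 ≤
        (a + b * β) ^ (2 * m) / (∏ j, ‖(a + b * z j : ℂ)‖) * |ω.eval t| := by
  have hκ := h.kappa_pos
  obtain ⟨R, hR⟩ : ∃ R : ℝ[X], R.map Complex.ofRealHom =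
      ∏ j, (X + C (slitRoot a b β (z j)) : ℂ[X]) := by
    refine exists_real_polynomial ?_
    rw [Polynomial.map_prod, ← prod_conj_nodes hconj fun w => X + C (slitRoot a b β w)]
    simp [h.root_conj (hz _)]
  have hRdeg : R.natDegree = 2 * m := by
    rw [← natDegree_map Complex.ofRealHom, hR,
      natDegree_prod_of_monic _ _ fun j _ => monic_X_add_C _]
    simp
  have hRcoeff : ∀ n, 2 * m < n → R.coeff n = 0 := fun n hn =>
    coeff_eq_zero_of_natDegree_lt (by omega)
  set Q₀ := contract 2 R with hQ₀
  set S₀ := contract 2 R.divX with hS₀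
  have hQ₀m : Q₀.natDegree ≤ m := by
    rw [natDegree_le_iff_coeff_eq_zero]
    intro n hn
    rw [hQ₀, coeff_contract two_ne_zero]
    exact hRcoeff _ (by omega)
  have hS₀m : S₀.natDegree ≤ m - 1 := by
    rw [natDegree_le_iff_coeff_eq_zero]
    intro n hn
    rw [hS₀, coeff_contract two_ne_zero, coeff_divX]
    exact hRcoeff _ (by omega)
  have hplus : ∀ s : ℂ, ∏ j, (s + slitRoot a b β (z j)) =
      (Q₀.map Complex.ofRealHom).eval (s ^ 2) + s * (S₀.map Complex.ofRealHom).eval (s ^ 2) := by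
    intro s
    have h1 := congrArg (eval s) hR
    rw [eq_expand_add_X_mul_expand R, ← hQ₀, ← hS₀] at h1
    simp only [Polynomial.map_add, Polynomial.map_mul, map_X, map_expand, eval_add, eval_mul,
      eval_X, expand_eval, eval_prod, eval_C] at h1
    exact h1.symm
  have hminus : ∀ s : ℂ, ∏ j, (s - slitRoot a b β (z j)) =
      (Q₀.map Complex.ofRealHom).eval (s ^ 2) - s * (S₀.map Complex.ofRealHom).eval (s ^ 2) := by
    intro s
    have h1 := hplus (-s)
    have h2 : ∏ j, (-s + slitRoot a b β (z j)) = ∏ j, (s - slitRoot a b β (z j)) := by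
      have : ∀ j, -s + slitRoot a b β (z j) = (-1) * (s - slitRoot a b β (z j)) := fun j => by ring
      simp_rw [this, Finset.prod_mul_distrib]
      simp [pow_mul]
    rw [h2, neg_sq] at h1
    rw [h1]; ring
  refine ⟨slitHomog a b β m Q₀, slitHomog a b β (m - 1) S₀, natDegree_slitHomog_le _ _ _ _ _, ?_,
    fun w hw => ⟨?_, ?_⟩, ?_⟩
  · refine lt_of_le_of_lt degree_le_natDegree ?_
    have := natDegree_slitHomog_le a b β (m - 1) S₀
    exact_mod_cast (by omega : (slitHomog a b β (m - 1) S₀).natDegree < m)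
  · have hs2 : slitRoot a b β w ^ 2 = slitCoord a b β w := Complex.sqrt_sq_self _
    rw [eval_slitHomog hQ₀m (h.lin_ne_zero hw), hplus, hminus, hs2]
    ring
  · have hs2 : slitRoot a b β w ^ 2 = slitCoord a b β w := Complex.sqrt_sq_self _
    have hpow : (a + b * w) ^ m = (a + b * w) * (a + b * w) ^ (m - 1) := by
      rw [← pow_succ', Nat.sub_add_cancel hm]
    rw [eval_slitHomog hS₀m (h.lin_ne_zero hw), hplus, hminus, hs2, hpow]
    ring
  -- the bound on the cut, first where `a + b t` does not vanish
  have key : ∀ t : ℝ, t ≤ β → 0 < a + b * t → (slitHomog a b β m Q₀).eval t ^ 2 ≤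
      (a + b * β) ^ (2 * m) / (∏ j, ‖(a + b * z j : ℂ)‖) * |ω.eval t| := by
    intro t htβ htl
    have htc : (a + b * (t : ℂ)) ≠ 0 := by exact_mod_cast htl.ne'
    set y : ℝ := (t - β) / (a + b * t) with hy
    have hy0 : 0 ≤ -y := by
      rw [hy, ← neg_div, neg_sub]; exact div_nonneg (by linarith) htl.le
    have hyc : slitCoord a b β t = (y : ℂ) := by simp [slitCoord, hy]
    -- the boundary value of the root at `t`
    set s : ℂ := (√(-y) : ℝ) * Complex.I with hs
    have hs2 : s ^ 2 = (y : ℂ) := by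
      rw [hs, mul_pow, Complex.I_sq, ← Complex.ofReal_pow, Real.sq_sqrt hy0]; simp
    have hconj_s : starRingEnd ℂ s = -s := by simp [hs]
    have hQy : (Q₀.map Complex.ofRealHom).eval ((y : ℂ)) = (Q₀.eval y : ℝ) := eval_map_ofReal _ _
    have hSy : (S₀.map Complex.ofRealHom).eval ((y : ℂ)) = (S₀.eval y : ℝ) := eval_map_ofReal _ _
    have hp := hplus s
    have hmi := hminus s
    rw [hs2, hQy, hSy] at hp hmi
    -- the two products are conjugate to each other
    have hcc : ‖∏ j, (s - slitRoot a b β (z j))‖ = ‖∏ j, (s + slitRoot a b β (z j))‖ := by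
      rw [hp, hmi, ← Complex.norm_conj]
      congr 1
      simp [hconj_s]
    have hQle : |Q₀.eval y| ≤ ‖∏ j, (s + slitRoot a b β (z j))‖ := by
      have h1 : (2 : ℂ) * (Q₀.eval y : ℝ) =
          ∏ j, (s + slitRoot a b β (z j)) + ∏ j, (s - slitRoot a b β (z j)) := by
        rw [hp, hmi]; ring
      have h2 := norm_add_le (∏ j, (s + slitRoot a b β (z j))) (∏ j, (s - slitRoot a b β (z j)))
      rw [← h1, hcc, norm_mul, Complex.norm_real, Real.norm_eq_abs, Complex.norm_ofNat] at h2
      linarith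
    have hprod : ‖∏ j, (s + slitRoot a b β (z j))‖ * ‖∏ j, (s - slitRoot a b β (z j))‖ =
        (a + b * β) ^ (2 * m) * |ω.eval t| / ((a + b * t) ^ (2 * m) * ∏ j, ‖(a + b * z j : ℂ)‖) := by
      have h1 : ∀ j, (s + slitRoot a b β (z j)) * (s - slitRoot a b β (z j)) =
          (a + b * β) * (t - z j) / ((a + b * t) * (a + b * z j)) := by
        intro j
        rw [← IsSlitParam.coord_sub htc (h.lin_ne_zero (hz j)), hyc, ← hs2]
        have : slitRoot a b β (z j) ^ 2 = slitCoord a b β (z j) := Complex.sqrt_sq_self _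
        rw [← this]; ring
      have h2 : ((ω.eval t : ℝ) : ℂ) = ∏ j, ((t : ℂ) - z j) := by
        rw [← nodePoly_eval, ← hω, eval_map_ofReal]
      rw [← norm_mul, ← Finset.prod_mul_distrib]
      simp_rw [h1]
      rw [Finset.prod_div_distrib, Finset.prod_mul_distrib, Finset.prod_mul_distrib, norm_div,
        norm_mul, norm_mul, ← h2, Complex.norm_real, Finset.prod_const, Finset.prod_const,
        Finset.card_univ, Fintype.card_fin, norm_prod, norm_pow, norm_pow, Real.norm_eq_abs]
      rw [show (a + b * (β : ℂ)) = ((a + b * β : ℝ) : ℂ) by push_cast; rfl,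
        show (a + b * (t : ℂ)) = ((a + b * t : ℝ) : ℂ) by push_cast; rfl, Complex.norm_real,
        Complex.norm_real, Real.norm_of_nonneg hκ.le, Real.norm_of_nonneg htl.le]
    have hev : (slitHomog a b β m Q₀).eval t = (a + b * t) ^ m * Q₀.eval y := by
      have h1 := eval_slitHomog (β := β) hQ₀m htc
      rw [hyc, eval_map_ofReal, eval_map_ofReal] at h1
      exact_mod_cast h1
    rw [hcc] at hprod
    have hLpos : 0 < ∏ j, ‖(a + b * z j : ℂ)‖ :=
      Finset.prod_pos fun j _ => norm_pos_iff.2 (h.lin_ne_zero (hz j))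
    have hsq : Q₀.eval y ^ 2 ≤ (a + b * β) ^ (2 * m) * |ω.eval t| /
        ((a + b * t) ^ (2 * m) * ∏ j, ‖(a + b * z j : ℂ)‖) := by
      rw [← hprod, ← sq_abs, sq]
      exact mul_self_le_mul_self (abs_nonneg _) hQle
    rw [hev, mul_pow, ← pow_mul, mul_comm m 2]
    calc (a + b * t) ^ (2 * m) * Q₀.eval y ^ 2
        ≤ (a + b * t) ^ (2 * m) * ((a + b * β) ^ (2 * m) * |ω.eval t| /
        ((a + b * t) ^ (2 * m) * ∏ j, ‖(a + b * z j : ℂ)‖)) := by gcongr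
      _ = _ := by field_simp
  intro t ht
  obtain ⟨htβ, htl⟩ := (h.mem_iff t).1 ht
  rcases htl.eq_or_lt with h0 | hpos
  · -- the left endpoint of a finite interval is a limit of interior points
    have hb : 0 < b := by
      rcases h.b_nonneg.eq_or_lt with hb | hb
      · rw [← hb, zero_mul, add_zero] at h0 hκ; exact absurd h0.symm hκ.ne'
      · exact hb
    have htβ' : t < β := lt_of_le_of_ne htβ (by rintro rfl; exact hκ.ne h0)
    have hcl : IsClosed {t : ℝ | (slitHomog a b β m Q₀).eval t ^ 2 ≤
        (a + b * β) ^ (2 * m) / (∏ j, ‖(a + b * z j : ℂ)‖) * |ω.eval t|} :=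
      isClosed_le ((slitHomog a b β m Q₀).continuous.pow 2)
        (continuous_const.mul ω.continuous.abs)
    refine closure_minimal (s := Ioc t β) (fun u hu => ?_) hcl ?_
    · exact key u hu.2 (by nlinarith [mul_lt_mul_of_pos_left hu.1 hb])
    · rw [closure_Ioc htβ'.ne]
      exact left_mem_Icc.2 htβ
  · exact key t htβ hpos

end Explicit

/-! ### The relative errors at a point -/

section Pointwise

open Polynomial

variable {α : EReal} {β a b c : ℝ} {μ : Measure ℝ}

theorem IsSlitParam.exists_slitBlaschke_eq (h : IsSlitParam α β a b c) {n : ℕ}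
    {z : Fin n → ℂ} (hz : ∀ j, z j ∉ complexCut α β)
    (hconj : ∀ w : ℂ, pointMultiplicity z (starRingEnd ℂ w) = pointMultiplicity z w)
    {x : ℝ} (hx : x ∉ realCut α β) : ∃ B : ℝ, slitBlaschke a b β z x = B := by
  have hroot := (h.root_ofReal hx).1
  refine Complex.conj_eq_iff_real.1 ?_
  have h1 : starRingEnd ℂ (slitRoot a b β x) = slitRoot a b β x := by
    rw [hroot, Complex.conj_ofReal]
  rw [slitBlaschke, map_prod]
  refine Eq.trans (Finset.prod_congr rfl fun j _ => ?_) (prod_conj_nodes hconj fun w =>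
    (slitRoot a b β x - slitRoot a b β w) / (slitRoot a b β x + slitRoot a b β w))
  rw [map_div₀, map_sub, map_add, h1, h.root_conj (hz j)]

/-- The explicit interpolant of the Markov function of `ν`: with `P± = ∏_j (s ± s_j)` its numerator
and denominator are multiples of `(P₊ - P₋) / s` and `P₊ + P₋`, and the error is a multiple of
`P₋`, hence of the node polynomial. -/
theorem IsSlitParam.isRationalInterpolant_nu (h : IsSlitParam α β a b c) {m : ℕ}
    {z : Fin (2 * m) → ℂ} (hz : ∀ j, z j ∉ complexCut α β) {Q S : ℂ[X]}
    (hQ : Q.natDegree ≤ m) (hS : S.degree < (m : WithBot ℕ))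
    (hQP : ∀ w ∉ complexCut α β, 2 * Q.eval w = (a + b * w) ^ m *
      (∏ j, (slitRoot a b β w + slitRoot a b β (z j)) +
        ∏ j, (slitRoot a b β w - slitRoot a b β (z j))))
    (hSP : ∀ w ∉ complexCut α β, 2 * slitRoot a b β w * (a + b * w) * S.eval w = (a + b * w) ^ m *
      (∏ j, (slitRoot a b β w + slitRoot a b β (z j)) -
        ∏ j, (slitRoot a b β w - slitRoot a b β (z j)))) :
    IsRationalInterpolant m z (markov (nu α β))
      (algebraMap ℂ[X] (RatFunc ℂ) (C (c : ℂ) * S) / algebraMap ℂ[X] (RatFunc ℂ) Q) := by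
  have hopen : ∀ j, (complexCut α β)ᶜ ∈ nhds (z j) := fun j =>
    (isClosed_complexCut α β).isOpen_compl.mem_nhds (hz j)
  have hκ : ((a + b * β : ℝ) : ℂ) ≠ 0 := by exact_mod_cast h.kappa_pos.ne'
  have hlin : Differentiable ℂ fun w : ℂ => (a + b * w : ℂ) := by fun_prop
  refine isRationalInterpolant_div (g := fun w => c * (a + b * w) ^ m /
      ((a + b * w) * slitRoot a b β w) * ∏ j, ((a + b * β : ℝ) : ℂ) / (((a + b * w) * (a + b * z j)) *
      (slitRoot a b β w + slitRoot a b β (z j)))) ?_ hQ ?_ (fun j => ?_) (fun j => ?_) fun j => ?_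
  · rwa [degree_C_mul (by exact_mod_cast h.c_pos.ne')]
  · intro j h0
    have h1 := hQP (z j) (hz j)
    rw [h0, mul_zero, Finset.prod_eq_zero (f := fun i => slitRoot a b β (z j) - slitRoot a b β (z i))
      (Finset.mem_univ j) (sub_self _), add_zero, eq_comm] at h1
    refine mul_ne_zero (pow_ne_zero _ (h.lin_ne_zero (hz j))) ?_ h1
    exact Finset.prod_ne_zero_iff.2 fun i _ => h.root_add_ne_zero (hz j) (hz i)
  · have hd : DifferentiableOn ℂ (fun w => c / ((a + b * w) * slitRoot a b β w))
        (complexCut α β)ᶜ := by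
      refine (differentiableOn_const _).div (hlin.differentiableOn.mul h.differentiableOn_root) ?_
      exact fun w hw => mul_ne_zero (h.lin_ne_zero hw) (h.root_ne_zero hw)
    refine (hd.analyticAt (hopen j)).congr ?_
    filter_upwards [hopen j] with w hw using (h.markov_nu hw).symm
  · refine DifferentiableOn.analyticAt (s := (complexCut α β)ᶜ) ?_ (hopen j)
    refine DifferentiableOn.mul ?_ (DifferentiableOn.fun_finsetProd fun i _ => ?_)
    · refine ((hlin.pow m).differentiableOn.const_mul _).div
        (hlin.differentiableOn.mul h.differentiableOn_root) ?_
      exact fun w hw => mul_ne_zero (h.lin_ne_zero hw) (h.root_ne_zero hw)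
    · refine (differentiableOn_const _).div ((hlin.differentiableOn.mul_const _).mul
        (h.differentiableOn_root.add_const _)) fun w hw => ?_
      exact mul_ne_zero (mul_ne_zero (h.lin_ne_zero hw) (h.lin_ne_zero (hz i)))
        (h.root_add_ne_zero hw (hz i))
  · filter_upwards [hopen j] with w hw
    have hl := h.lin_ne_zero hw
    have hs := h.root_ne_zero hw
    have hprod : ∏ i, (slitRoot a b β w - slitRoot a b β (z i)) = (nodePoly z).eval w *
        ∏ j, ((a + b * β : ℝ) : ℂ) / (((a + b * w) * (a + b * z j)) *
          (slitRoot a b β w + slitRoot a b β (z j))) := by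
      rw [nodePoly_eval, ← Finset.prod_mul_distrib]
      refine Finset.prod_congr rfl fun i _ => ?_
      have hli := h.lin_ne_zero (hz i)
      have hsum := h.root_add_ne_zero hw (hz i)
      have h1 : (slitRoot a b β w - slitRoot a b β (z i)) *
          (slitRoot a b β w + slitRoot a b β (z i)) =
          (a + b * β) * (w - z i) / ((a + b * w) * (a + b * z i)) := by
        rw [← coord_sub hl hli, ← Complex.sqrt_sq_self (slitCoord a b β w),
          ← Complex.sqrt_sq_self (slitCoord a b β (z i))]
        simp only [slitRoot]
        ring
      rw [← mul_div_assoc, mul_comm (w - z i), ← div_div, Complex.ofReal_add, Complex.ofReal_mul,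
        ← h1, mul_div_cancel_right₀ _ hsum]
    have h1 := hQP w hw
    have h2 := hSP w hw
    rw [h.markov_nu hw, mul_left_comm, ← hprod, eval_mul, eval_C, div_mul_eq_mul_div,
      div_mul_eq_mul_div, sub_eq_iff_eq_add, div_eq_iff (mul_ne_zero hl hs), add_mul,
      div_mul_cancel₀ _ (mul_ne_zero hl hs)]
    linear_combination (c / 2 : ℂ) * h1 - (c / 2 : ℂ) * h2

/-- The relative errors at a real point `x` in terms of the value `B` of the Blaschke product:
`r^ν / f^ν = (1 - B) / (1 + B)`, and the relative error for `μ` is at most `4 |B| / (1 + B)²`. -/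
theorem IsSlitParam.exists_interpolants (h : IsSlitParam α β a b c) (hμ : IsMarkovMeasure α β μ)
    {m : ℕ} (hm : 0 < m) {z : Fin (2 * m) → ℂ} (hz : ∀ j, z j ∉ complexCut α β)
    (hconj : ∀ w : ℂ, pointMultiplicity z (starRingEnd ℂ w) = pointMultiplicity z w) :
    ∃ rμ rν : RatFunc ℂ, IsRationalInterpolant m z (markov μ) rμ ∧
      IsRationalInterpolant m z (markov (nu α β)) rν ∧
      ∀ x : ℝ, x ∉ realCut α β → markov μ x ≠ 0 ∧ rμ.denom.eval (x : ℂ) ≠ 0 ∧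
        markov (nu α β) x ≠ 0 ∧ rν.denom.eval (x : ℂ) ≠ 0 ∧
        ∃ B : ℝ, |B| < 1 ∧ slitBlaschke a b β z x = B ∧
          ratVal rν x / markov (nu α β) x = ((1 - B) / (1 + B) : ℝ) ∧
          ‖(markov μ x - ratVal rμ x) / markov μ x‖ ≤ 4 * |B| / (1 + B) ^ 2 := by
  obtain ⟨ω, hω⟩ := exists_real_nodePoly hconj
  obtain ⟨rμ, hrμ, hrμx⟩ := hμ.exists_interpolant hm hz hω
  obtain ⟨Q, S, hQ, hS, hQS, hcut⟩ := h.exists_explicit hm hz hconj hω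
  set Qc := Q.map Complex.ofRealHom with hQc
  set Sc := S.map Complex.ofRealHom with hSc
  refine ⟨rμ, _, hrμ, h.isRationalInterpolant_nu hz (Q := Qc) (S := Sc)
    (by rwa [hQc, natDegree_map]) (by rwa [hSc, degree_map])
    (fun w hw => (hQS w hw).1) (fun w hw => (hQS w hw).2), fun x hx => ?_⟩
  obtain ⟨hden, herr⟩ := hrμx x hx
  have hxc : (x : ℂ) ∉ complexCut α β := by simpa using hx
  have hl := h.lin_ne_zero hxc
  have hs := h.root_ne_zero hxc
  have hc : (c : ℂ) ≠ 0 := by exact_mod_cast h.c_pos.ne'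
  have hf0 := hμ.markov_ne_zero hx
  obtain ⟨B, hB⟩ := h.exists_slitBlaschke_eq hz hconj hx
  have hB1 : |B| < 1 := by
    have := h.norm_slitBlaschke_lt (by omega : 0 < 2 * m) hz hx
    rwa [hB, Complex.norm_real] at this
  have hB1' : 0 < 1 + B := by linarith [(abs_lt.1 hB1).1]
  have hBc : (1 + B : ℂ) ≠ 0 := by exact_mod_cast hB1'.ne'
  set P₂ := ∏ j, (slitRoot a b β x + slitRoot a b β (z j)) with hP₂
  set P₁ := ∏ j, (slitRoot a b β x - slitRoot a b β (z j)) with hP₁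
  have hP₂0 : P₂ ≠ 0 := Finset.prod_ne_zero_iff.2 fun j _ => h.root_add_ne_zero hxc (hz j)
  have hPB : P₁ = B * P₂ := by
    rw [← hB, slitBlaschke, Finset.prod_div_distrib, div_mul_cancel₀ _ hP₂0]
  obtain ⟨hq1, hs1⟩ := hQS x hxc
  rw [← hP₁, ← hP₂, hPB] at hq1 hs1
  have hlm := pow_ne_zero m hl
  have hQx : Qc.eval (x : ℂ) ≠ 0 := by
    intro h0
    rw [h0, mul_zero] at hq1
    have : (a + b * (x : ℂ)) ^ m * (P₂ + B * P₂) = (a + b * (x : ℂ)) ^ m * ((1 + B) * P₂) := by ring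
    rw [this] at hq1
    exact mul_ne_zero hlm (mul_ne_zero hBc hP₂0) hq1.symm
  obtain ⟨hden', hval⟩ := ratVal_div_eq (p := C (c : ℂ) * Sc) hQx
  have hνx : markov (nu α β) x = c / ((a + b * x) * slitRoot a b β x) := h.markov_nu hxc
  refine ⟨hf0, hden, ?_, hden', B, hB1, hB, ?_, ?_⟩
  · rw [hνx]
    exact div_ne_zero hc (mul_ne_zero hl hs)
  · rw [hval, hνx, eval_mul, eval_C, div_div_div_eq, div_eq_iff (mul_ne_zero hQx hc)]
    push_cast
    rw [div_mul_eq_mul_div, eq_div_iff hBc]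
    linear_combination (c * (1 + B) / 2 : ℂ) * hs1 - (c * (1 - B) / 2 : ℂ) * hq1
  · have hκ := h.kappa_pos
    have hLpos : 0 < ∏ j, ‖(a + b * z j : ℂ)‖ :=
      Finset.prod_pos fun j _ => norm_pos_iff.2 (h.lin_ne_zero (hz j))
    have h1 := herr Q _ hQ hcut
    have hωx : ((ω.eval x : ℝ) : ℂ) = ∏ j, ((x : ℂ) - z j) := by
      rw [← nodePoly_eval, ← hω, eval_map_ofReal]
    have hprod : (a + b * β) ^ (2 * m) / (∏ j, ‖(a + b * z j : ℂ)‖) * |ω.eval x| =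
        ‖(a + b * x : ℂ)‖ ^ (2 * m) * (|B| * ‖P₂‖ ^ 2) := by
      have h2 : P₁ * P₂ = (a + b * β : ℂ) ^ (2 * m) * (ω.eval x : ℝ) /
          ((a + b * x : ℂ) ^ (2 * m) * ∏ j, (a + b * z j : ℂ)) := by
        rw [hP₁, hP₂, ← Finset.prod_mul_distrib, hωx]
        have h3 : ∀ j, (slitRoot a b β x - slitRoot a b β (z j)) *
            (slitRoot a b β x + slitRoot a b β (z j)) =
            (a + b * β) * (x - z j) / ((a + b * x) * (a + b * z j)) := fun j => by
          rw [← coord_sub hl (h.lin_ne_zero (hz j)), ← Complex.sqrt_sq_self (slitCoord a b β x),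
            ← Complex.sqrt_sq_self (slitCoord a b β (z j))]
          simp only [slitRoot]
          ring
        simp_rw [h3]
        rw [Finset.prod_div_distrib, Finset.prod_mul_distrib, Finset.prod_mul_distrib,
          Finset.prod_const, Finset.prod_const, Finset.card_univ, Fintype.card_fin]
      have h4 := congrArg norm h2
      have hnp : ‖∏ j, (a + b * z j : ℂ)‖ = ∏ j, ‖(a + b * z j : ℂ)‖ := norm_prod _ _
      rw [hPB, norm_mul, norm_mul, norm_div, norm_mul, norm_mul, norm_pow, norm_pow, hnp,
        Complex.norm_real, Complex.norm_real, Real.norm_eq_abs, Real.norm_eq_abs,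
        show (a + b * (β : ℂ)) = ((a + b * β : ℝ) : ℂ) by push_cast; rfl, Complex.norm_real,
        Real.norm_of_nonneg hκ.le] at h4
      have hlp := pow_pos (norm_pos_iff.2 hl) (2 * m)
      rw [eq_div_iff (mul_pos hlp hLpos).ne'] at h4
      rw [div_mul_eq_mul_div, div_eq_iff hLpos.ne']
      linear_combination -h4
    have hQsq : 4 * Q.eval x ^ 2 = ‖(a + b * x : ℂ)‖ ^ (2 * m) * ((1 + B) ^ 2 * ‖P₂‖ ^ 2) := by
      have h2 := congrArg norm hq1
      rw [hQc, eval_map_ofReal, norm_mul, norm_mul, Complex.norm_real, Complex.norm_ofNat, norm_pow,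
        Real.norm_eq_abs, show P₂ + B * P₂ = ((1 + B : ℝ) : ℂ) * P₂ by push_cast; ring, norm_mul,
        Complex.norm_real, Real.norm_of_nonneg hB1'.le] at h2
      rw [← sq_abs (Q.eval x)]
      have : 4 * |Q.eval x| ^ 2 = (2 * |Q.eval x|) ^ 2 := by ring
      rw [this, h2]
      ring
    rw [hprod] at h1
    rw [norm_div, div_le_div_iff₀ (norm_pos_iff.2 hf0) (by positivity)]
    have hK : 0 < ‖(a + b * x : ℂ)‖ ^ (2 * m) * ‖P₂‖ ^ 2 :=
      mul_pos (pow_pos (norm_pos_iff.2 hl) _) (pow_pos (norm_pos_iff.2 hP₂0) _)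
    refine le_of_mul_le_mul_left ?_ hK
    calc _ = ‖markov μ x - ratVal rμ x‖ * (4 * Q.eval x ^ 2) := by rw [hQsq]; ring
      _ = 4 * (‖markov μ x - ratVal rμ x‖ * Q.eval x ^ 2) := by ring
      _ ≤ 4 * (‖(a + b * x : ℂ)‖ ^ (2 * m) * (|B| * ‖P₂‖ ^ 2) * ‖markov μ x‖) := by gcongr
      _ = _ := by ring

end Pointwise

/-! ### The sign of the Blaschke product -/

section Parity

variable {α : EReal} {β a b c : ℝ}

theorem even_card_of_even_fibers {ι γ : Type*} [DecidableEq γ] (T : Finset ι) (g : ι → γ)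
    (h : ∀ j ∈ T, Even (T.filter fun i => g i = g j).card) : Even T.card := by
  rw [Finset.card_eq_sum_card_image g T]
  refine Finset.even_sum _ fun y hy => ?_
  obtain ⟨j, hj, rfl⟩ := Finset.mem_image.1 hy
  exact h j hj

open scoped Classical in
theorem even_card_of_even_pointMultiplicity {n : ℕ} {z : Fin n → ℂ} (I : Set ℝ)
    (heven : ∀ x : ℝ, Even (pointMultiplicity z (x : ℂ))) :
    Even (Finset.univ.filter fun j => ∃ t ∈ I, z j = (t : ℂ)).card := by
  refine even_card_of_even_fibers _ z fun j hj => ?_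
  obtain ⟨t, ht, hjt⟩ := (Finset.mem_filter.1 hj).2
  have := heven t
  rw [pointMultiplicity_eq_card] at this
  convert this using 2
  ext i
  simp only [Finset.mem_filter, Finset.mem_univ, true_and, hjt]
  exact ⟨fun h => h.2, fun h => ⟨⟨t, ht, h⟩, h⟩⟩

open scoped Classical in
/-- Let `Ioo p q` be disjoint from the cut, with endpoints in the cut or in `Int E`. It contains an
even number of nodes: those in `Int E` have even multiplicity, and the components of the complement
of `Int E` and the cut that meet `Ioo p q` are contained in it. -/
theorem even_card_of_components {n : ℕ} {z : Fin n → ℂ} {E : Set ℝ} {p q : ℝ}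
    (hp : p ∈ interior E ∪ realCut α β) (hq : q ∈ interior E ∪ realCut α β)
    (hI : ∀ t ∈ Ioo p q, t ∉ realCut α β)
    (hint : ∀ x ∈ interior E, Even (pointMultiplicity z (x : ℂ)))
    (hcomp : ∀ x ∈ (interior E ∪ realCut α β)ᶜ,
      Even (Set.ncard {j | ∃ y ∈ connectedComponentIn (interior E ∪ realCut α β)ᶜ x,
        z j = (y : ℂ)})) :
    Even (Finset.univ.filter fun j => ∃ t ∈ Ioo p q, z j = (t : ℂ)).card := by
  set W := (interior E ∪ realCut α β)ᶜ with hW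
  -- group the nodes into the points of `Int E` and the components of the complement
  refine even_card_of_even_fibers _ (fun j => if (z j).re ∈ interior E then {(z j).re} else
    connectedComponentIn W (z j).re) fun j hj => ?_
  obtain ⟨t, ht, hjt⟩ := (Finset.mem_filter.1 hj).2
  have hmemW : ∀ u ∈ Ioo p q, u ∉ interior E → u ∈ W := fun u hu hu' h =>
    h.elim hu' (hI u hu)
  by_cases htE : t ∈ interior E
  · have := hint t htE
    rw [pointMultiplicity_eq_card] at this
    convert this using 2
    ext i
    simp only [Finset.mem_filter, Finset.mem_univ, true_and, hjt, Complex.ofReal_re, htE, if_true]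
    constructor
    · rintro ⟨⟨u, hu, hiu⟩, hg⟩
      rw [hiu, Complex.ofReal_re] at hg
      have hut : u ∈ ({t} : Set ℝ) := by
        rw [← hg]
        split_ifs with huE
        · exact mem_singleton u
        · exact mem_connectedComponentIn (hmemW u hu huE)
      rw [hiu, mem_singleton_iff.1 hut]
    · intro h
      exact ⟨⟨t, ht, h⟩, by rw [h, Complex.ofReal_re, if_pos htE]⟩
  · have htW := hmemW t ht htE
    have hsub : connectedComponentIn W t ⊆ Ioo p q := by
      have hord := (isPreconnected_connectedComponentIn (F := W) (x := t)).ordConnected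
      have htm := mem_connectedComponentIn htW
      have hW' := connectedComponentIn_subset W t
      intro u hu
      constructor
      · by_contra! hle
        exact hW' (hord.out hu htm ⟨hle, ht.1.le⟩) hp
      · by_contra! hle
        exact hW' (hord.out htm hu ⟨ht.2.le, hle⟩) hq
    have := hcomp t htW
    rw [← Set.ncard_coe_finset]
    convert this using 2
    ext i
    simp only [Finset.coe_filter, Finset.mem_filter, Finset.mem_univ, true_and, hjt,
      Complex.ofReal_re, htE, if_false, mem_ofPred_eq]
    constructor
    · rintro ⟨⟨u, hu, hiu⟩, hg⟩
      rw [hiu, Complex.ofReal_re] at hg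
      refine ⟨u, ?_, hiu⟩
      rw [← hg]
      split_ifs with huE
      · exact mem_singleton u
      · exact mem_connectedComponentIn (hmemW u hu huE)
    · rintro ⟨y, hy, hiy⟩
      refine ⟨⟨y, hsub hy, hiy⟩, ?_⟩
      have hyE : y ∉ interior E := fun h => connectedComponentIn_subset W t hy (Or.inl h)
      rw [hiy, Complex.ofReal_re, if_neg hyE]
      exact (connectedComponentIn_eq hy).symm

/-- A product over a conjugation-symmetric family of nodes of a function compatible with conjugation
is nonnegative if the number of real nodes with a nonpositive factor is even. -/
theorem prod_nonneg_of_even {n : ℕ} {z : Fin n → ℂ}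
    (hconj : ∀ w : ℂ, pointMultiplicity z (starRingEnd ℂ w) = pointMultiplicity z w)
    {F : ℂ → ℂ} (hF : ∀ j, F (starRingEnd ℂ (z j)) = starRingEnd ℂ (F (z j)))
    {f : ℝ → ℝ} (hf : ∀ j, ∀ t : ℝ, z j = t → F t = f t)
    (heven : Even (Finset.univ.filter fun j => (z j).im = 0 ∧ f (z j).re ≤ 0).card) :
    ∃ r : ℝ, 0 ≤ r ∧ ∏ j, F (z j) = r := by
  have hsplit : ∏ j, F (z j) = (∏ j, if 0 < (z j).im then F (z j) else 1) *
      (∏ j, if (z j).im < 0 then F (z j) else 1) * ∏ j, if (z j).im = 0 then F (z j) else 1 := by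
    rw [← Finset.prod_mul_distrib, ← Finset.prod_mul_distrib]
    refine Finset.prod_congr rfl fun j _ => ?_
    rcases lt_trichotomy (z j).im 0 with h | h | h
    · simp [h, h.not_gt, h.ne]
    · simp [h]
    · simp [h, h.not_gt, h.ne']
  have hneg : (∏ j, if (z j).im < 0 then F (z j) else 1) =
      starRingEnd ℂ (∏ j, if 0 < (z j).im then F (z j) else 1) := by
    rw [← prod_conj_nodes hconj fun w => if w.im < 0 then F w else 1, map_prod]
    refine Finset.prod_congr rfl fun j _ => ?_
    by_cases him : 0 < (z j).im
    · simp [him, hF j]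
    · simp [him]
  have hreal : (∏ j, if (z j).im = 0 then F (z j) else 1) =
      ((∏ j ∈ Finset.univ.filter fun j => (z j).im = 0, f (z j).re : ℝ) : ℂ) := by
    rw [← Finset.prod_filter, Complex.ofReal_prod]
    refine Finset.prod_congr rfl fun j hj => ?_
    have hj : z j = ((z j).re : ℂ) := Complex.ext rfl (by simp [(Finset.mem_filter.1 hj).2])
    rw [← hf j _ hj, ← hj]
  refine ⟨Complex.normSq (∏ j, if 0 < (z j).im then F (z j) else 1) *
    ∏ j ∈ Finset.univ.filter fun j => (z j).im = 0, f (z j).re,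
    mul_nonneg (Complex.normSq_nonneg _) ?_, ?_⟩
  · refine Finset.prod_nonneg_of_card_nonpos_even ?_
    rwa [Finset.filter_filter]
  · rw [hsplit, hneg, hreal, Complex.mul_conj, Complex.ofReal_mul]

open scoped Classical in
/-- The Blaschke product is nonnegative at a real point `x` if an even number of nodes lies
strictly between `x` and the cut. For `x < α` these are the nodes with `s_j > s`; for `x > β` they
are those with `s_j < s`, and all signs are changed first, their number `2m` being even. -/
theorem IsSlitParam.slitBlaschke_nonneg (h : IsSlitParam α β a b c) {m : ℕ}
    {z : Fin (2 * m) → ℂ} (hz : ∀ j, z j ∉ complexCut α β)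
    (hconj : ∀ w : ℂ, pointMultiplicity z (starRingEnd ℂ w) = pointMultiplicity z w)
    {x : ℝ} (hx : x ∉ realCut α β)
    (hev : ∀ p q : ℝ, (p = x ∨ p ∈ realCut α β) → (q = x ∨ q ∈ realCut α β) →
      (∀ t ∈ Ioo p q, t ∉ realCut α β) →
      Even (Finset.univ.filter fun j => ∃ t ∈ Ioo p q, z j = (t : ℂ)).card) :
    ∃ r : ℝ, 0 ≤ r ∧ slitBlaschke a b β z x = r := by
  by_cases hxz : ∃ j, z j = x
  · obtain ⟨j, hj⟩ := hxz
    refine ⟨0, le_rfl, ?_⟩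
    rw [slitBlaschke, Finset.prod_eq_zero (Finset.mem_univ j) (by rw [hj]; simp)]
    simp
  push Not at hxz
  have hκ := h.kappa_pos
  have hb := h.b_nonneg
  have hxc : (x : ℂ) ∉ complexCut α β := by simpa using hx
  obtain ⟨hroot, hσ0⟩ := h.root_ofReal hx
  set ρ : ℝ → ℝ := fun t => √((t - β) / (a + b * t)) with hρ
  have hlin : ∀ t : ℝ, t ∉ realCut α β → (a + b * t) ≠ 0 := fun t ht h0 => by
    have := h.lin_mul_pos ht
    rw [h0, mul_zero] at this
    exact lt_irrefl _ this
  -- comparing two values of `s` on the real line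
  have hcmp : ∀ t : ℝ, t ∉ realCut α β →
      (ρ x - ρ t ≤ 0 ↔ (x - t) * ((a + b * x) * (a + b * t)) ≤ 0) := by
    intro t ht
    have hy : 0 ≤ (t - β) / (a + b * t) := by
      have := (h.root_ofReal ht).2
      exact (Real.sqrt_pos.1 this).le
    have hX := hlin x hx
    have hT := hlin t ht
    rw [sub_nonpos, hρ, Real.sqrt_le_sqrt_iff hy, ← sub_nonpos]
    have h1 : (x - β) / (a + b * x) - (t - β) / (a + b * t) =
        (a + b * β) / ((a + b * x) * (a + b * t)) ^ 2 *
          ((x - t) * ((a + b * x) * (a + b * t))) := by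
      rw [div_sub_div _ _ hX hT, div_mul_eq_mul_div,
        div_eq_div_iff (mul_ne_zero hX hT) (pow_ne_zero 2 (mul_ne_zero hX hT))]
      ring
    have h2 : 0 < (a + b * β) / ((a + b * x) * (a + b * t)) ^ 2 := by positivity
    rw [h1, mul_nonpos_iff_pos_imp_nonpos]
    constructor
    · intro h3; exact h3.1 h2
    · intro h3; exact ⟨fun _ => h3, fun h4 => by nlinarith⟩
  have hzr : ∀ j, ∀ t : ℝ, z j = t → t ∉ realCut α β := fun j t hjt => by
    have := hz j
    rwa [hjt, ofReal_mem_complexCut] at this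
  have hF : ∀ ε : ℝ, ∀ j,
      (fun w => (ε : ℂ) * ((slitRoot a b β x - slitRoot a b β w) /
        (slitRoot a b β x + slitRoot a b β w))) (starRingEnd ℂ (z j)) =
      starRingEnd ℂ ((fun w => (ε : ℂ) * ((slitRoot a b β x - slitRoot a b β w) /
        (slitRoot a b β x + slitRoot a b β w))) (z j)) := by
    intro ε j
    have h1 : starRingEnd ℂ (slitRoot a b β x) = slitRoot a b β x := by
      rw [hroot, Complex.conj_ofReal]
    simp only [map_mul, map_div₀, map_sub, map_add, h1, h.root_conj (hz j), Complex.conj_ofReal]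
  have hf : ∀ ε : ℝ, ∀ j, ∀ t : ℝ, z j = t →
      (fun w => (ε : ℂ) * ((slitRoot a b β x - slitRoot a b β w) /
        (slitRoot a b β x + slitRoot a b β w))) t =
      ((fun t => ε * ((ρ x - ρ t) / (ρ x + ρ t))) t : ℝ) := by
    intro ε j t hjt
    simp only [hroot, (h.root_ofReal (hzr j t hjt)).1, hρ]
    push_cast
    rfl
  have hden : ∀ t, 0 < ρ x + ρ t := fun t => add_pos_of_pos_of_nonneg hσ0 (Real.sqrt_nonneg _)
  rcases pos_and_pos_or_neg_and_neg_of_mul_pos (h.lin_mul_pos hx) with ⟨hxβ, hlx⟩ | ⟨hxβ, hlx⟩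
  · obtain ⟨r, hr0, hr⟩ := prod_nonneg_of_even
      (F := fun w => ((-1 : ℝ) : ℂ) * ((slitRoot a b β x - slitRoot a b β w) /
        (slitRoot a b β x + slitRoot a b β w)))
      (f := fun t => -1 * ((ρ x - ρ t) / (ρ x + ρ t)))
      hconj (hF (-1)) (hf (-1)) (by
      have := hev β x (Or.inr ((h.mem_iff β).2 ⟨le_rfl, hκ.le⟩)) (Or.inl rfl)
        (fun t ht ht' => ((h.mem_iff t).1 ht').1.not_gt ht.1)
      convert this using 2
      ext j
      simp only [Finset.mem_filter, Finset.mem_univ, true_and]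
      have key : ∀ t : ℝ, z j = t → (-1 * ((ρ x - ρ t) / (ρ x + ρ t)) ≤ 0 ↔ t ∈ Ioo β x) := by
        intro t hjt
        have ht := hzr j t hjt
        have htx : x ≠ t := fun hxt => hxz j (by rw [hjt, hxt])
        have hne : ρ x - ρ t ≠ 0 := by
          intro h0
          have h1 := (hcmp t ht).1 h0.le
          have h2 : ρ t - ρ x ≤ 0 := by linarith
          have hy : (x - β) / (a + b * x) = (t - β) / (a + b * t) := by
            have e := sub_eq_zero.1 h0
            simp only [hρ] at e
            rwa [Real.sqrt_inj (Real.sqrt_pos.1 hσ0).le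
              (Real.sqrt_pos.1 (h.root_ofReal ht).2).le] at e
          rw [div_eq_div_iff (hlin x hx) (hlin t ht)] at hy
          have h3 : (a + b * β) * (x - t) = 0 := by linear_combination hy
          exact htx (sub_eq_zero.1 ((mul_eq_zero.1 h3).resolve_left hκ.ne'))
        have e1 : (-1 * ((ρ x - ρ t) / (ρ x + ρ t)) ≤ 0) ↔ ¬ (ρ x - ρ t ≤ 0) := by
          rw [neg_one_mul, neg_nonpos, le_div_iff₀ (hden t), zero_mul, not_le]
          exact ⟨fun h => lt_of_le_of_ne h hne.symm, le_of_lt⟩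
        rw [e1, hcmp t ht, not_le]
        constructor
        · intro hpos
          have h1 : 0 < (x - t) * (a + b * t) := by
            by_contra! hle
            nlinarith
          rcases pos_and_pos_or_neg_and_neg_of_mul_pos h1 with ⟨h2, h3⟩ | ⟨h2, h3⟩
          · refine ⟨?_, by linarith⟩
            by_contra! hle
            exact ht ((h.mem_iff t).2 ⟨hle, h3.le⟩)
          · nlinarith
        · rintro ⟨h1, h2⟩
          have h3 : 0 < a + b * t := by nlinarith
          exact mul_pos (by linarith) (mul_pos hlx h3)
      constructor
      · rintro ⟨him, hle⟩
        have hjt : z j = ((z j).re : ℂ) := Complex.ext rfl (by simp [him])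
        exact ⟨_, (key _ hjt).1 hle, hjt⟩
      · rintro ⟨t, ht, hjt⟩
        have := (key t hjt).2 ht
        refine ⟨by rw [hjt, Complex.ofReal_im], ?_⟩
        rwa [hjt, Complex.ofReal_re])
    refine ⟨r, hr0, ?_⟩
    rw [← hr, slitBlaschke, Finset.prod_mul_distrib]
    simp [pow_mul]
  · have hb0 : 0 < b := by
      rcases hb.eq_or_lt with hb0 | hb0
      · rw [← hb0, zero_mul, add_zero] at hκ hlx; linarith
      · exact hb0
    have hα0 : a + b * (-a / b) = 0 := by field_simp; ring
    have hαβ : -a / b ≤ β := by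
      by_contra! hlt
      have := mul_lt_mul_of_pos_left hlt hb0
      linarith
    obtain ⟨r, hr0, hr⟩ := prod_nonneg_of_even
      (F := fun w => ((1 : ℝ) : ℂ) * ((slitRoot a b β x - slitRoot a b β w) /
        (slitRoot a b β x + slitRoot a b β w)))
      (f := fun t => 1 * ((ρ x - ρ t) / (ρ x + ρ t)))
      hconj (hF 1) (hf 1) (by
      have := hev x (-a / b) (Or.inl rfl) (Or.inr ((h.mem_iff _).2 ⟨hαβ, hα0.ge⟩))
        (fun t ht ht' => by
          have h1 := ((h.mem_iff t).1 ht').2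
          have h2 := mul_lt_mul_of_pos_left ht.2 hb0
          linarith)
      convert this using 2
      ext j
      simp only [Finset.mem_filter, Finset.mem_univ, true_and]
      have key : ∀ t : ℝ, z j = t → (1 * ((ρ x - ρ t) / (ρ x + ρ t)) ≤ 0 ↔ t ∈ Ioo x (-a / b)) := by
        intro t hjt
        have ht := hzr j t hjt
        have htx : x ≠ t := fun hxt => hxz j (by rw [hjt, hxt])
        rw [one_mul, div_le_iff₀ (hden t), zero_mul, hcmp t ht]
        constructor
        · intro hle
          have h1 : 0 ≤ (x - t) * (a + b * t) := by
            by_contra! hlt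
            nlinarith
          have h4 := hlin t ht
          have h1' := lt_of_le_of_ne h1 (mul_ne_zero (sub_ne_zero.2 htx) h4).symm
          rcases pos_and_pos_or_neg_and_neg_of_mul_pos h1' with ⟨h2, h3⟩ | ⟨h2, h3⟩
          · nlinarith
          · refine ⟨by linarith, ?_⟩
            rw [lt_div_iff₀ hb0]
            linarith
        · rintro ⟨h1, h2⟩
          rw [lt_div_iff₀ hb0] at h2
          have h3 : a + b * t < 0 := by linarith
          exact mul_nonpos_of_nonpos_of_nonneg (by linarith) (mul_pos_of_neg_of_neg hlx h3).le
      constructor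
      · rintro ⟨him, hle⟩
        have hjt : z j = ((z j).re : ℂ) := Complex.ext rfl (by simp [him])
        exact ⟨_, (key _ hjt).1 hle, hjt⟩
      · rintro ⟨t, ht, hjt⟩
        have := (key t hjt).2 ht
        refine ⟨by rw [hjt, Complex.ofReal_im], ?_⟩
        rwa [hjt, Complex.ofReal_re])
    refine ⟨r, hr0, ?_⟩
    rw [← hr, slitBlaschke]
    simp

theorem IsFiniteUnionOfIntervals.subset_closure_interior {E : Set ℝ}
    (hE : IsFiniteUnionOfIntervals E) : E ⊆ closure (interior E) := by
  obtain ⟨S, -, rfl, hS⟩ := hE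
  rintro x ⟨J, hJ, hxJ⟩
  obtain ⟨-, hord, hne⟩ := hS J hJ
  have hconvex : Convex ℝ J := hord.convex
  have h1 := hconvex.closure_interior_eq_closure_of_nonempty_interior hne
  have h2 : x ∈ closure (interior J) := h1 ▸ subset_closure hxJ
  exact closure_mono (interior_mono (subset_sUnion_of_mem hJ)) h2

theorem IsSlitParam.continuousAt_slitBlaschke (h : IsSlitParam α β a b c) {n : ℕ}
    {z : Fin n → ℂ} (hz : ∀ j, z j ∉ complexCut α β) {x : ℝ} (hx : x ∉ realCut α β) :
    ContinuousAt (fun t : ℝ => slitBlaschke a b β z t) x := by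
  have hxc : (x : ℂ) ∉ complexCut α β := by simpa using hx
  have hs : ContinuousAt (slitRoot a b β) (x : ℂ) :=
    (h.differentiableOn_root.differentiableAt
      ((isClosed_complexCut α β).isOpen_compl.mem_nhds hxc)).continuousAt
  have hs' : ContinuousAt (fun t : ℝ => slitRoot a b β t) x :=
    ContinuousAt.comp (f := fun t : ℝ => (t : ℂ)) hs Complex.continuous_ofReal.continuousAt
  simp only [slitBlaschke]
  refine tendsto_finsetProd _ fun j _ => ?_
  exact (hs'.sub continuousAt_const).div (hs'.add continuousAt_const)
    (h.root_add_ne_zero hxc (hz j))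

/-- In the positive case the Blaschke product is nonnegative on `E`. -/
theorem IsSlitParam.slitBlaschke_nonneg_of_positiveCase (h : IsSlitParam α β a b c) {m : ℕ}
    {z : Fin (2 * m) → ℂ} (hz : ∀ j, z j ∉ complexCut α β)
    (hconj : ∀ w : ℂ, pointMultiplicity z (starRingEnd ℂ w) = pointMultiplicity z w)
    {E : Set ℝ} (hE : ∀ x ∈ E, x ∉ realCut α β) (hpos : PositiveCase α β E z)
    {x : ℝ} (hx : x ∈ E) {B : ℝ} (hB : slitBlaschke a b β z x = B) : 0 ≤ B := by
  rcases hpos with heven | ⟨hunion, hint, hcomp⟩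
  · obtain ⟨r, hr0, hr⟩ := h.slitBlaschke_nonneg hz hconj (hE x hx) fun p q _ _ _ =>
      even_card_of_even_pointMultiplicity _ heven
    have : B = r := by exact_mod_cast hB.symm.trans hr
    rwa [this]
  -- the parity condition gives the sign on `Int E` only; `E` is in the closure of `Int E`
  · have hinterior : ∀ t ∈ interior E, 0 ≤ (slitBlaschke a b β z t).re := by
      intro t ht
      have hmem : ∀ p : ℝ, (p = t ∨ p ∈ realCut α β) → p ∈ interior E ∪ realCut α β := by
        rintro p (rfl | hp)
        · exact Or.inl ht
        · exact Or.inr hp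
      obtain ⟨r, hr0, hr⟩ := h.slitBlaschke_nonneg hz hconj (hE t (interior_subset ht))
        fun p q hp hq hI => even_card_of_components (hmem p hp) (hmem q hq) hI hint hcomp
      rwa [hr, Complex.ofReal_re]
    have hcont : ContinuousAt (fun t : ℝ => (slitBlaschke a b β z t).re) x :=
      Complex.continuous_re.continuousAt.comp (h.continuousAt_slitBlaschke hz (hE x hx))
    have := mem_closure_iff_nhdsWithin_neBot.1 (hunion.subset_closure_interior hx)
    have h1 : 0 ≤ (slitBlaschke a b β z x).re :=
      ge_of_tendsto (hcont.tendsto.mono_left nhdsWithin_le_nhds : Filter.Tendsto _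
        (nhdsWithin x (interior E)) _) (by
        filter_upwards [self_mem_nhdsWithin] with t ht using hinterior t ht)
    rwa [hB, Complex.ofReal_re] at h1

end Parity

/-! ### From pointwise bounds to supremum norms -/

section SupNorm

theorem supNormOn_le_supNormOn {E : Set ℝ} {g g' : ℂ → ℂ}
    (h : ∀ x ∈ E, ‖g (x : ℂ)‖ ≤ ‖g' (x : ℂ)‖) : supNormOn E g ≤ supNormOn E g' :=
  iSup₂_mono fun x hx => by simpa only [enorm_le_iff_norm_le] using h x hx

theorem supNormOn_le_mul_supNormOn {E : Set ℝ} {g g' : ℂ → ℂ} {C : ℝ} (hC : 0 ≤ C)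
    (h : ∀ x ∈ E, ‖g (x : ℂ)‖ ≤ C * ‖g' (x : ℂ)‖) :
    supNormOn E g ≤ ENNReal.ofReal C * supNormOn E g' := by
  refine iSup₂_le fun x hx => ?_
  calc ‖g (x : ℂ)‖ₑ ≤ ENNReal.ofReal (C * ‖g' (x : ℂ)‖) := by
        rw [← ofReal_norm]
        exact ENNReal.ofReal_le_ofReal (h x hx)
    _ = ENNReal.ofReal C * ‖g' (x : ℂ)‖ₑ := by
        rw [ENNReal.ofReal_mul hC, ofReal_norm]
    _ ≤ ENNReal.ofReal C * supNormOn E g' :=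
        mul_le_mul_right (le_iSup₂ (f := fun (x : ℝ) (_ : x ∈ E) => ‖g' (x : ℂ)‖ₑ) x hx) _

/-- The bound `4t / (1 - t)²` is increasing in `t`, and `+∞` for `t ≥ 1`. -/
theorem ofReal_four_mul_div_le {t : ℝ} {η : ENNReal} (h : ENNReal.ofReal t ≤ η) :
    ENNReal.ofReal (4 * t / (1 - t) ^ 2) ≤ 4 * η / (1 - η) ^ 2 := by
  rcases le_or_gt 1 η with hη | hη
  · have h1 : (4 : ENNReal) * η ≠ 0 :=
      mul_ne_zero (by norm_num) (zero_lt_one.trans_le hη).ne'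
    rw [tsub_eq_zero_of_le hη, zero_pow two_ne_zero, ENNReal.div_zero h1]
    exact le_top
  · have htop : η ≠ ⊤ := hη.ne_top
    lift η to NNReal using htop
    have hη1 : (η : ℝ) < 1 := by exact_mod_cast hη
    have hη0 : (0 : ℝ) ≤ η := η.coe_nonneg
    have htη : t ≤ η := by
      rwa [← ENNReal.ofReal_coe_nnreal, ENNReal.ofReal_le_ofReal_iff hη0] at h
    have hval : (4 : ENNReal) * η / (1 - η) ^ 2 = ENNReal.ofReal (4 * η / (1 - η) ^ 2) := by
      rw [ENNReal.ofReal_div_of_pos (pow_pos (sub_pos.2 hη1) 2),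
        ENNReal.ofReal_pow (sub_pos.2 hη1).le, ENNReal.ofReal_sub _ hη0, ENNReal.ofReal_one,
        ENNReal.ofReal_mul (by norm_num), ENNReal.ofReal_coe_nnreal]
      norm_num
    rw [hval]
    refine ENNReal.ofReal_le_ofReal ?_
    have h1 : (0 : ℝ) < 1 - η := sub_pos.2 hη1
    gcongr

end SupNorm

theorem theorem2p1 (α : EReal) (β : ℝ) (hαβ : α < (β : EReal))
    (μ : Measure ℝ) (hμ : IsMarkovMeasure α β μ)
    (E : Set ℝ) (hE : ∀ x ∈ E, x ∉ realCut α β)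
    (m : ℕ) (hm : 0 < m) (z : Fin (2 * m) → ℂ)
    (hz : ∀ j, z j ∉ complexCut α β)
    (hconj : ∀ w : ℂ, pointMultiplicity z (starRingEnd ℂ w) = pointMultiplicity z w) :
    -- the interpolants `r_m^{[μ]}` and `r_m^{[ν]}` are well defined
    (∃! r : RatFunc ℂ, IsRationalInterpolant m z (markov μ) r) ∧
    (∃! r : RatFunc ℂ, IsRationalInterpolant m z (markov (nu α β)) r) ∧
    ∀ rμ rν : RatFunc ℂ, IsRationalInterpolant m z (markov μ) rμ →
      IsRationalInterpolant m z (markov (nu α β)) rν →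
      -- the relative errors make sense on `E`
      (∀ x ∈ E, markov μ (x : ℂ) ≠ 0 ∧ rμ.denom.eval (x : ℂ) ≠ 0 ∧
        markov (nu α β) (x : ℂ) ≠ 0 ∧ rν.denom.eval (x : ℂ) ≠ 0) ∧
      -- the positive case
      (PositiveCase α β E z →
        relError E (markov μ) rμ ≤ 2 * relError E (markov (nu α β)) rν ∧
        ∀ φ, IsConformalExteriorMap α β φ →
          2 * relError E (markov (nu α β)) rν ≤ 4 * eta φ E z) ∧
      -- the general case
      (relError E (markov μ) rμ ≤
          supNormOn E (fun x => 1 - (ratVal rν x / markov (nu α β) x) ^ 2) ∧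
        ∀ φ, IsConformalExteriorMap α β φ →
          supNormOn E (fun x => 1 - (ratVal rν x / markov (nu α β) x) ^ 2) ≤
            4 * eta φ E z / (1 - eta φ E z) ^ 2) := by
  obtain ⟨a, b, c, h⟩ := exists_isSlitParam hαβ
  obtain ⟨rμ₀, rν₀, hrμ₀, hrν₀, hpt⟩ := h.exists_interpolants hμ hm hz hconj
  refine ⟨⟨rμ₀, hrμ₀, fun r hr => hr.unique hrμ₀⟩, ⟨rν₀, hrν₀, fun r hr => hr.unique hrν₀⟩, ?_⟩
  intro rμ rν hrμ hrν
  obtain rfl := hrμ.unique hrμ₀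
  obtain rfl := hrν.unique hrν₀
  -- with `rν / f^{[ν]} = (1 - B) / (1 + B)` both errors for `ν` are explicit in `B`
  have hsq : ∀ x ∈ E, ∀ B : ℝ, |B| < 1 →
      ratVal rν x / markov (nu α β) x = ((1 - B) / (1 + B) : ℝ) →
      ‖1 - (ratVal rν x / markov (nu α β) x) ^ 2‖ = 4 * |B| / (1 + B) ^ 2 := by
    intro x _ B hB hr
    have h1 : 0 < 1 + B := by linarith [(abs_lt.1 hB).1]
    have h2 : 1 - ((1 - B) / (1 + B)) ^ 2 = 4 * B / (1 + B) ^ 2 := by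
      field_simp
      ring
    rw [hr, ← Complex.ofReal_pow, ← Complex.ofReal_one, ← Complex.ofReal_sub, h2,
      Complex.norm_real, Real.norm_eq_abs, abs_div, abs_mul, abs_of_pos (pow_pos h1 2)]
    norm_num
  have hlin : ∀ x ∈ E, ∀ B : ℝ, 0 ≤ B →
      ratVal rν x / markov (nu α β) x = ((1 - B) / (1 + B) : ℝ) →
      ‖(markov (nu α β) x - ratVal rν x) / markov (nu α β) x‖ = 2 * B / (1 + B) := by
    intro x hx B hB hr
    have h1 : 0 < 1 + B := by linarith
    have h2 : 1 - (1 - B) / (1 + B) = 2 * B / (1 + B) := by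
      field_simp
      ring
    rw [sub_div, div_self (hpt x (hE x hx)).2.2.1, hr, ← Complex.ofReal_one,
      ← Complex.ofReal_sub, h2, Complex.norm_real, Real.norm_eq_abs, abs_of_nonneg (by positivity)]
  refine ⟨fun x hx => ?_, fun hpos => ⟨?_, fun φ hφ => ?_⟩, ?_, fun φ hφ => ?_⟩
  · obtain ⟨h1, h2, h3, h4, -⟩ := hpt x (hE x hx)
    exact ⟨h1, h2, h3, h4⟩
  · have := supNormOn_le_mul_supNormOn (E := E) (C := 2)
      (g := fun x => (markov μ x - ratVal rμ x) / markov μ x)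
      (g' := fun x => (markov (nu α β) x - ratVal rν x) / markov (nu α β) x) zero_le_two ?_
    · simpa only [relError, ENNReal.ofReal_ofNat] using this
    intro x hx
    obtain ⟨-, -, -, -, B, -, hBx, hr, herr⟩ := hpt x (hE x hx)
    have hB := h.slitBlaschke_nonneg_of_positiveCase hz hconj hE hpos hx hBx
    rw [hlin x hx B hB hr]
    refine herr.trans ?_
    rw [abs_of_nonneg hB, ← mul_div_assoc, div_le_div_iff₀ (by positivity) (by positivity)]
    nlinarith [mul_nonneg hB hB, mul_nonneg (mul_nonneg hB hB) hB]
  · have := supNormOn_le_mul_supNormOn (E := E) (C := 2)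
      (g := fun x => (markov (nu α β) x - ratVal rν x) / markov (nu α β) x)
      (g' := blaschkeProduct φ z) zero_le_two ?_
    · calc 2 * relError E (markov (nu α β)) rν ≤ 2 * (2 * eta φ E z) :=
            mul_le_mul_right (by simpa only [relError, eta, ENNReal.ofReal_ofNat] using this) _
        _ = 4 * eta φ E z := by
            rw [← mul_assoc]
            norm_num
    intro x hx
    obtain ⟨-, -, -, -, B, -, hBx, hr, -⟩ := hpt x (hE x hx)
    have hB := h.slitBlaschke_nonneg_of_positiveCase hz hconj hE hpos hx hBx
    have hle := h.slitBlaschke_le hφ hz (hE x hx)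
    rw [hBx, Complex.norm_real, Real.norm_eq_abs, abs_of_nonneg hB] at hle
    rw [hlin x hx B hB hr]
    calc 2 * B / (1 + B) ≤ 2 * B := div_le_self (by positivity) (by linarith)
      _ ≤ 2 * ‖blaschkeProduct φ z x‖ := by linarith
  · refine supNormOn_le_supNormOn fun x hx => ?_
    obtain ⟨-, -, -, -, B, hB1, -, hr, herr⟩ := hpt x (hE x hx)
    exact herr.trans (hsq x hx B hB1 hr).ge
  · refine iSup₂_le fun x hx => ?_
    obtain ⟨-, -, -, -, B, hB1, hBx, hr, -⟩ := hpt x (hE x hx)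
    have hle := h.slitBlaschke_le hφ hz (hE x hx)
    rw [hBx, Complex.norm_real, Real.norm_eq_abs] at hle
    have hη : ENNReal.ofReal |B| ≤ eta φ E z := by
      refine (ENNReal.ofReal_le_ofReal hle).trans ?_
      rw [ofReal_norm]
      exact le_iSup₂ (f := fun (x : ℝ) (_ : x ∈ E) => ‖blaschkeProduct φ z (x : ℂ)‖ₑ) x hx
    refine le_trans ?_ (ofReal_four_mul_div_le hη)
    rw [← ofReal_norm, hsq x hx B hB1 hr]
    refine ENNReal.ofReal_le_ofReal ?_
    have h1 : 0 < 1 - |B| := by linarith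
    have h2 : 1 - |B| ≤ 1 + B := by linarith [neg_abs_le B]
    gcongr
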